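/- **Spaces.** Let $\mathrm{Top}$ be a category with finite limits and finite colimits, with terminal object $1$, equipped with an object $I$ with two points $0,1:1\to I$ such that for every object $X$ and points $a,b:1\to X$ there is an object of paths $X(a,b)$, representing the morphisms $Z\times I\to X$ that are constant at $a$ on $Z\times\{0\}$ and constant at $b$ on $Z\times\{1\}$. (This holds for every complete, cocomplete, cartesian closed category with a bipointed object $I$, for instance compactly generated Hausdorff spaces, and also for all topological spaces with $I=[0,1]$.) For a category $V$, let $\mathcal GV$ be the category of graphs enriched in $V$: an object is a set of objects together with a hom $X(a,b)\in V$ for all $a,b$. Let $P:\mathrm{Top}\to\mathcal G\mathrm{Top}$ send $X$ to the graph whose objects are the points of $X$ and whose homs are the path objects $X(a,b)$. **Trimble $n$-categories.** For a non-symmetric operad $A$ in a category $V$ with finite products, an $A$-category is a $V$-enriched graph $X$ with maps $A_k\times X(x_0,x_1)\times\dots\times X(x_{k-1},x_k)\to X(x_0,x_k)$ compatible with the unit and composition of $A$; these form a category $\mathrm{Cat}_A$ over $\mathcal GV$. Suppose that a non-symmetric operad $A$ in $\mathrm{Top}$ acts on path spaces, i.e. $P$ lifts to a functor $P_A:\mathrm{Top}\to\mathrm{Cat}_A$.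 Define categories $\mathrm{Trm}_n$ and finite product preserving functors $\pi_n:\mathrm{Top}\to\mathrm{Trm}_n$ by: $\mathrm{Trm}_0=\mathrm{Set}$ and $\pi_0$ is the path components functor; $\mathrm{Trm}_{n+1}=\mathrm{Cat}_{\pi_nA}$ and $\pi_{n+1}$ is $P_A$ followed by application of $\pi_n$ to the homs. Let $U_n:\mathrm{Trm}_n\to\mathcal G^n\mathrm{Set}$ be the resulting forgetful functor to $n$-globular sets. **Contractibility.** The operad $A$ is contractible if every $A_k\to1$ has the right lifting property with respect to the maps $S^{m-1}\to D^m$ ($m\ge0$) obtained by applying to $\emptyset\to1$ iterates of the suspension $X\mapsto\sigma X=(X\times I)\sqcup_{X+X}(1+1)$. Let $T_{\le n}$ be the monad on $\mathcal G^n\mathrm{Set}$ whose category of algebras over $\mathcal G^n\mathrm{Set}$ is the category of strict $n$-categories. A $T_{\le n}$-operad is a monad $S$ on $\mathcal G^n\mathrm{Set}$ with a monad morphism $\phi:S\to T_{\le n}$ whose naturality squares are pullbacks and whose components are bijective on objects (no condition if $n=0$). Let $I_{\le0}=\{\emptyset\to1,\ 1+1\to1\}$, and let $I_{\le n+1}$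 consist of the map from the empty graph to the graph with one object and initial hom, and of the maps $(i):(S)\to(B)$ for $i:S\to B$ in $I_{\le n}$, where $(Z)$ is the graph with objects $0,1$, hom $Z$ from $0$ to $1$, and all other homs initial. The operad is contractible if all components of $\phi$ have the right lifting property with respect to $I_{\le n}$. **Theorem.** If $A$ is a contractible operad acting on path spaces as above, then for every $n\ge0$ there is a contractible $T_{\le n}$-operad $S$ such that $\mathrm{Trm}_n$ is equivalent, over $\mathcal G^n\mathrm{Set}$, to the category of $S$-algebras. In particular this holds for Trimble's weak $n$-categories, that is, for topological spaces with $I=[0,1]$ and with $A_k$ the space of endpoint preserving continuous maps $[0,1]\to[0,k]$, acting on path spaces by concatenating $k$ consecutive paths to a path $[0,k]\to X$ and reparametrising. -/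

import Mathlib

set_option linter.unusedVariables false

open CategoryTheory CategoryTheory.Limits

universe v u u'

/-! ### Graphs enriched in a category -/

/-- A graph enriched in `V`: a set of objects and a hom in `V` for each ordered pair of objects. -/
structure EGraph (V : Type u) [Category.{v} V] where
  obj : Type v
  hom : obj → obj → V

namespace EGraph

variable {V : Type u} [Category.{v} V] {W : Type u'} [Category.{v} W]

/-- A morphism of enriched graphs: an object function together with hom maps. -/
structure Hom (X Y : EGraph V) where
  obj : X.obj → Y.obj
  hom : ∀ a b, X.hom a b ⟶ Y.hom (obj a) (obj b)

instance : Category.{v} (EGraph V) where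
  Hom := Hom
  id X := ⟨id, fun _ _ => 𝟙 _⟩
  comp f g := ⟨g.obj ∘ f.obj, fun a b => f.hom a b ≫ g.hom _ _⟩
  id_comp f := by cases f; simp
  comp_id f := by cases f; simp
  assoc f g h := by simp; rfl

@[simp] lemma id_obj (X : EGraph V) (a : X.obj) : (𝟙 X : Hom X X).obj a = a := rfl
@[simp] lemma id_hom (X : EGraph V) (a b : X.obj) : (𝟙 X : Hom X X).hom a b = 𝟙 _ := rfl
@[simp] lemma comp_obj {X Y Z : EGraph V} (f : X ⟶ Y) (g : Y ⟶ Z) (a : X.obj) :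
    (f ≫ g : Hom X Z).obj a = g.obj (f.obj a) := rfl
@[simp] lemma comp_hom {X Y Z : EGraph V} (f : X ⟶ Y) (g : Y ⟶ Z) (a b : X.obj) :
    (f ≫ g : Hom X Z).hom a b = f.hom a b ≫ g.hom _ _ := rfl

lemma hom_ext {X Y : EGraph V} {f g : X ⟶ Y} (h : ∀ a, f.obj a = g.obj a)
    (h' : ∀ a b, f.hom a b ≫ eqToHom (by rw [h, h]) = g.hom a b) : f = g := by
  obtain ⟨fo, fh⟩ := f
  obtain ⟨go, gh⟩ := g
  obtain rfl : fo = go := funext h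
  have : fh = gh := by
    funext a b
    simpa using h' a b
  rw [this]

/-- The functor between categories of enriched graphs obtained by applying `F` to all homs. -/
def map (F : V ⥤ W) : EGraph V ⥤ EGraph W where
  obj X := ⟨X.obj, fun a b => F.obj (X.hom a b)⟩
  map f := ⟨f.obj, fun a b => F.map (f.hom a b)⟩
  map_id X := by
    refine hom_ext (fun _ => rfl) fun a b => ?_
    simp [id_hom]
  map_comp f g := by
    refine hom_ext (fun _ => rfl) fun a b => ?_
    simp [comp_hom]

lemma hom_congr {X Y : EGraph V} {f g : X ⟶ Y} (h : f = g) (a b : X.obj) :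
    f.hom a b ≫ eqToHom (by rw [h]) = g.hom a b := by
  subst h
  simp

/-- A fan of enriched graphs which is a product on objects and on homs is a product. -/
lemma isLimit_fan {J : Type*} {X : J → EGraph V} (P : EGraph V) (p : ∀ j, P ⟶ X j)
    (hb : Function.Bijective (fun (x : P.obj) (j : J) => (p j).obj x))
    (hl : ∀ (a b : P.obj) (Z : V) (f : ∀ j, Z ⟶ (X j).hom ((p j).obj a) ((p j).obj b)),
      ∃! u : Z ⟶ P.hom a b, ∀ j, u ≫ (p j).hom a b = f j) :
    Nonempty (IsLimit (Fan.mk P p)) := by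
  have key : ∀ (S : EGraph V) (s : ∀ j, S ⟶ X j), ∃! u : S ⟶ P, ∀ j, u ≫ p j = s j := by
    intro S s
    choose l hl' using fun (x : S.obj) => hb.2 fun j => (s j).obj x
    have hlj : ∀ x j, (p j).obj (l x) = (s j).obj x := fun x j => congrFun (hl' x) j
    choose h hh huniq using fun a b => hl (l a) (l b) (S.hom a b) fun j =>
      (s j).hom a b ≫ eqToHom (by rw [hlj, hlj])
    refine ⟨⟨l, h⟩, fun j => hom_ext (fun a => hlj a j) fun a b => ?_, fun m hm => ?_⟩
    · rw [comp_hom]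
      dsimp only
      rw [hh a b j]
      simp
    · have ho : ∀ a, m.obj a = l a := fun a => hb.1 (by
        funext j
        dsimp only
        rw [hlj a j, ← hm j, comp_obj])
      refine hom_ext ho fun a b => huniq a b _ fun j => ?_
      have h1 := hom_congr (hm j) a b
      rw [comp_hom] at h1
      rw [← h1, Category.assoc, Category.assoc]
      clear h1
      obtain ⟨mo, mh⟩ := m
      obtain rfl : mo = l := funext ho
      simp
  choose l hl hu using key
  exact ⟨Fan.IsLimit.mk _ (fun s => l s.pt s.proj) (fun s j => hl s.pt s.proj j)
    (fun s _ hm => hu s.pt s.proj _ hm)⟩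

lemma exists_unique_of_isLimit {J : Type*} {X : J → V} {P : V} {p : ∀ j, P ⟶ X j}
    (h : IsLimit (Fan.mk P p)) (Z : V) (f : ∀ j, Z ⟶ X j) :
    ∃! u : Z ⟶ P, ∀ j, u ≫ p j = f j :=
  ⟨Fan.IsLimit.lift h f, fun j => Fan.IsLimit.fac h f j, fun m hm =>
    Fan.IsLimit.hom_ext h _ _ fun j => (hm j).trans (Fan.IsLimit.fac h f j).symm⟩

/-- The product of a finite family of enriched graphs. -/
noncomputable def pi [HasFiniteProducts V] {n : ℕ} (X : Fin n → EGraph V) : EGraph V :=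
  ⟨∀ j, (X j).obj, fun a b => ∏ᶜ fun j => (X j).hom (a j) (b j)⟩

noncomputable def piProj [HasFiniteProducts V] {n : ℕ} (X : Fin n → EGraph V) (j : Fin n) :
    pi X ⟶ X j :=
  ⟨fun a => a j, fun a b => Pi.π (fun j => (X j).hom (a j) (b j)) j⟩

lemma isLimit_pi [HasFiniteProducts V] {n : ℕ} (X : Fin n → EGraph V) :
    Nonempty (IsLimit (Fan.mk (pi X) (piProj X))) :=
  isLimit_fan _ _ Function.bijective_id fun _ _ =>
    exists_unique_of_isLimit (productIsProduct _)

instance [HasFiniteProducts V] : HasFiniteProducts (EGraph V) where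
  out n :=
    haveI : ∀ X : Fin n → EGraph V, HasProduct X := fun X => ⟨⟨⟨_, (isLimit_pi X).some⟩⟩⟩
    { has_limit := fun _ => hasLimit_of_iso Discrete.natIsoFunctor.symm }

lemma preservesFiniteProducts_of_fan {C : Type*} [Category* C] {D : Type*} [Category* D]
    (F : C ⥤ D)
    (h : ∀ (n : ℕ) (X : Fin n → C), ∃ (P : C) (p : ∀ j, P ⟶ X j),
      Nonempty (IsLimit (Fan.mk P p)) ∧
      Nonempty (IsLimit (Fan.mk (F.obj P) fun j => F.map (p j)))) :
    PreservesFiniteProducts F where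
  preserves n := by
    apply +allowSynthFailures preservesLimitsOfShape_of_discrete
    intro X
    obtain ⟨P, p, ⟨h1⟩, ⟨h2⟩⟩ := h n X
    exact preservesLimit_of_preserves_limit_cone h1
      ((isLimitMapConeFanMkEquiv F X p).symm h2)

instance [HasFiniteProducts V] (F : V ⥤ W) [PreservesFiniteProducts F] :
    PreservesFiniteProducts (map F) :=
  preservesFiniteProducts_of_fan _ fun n X => ⟨_, _, isLimit_pi X,
    isLimit_fan _ _ Function.bijective_id fun a b =>
      exists_unique_of_isLimit (isLimitMapConeFanMkEquiv F _ _ (isLimitOfPreserves F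
        (productIsProduct fun j => (X j).hom (a j) (b j))))⟩

instance : HasInitial (EGraph V) :=
  haveI : ∀ Y : EGraph V, Unique ((⟨PEmpty, fun a => a.elim⟩ : EGraph V) ⟶ Y) := fun Y =>
    { default := ⟨fun a => a.elim, fun a => a.elim⟩
      uniq := fun f => hom_ext (fun a => a.elim) fun a => a.elim }
  hasInitial_of_unique (⟨PEmpty, fun a => a.elim⟩ : EGraph V)

end EGraph

/-! ### Non-symmetric operads -/

section Operads

variable {V : Type u} [Category.{v} V] [HasFiniteProducts V]

lemma sum_concat {k : ℕ} (m : Fin k → ℕ) (n : ∀ i, Fin (m i) → ℕ) (n' : Fin (∑ i, m i) → ℕ)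
    (h : ∀ i j, n' (finSigmaFinEquiv ⟨i, j⟩) = n i j) :
    ∑ l, n' l = ∑ i, ∑ j, n i j := by
  rw [← Equiv.sum_comp finSigmaFinEquiv, Fintype.sum_sigma]
  simp [h]

variable (V) in
/-- A non-symmetric operad in the cartesian monoidal category `V`. The axioms are expressed by
means of generalized elements; `finSigmaFinEquiv ⟨i, j⟩` is the position of the `j`-th entry of
the `i`-th block in a concatenation of blocks of sizes `m i`. -/
structure NSOperad where
  obj : ℕ → V
  one : ⊤_ V ⟶ obj 1
  comp : ∀ {k : ℕ} (m : Fin k → ℕ), obj k ⨯ (∏ᶜ fun i => obj (m i)) ⟶ obj (∑ i, m i)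
  one_comp : ∀ {Z : V} (n : ℕ) (a : Z ⟶ obj n),
    prod.lift (terminal.from Z ≫ one) (Pi.lift fun _ : Fin 1 => a) ≫ comp (fun _ => n) =
      a ≫ eqToHom (by simp)
  comp_one : ∀ {Z : V} (n : ℕ) (a : Z ⟶ obj n),
    prod.lift a (Pi.lift fun _ : Fin n => terminal.from Z ≫ one) ≫ comp (fun _ => 1) =
      a ≫ eqToHom (by simp)
  assoc : ∀ {Z : V} {k : ℕ} (m : Fin k → ℕ) (n : ∀ i, Fin (m i) → ℕ)
    (n' : Fin (∑ i, m i) → ℕ) (hn : ∀ i j, n' (finSigmaFinEquiv ⟨i, j⟩) = n i j)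
    (a : Z ⟶ obj k) (b : ∀ i, Z ⟶ obj (m i)) (c : ∀ i j, Z ⟶ obj (n i j))
    (c' : ∀ l, Z ⟶ obj (n' l))
    (_ : ∀ i j, c' (finSigmaFinEquiv ⟨i, j⟩) = c i j ≫ eqToHom (by rw [hn])),
    prod.lift (prod.lift a (Pi.lift b) ≫ comp m) (Pi.lift c') ≫ comp n' =
      prod.lift a (Pi.lift fun i => prod.lift (b i) (Pi.lift (c i)) ≫ comp (n i)) ≫
        comp (fun i => ∑ j, n i j) ≫ eqToHom (by rw [sum_concat m n n' hn])

section mapElem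

variable {D : Type u'} [Category.{v} D] [HasFiniteProducts D] (Q : V ⥤ D)
  [PreservesFiniteProducts Q]

instance isIso_comparison {n : ℕ} (X : V) (Y : Fin n → V) :
    IsIso (prod.lift (Q.map prod.fst) (Pi.lift fun i => Q.map (prod.snd ≫ Pi.π Y i)) :
      Q.obj (X ⨯ ∏ᶜ Y) ⟶ Q.obj X ⨯ ∏ᶜ fun i => Q.obj (Y i)) := by
  have : (prod.lift (Q.map prod.fst) (Pi.lift fun i => Q.map (prod.snd ≫ Pi.π Y i)) :
      Q.obj (X ⨯ ∏ᶜ Y) ⟶ Q.obj X ⨯ ∏ᶜ fun i => Q.obj (Y i)) =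
      prodComparison Q X (∏ᶜ Y) ≫ prod.map (𝟙 _) (piComparison Q Y) := by
    ext <;> simp [prodComparison, prod.lift_fst, prod.lift_snd]
  rw [this]
  infer_instance

/-- The canonical map `Q X × ∏ Q Yᵢ ⟶ Q (X × ∏ Yᵢ)` for a product preserving functor `Q`. -/
noncomputable def comparisonInv {n : ℕ} (X : V) (Y : Fin n → V) :
    (Q.obj X ⨯ ∏ᶜ fun i => Q.obj (Y i)) ⟶ Q.obj (X ⨯ ∏ᶜ Y) :=
  inv (prod.lift (Q.map prod.fst) (Pi.lift fun i => Q.map (prod.snd ≫ Pi.π Y i)))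

lemma lift_comparisonInv {n : ℕ} {X : V} {Y : Fin n → V} {Z : D} {Z' : V} (w : Z ⟶ Q.obj Z')
    (a : Z' ⟶ X) (f : ∀ i, Z' ⟶ Y i) {b : Z ⟶ Q.obj X} {g : ∀ i, Z ⟶ Q.obj (Y i)}
    (hb : b = w ≫ Q.map a) (hg : ∀ i, g i = w ≫ Q.map (f i)) :
    prod.lift b (Pi.lift g) ≫ comparisonInv Q X Y = w ≫ Q.map (prod.lift a (Pi.lift f)) := by
  obtain rfl : g = fun i => w ≫ Q.map (f i) := funext hg
  subst hb
  rw [comparisonInv, IsIso.comp_inv_eq]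
  ext <;> simp [← Functor.map_comp, prod.lift_fst, prod.lift_snd,
    prod.lift_snd_assoc]

lemma exists_elem {J : Type} [Finite J] {Y : J → V} {Z : D} (g : ∀ j, Z ⟶ Q.obj (Y j)) :
    ∃ (Z' : V) (w : Z ⟶ Q.obj Z') (f : ∀ j, Z' ⟶ Y j), ∀ j, g j = w ≫ Q.map (f j) :=
  ⟨∏ᶜ Y, Pi.lift g ≫ inv (piComparison Q Y), Pi.π Y, fun j => by
    rw [Category.assoc, ← piComparison_comp_π, IsIso.inv_hom_id_assoc]; simp⟩

lemma exists_concat {C : Type*} [Category* C] {k : ℕ} {m : Fin k → ℕ} {Z : C}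
    {B : Fin (∑ i, m i) → C} {B' : ∀ i, Fin (m i) → C}
    (h : ∀ i j, B' i j = B (finSigmaFinEquiv ⟨i, j⟩)) (f : ∀ i j, Z ⟶ B' i j) :
    ∃ g : ∀ l, Z ⟶ B l, ∀ i j, g (finSigmaFinEquiv ⟨i, j⟩) = f i j ≫ eqToHom (h i j) := by
  exact ⟨_, fun i j => Equiv.piCongrLeft_apply_apply (P := fun l => Z ⟶ B l) finSigmaFinEquiv
    (fun x => f x.1 x.2 ≫ eqToHom (h x.1 x.2)) ⟨i, j⟩⟩

lemma one_elem (A : NSOperad V) {Z : D} {Z' : V} (w : Z ⟶ Q.obj Z') :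
    terminal.from Z ≫ inv (terminalComparison Q) ≫ Q.map A.one =
      w ≫ Q.map (terminal.from Z' ≫ A.one) := by
  rw [Q.map_comp]
  simp only [← Category.assoc]
  congr 1
  rw [IsIso.comp_inv_eq]
  apply Subsingleton.elim

/-- The image of an operad under a product preserving functor. -/
noncomputable def NSOperad.map (A : NSOperad V) : NSOperad D where
  obj n := Q.obj (A.obj n)
  one := inv (terminalComparison Q) ≫ Q.map A.one
  comp m := comparisonInv Q _ _ ≫ Q.map (A.comp m)
  one_comp {Z} n a := by
    rw [← Category.assoc, lift_comparisonInv Q a (terminal.from _ ≫ A.one) (fun _ => 𝟙 _)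
      _ (by simp)]
    · rw [Category.assoc, ← Q.map_comp, A.one_comp]
      simp [eqToHom_map]
    · exact one_elem Q A a
  comp_one {Z} n a := by
    rw [← Category.assoc, lift_comparisonInv Q a (𝟙 _) (fun _ => terminal.from _ ≫ A.one)
      (by simp)]
    · rw [Category.assoc, ← Q.map_comp, A.comp_one]
      simp [eqToHom_map]
    · intro i
      exact one_elem Q A a
  assoc {Z} k m n n' hn a b c c' hc := by
    obtain ⟨Z', w, f, hf⟩ := exists_elem Q (J := Unit ⊕ Fin k ⊕ (Σ i, Fin (m i)))
      (Y := Sum.elim (fun _ => A.obj k) (Sum.elim (fun i => A.obj (m i))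
        fun x => A.obj (n x.1 x.2)))
      (fun j => match j with
        | .inl _ => a
        | .inr (.inl i) => b i
        | .inr (.inr x) => c x.1 x.2)
    let a₀ : Z' ⟶ A.obj k := f (.inl ())
    let b₀ : ∀ i, Z' ⟶ A.obj (m i) := fun i => f (.inr (.inl i))
    let c₀ : ∀ i j, Z' ⟶ A.obj (n i j) := fun i j => f (.inr (.inr ⟨i, j⟩))
    have ha : a = w ≫ Q.map a₀ := hf (.inl ())
    have hb : ∀ i, b i = w ≫ Q.map (b₀ i) := fun i => hf (.inr (.inl i))
    have hc₀ : ∀ i j, c i j = w ≫ Q.map (c₀ i j) := fun i j => hf (.inr (.inr ⟨i, j⟩))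
    obtain ⟨c₀', hc₁⟩ := exists_concat (B := fun l => A.obj (n' l))
      (fun i j => congrArg A.obj (hn i j).symm) c₀
    have hc' : ∀ l, c' l = w ≫ Q.map (c₀' l) := by
      intro l
      obtain ⟨⟨i, j⟩, rfl⟩ := finSigmaFinEquiv.surjective l
      rw [hc, hc₁, hc₀]
      simp [eqToHom_map]
    have e1 := lift_comparisonInv Q w a₀ b₀ ha hb
    have e2 : ∀ i, _ := fun i => lift_comparisonInv Q w (b₀ i) (c₀ i) (hb i) (hc₀ i)
    have key := A.assoc m n n' hn a₀ b₀ c₀ c₀' hc₁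
    have f1 : prod.lift a (Pi.lift b) ≫ comparisonInv Q _ _ ≫ Q.map (A.comp m) =
        w ≫ Q.map (prod.lift a₀ (Pi.lift b₀) ≫ A.comp m) := by
      rw [← Category.assoc, e1]; simp
    have f2 : ∀ i, prod.lift (b i) (Pi.lift (c i)) ≫ comparisonInv Q _ _ ≫ Q.map (A.comp (n i)) =
        w ≫ Q.map (prod.lift (b₀ i) (Pi.lift (c₀ i)) ≫ A.comp (n i)) := by
      intro i
      rw [← Category.assoc, e2]; simp
    have e3 := lift_comparisonInv Q w _ _ f1 hc'
    have e4 := lift_comparisonInv Q w _ _ ha f2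
    rw [← Category.assoc, e3, Category.assoc, ← Q.map_comp, key]
    refine Eq.trans ?_ (congrArg (fun t => t ≫ Q.map (A.comp fun i => ∑ j, n i j) ≫
      eqToHom (by rw [sum_concat m n n' hn])) e4.symm) |>.trans ?_ <;> simp [eqToHom_map]

end mapElem

/-- The terminal operad: all the objects of operations are terminal. -/
noncomputable def NSOperad.terminal (V : Type u) [Category.{v} V] [HasFiniteProducts V] :
    NSOperad V where
  obj _ := ⊤_ V
  one := 𝟙 _
  comp _ := Limits.terminal.from _
  one_comp _ _ := Subsingleton.elim _ _
  comp_one _ _ := Subsingleton.elim _ _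
  assoc _ _ _ _ _ _ _ _ _ := Subsingleton.elim _ _

/-! ### Categories enriched over an operad -/

/-- A sequence `x₀ = a, x₁, …, xₙ = b` of elements of `α`. -/
structure Chain (α : Type v) (n : ℕ) (a b : α) where
  pt : Fin (n + 1) → α
  first : pt 0 = a
  last : pt (Fin.last n) = b

namespace Chain

variable {α β : Type v} {n : ℕ} {a b : α}

/-- The `i`-th step of a chain starts at `src i` and ends at `tgt i`. -/
abbrev src (p : Chain α n a b) (i : Fin n) : α := p.pt i.castSucc

abbrev tgt (p : Chain α n a b) (i : Fin n) : α := p.pt i.succ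

abbrev map (f : α → β) (p : Chain α n a b) : Chain β n (f a) (f b) :=
  ⟨fun i => f (p.pt i), congrArg f p.first, congrArg f p.last⟩

/-- The chain `r` is the concatenation of the chains `q i`, the `i`-th of which leads from
the start to the end of the `i`-th step of `p`. -/
structure IsConcat {k : ℕ} {m : Fin k → ℕ} (p : Chain α k a b)
    (q : ∀ i, Chain α (m i) (p.src i) (p.tgt i)) (r : Chain α (∑ i, m i) a b) : Prop where
  src : ∀ i j, r.src (finSigmaFinEquiv ⟨i, j⟩) = (q i).src j
  tgt : ∀ i j, r.tgt (finSigmaFinEquiv ⟨i, j⟩) = (q i).tgt j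

lemma IsConcat.map {k : ℕ} {m : Fin k → ℕ} {p : Chain α k a b}
    {q : ∀ i, Chain α (m i) (p.src i) (p.tgt i)} {r : Chain α (∑ i, m i) a b}
    (h : IsConcat p q r) (f : α → β) :
    IsConcat (p.map f) (fun i => (q i).map f) (r.map f) :=
  ⟨fun i j => congrArg f (h.src i j), fun i j => congrArg f (h.tgt i j)⟩

end Chain

/-- A category enriched in the multitensor `(X₁, …, Xₙ) ↦ A n × X₁ × ⋯ × Xₙ` of an operad `A`. -/
structure OpCat (A : NSOperad V) extends EGraph V where
  act : ∀ {n : ℕ} {a b : obj} (p : Chain obj n a b),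
    A.obj n ⨯ (∏ᶜ fun i => hom (p.src i) (p.tgt i)) ⟶ hom a b
  act_one : ∀ {a b : obj} (p : Chain obj 1 a b) {Z : V}
    (f : ∀ i, Z ⟶ hom (p.src i) (p.tgt i)),
    prod.lift (terminal.from Z ≫ A.one) (Pi.lift f) ≫ act p =
      f 0 ≫ eqToHom (congrArg₂ hom p.first p.last)
  act_comp : ∀ {k : ℕ} {m : Fin k → ℕ} {a b : obj} (p : Chain obj k a b)
    (q : ∀ i, Chain obj (m i) (p.src i) (p.tgt i)) (r : Chain obj (∑ i, m i) a b)
    (h : p.IsConcat q r) {Z : V} (x : Z ⟶ A.obj k) (y : ∀ i, Z ⟶ A.obj (m i))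
    (f : ∀ i j, Z ⟶ hom ((q i).src j) ((q i).tgt j)) (g : ∀ l, Z ⟶ hom (r.src l) (r.tgt l))
    (_ : ∀ i j, g (finSigmaFinEquiv ⟨i, j⟩) =
      f i j ≫ eqToHom (congrArg₂ hom (h.src i j).symm (h.tgt i j).symm)),
    prod.lift (prod.lift x (Pi.lift y) ≫ A.comp m) (Pi.lift g) ≫ act r =
      prod.lift x (Pi.lift fun i => prod.lift (y i) (Pi.lift (f i)) ≫ act (q i)) ≫ act p

namespace OpCat

variable {A : NSOperad V}

/-- The action of an `A`-category on generalized elements. -/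
noncomputable def op (X : OpCat A) {n : ℕ} {a b : X.obj} (p : Chain X.obj n a b) {Z : V}
    (x : Z ⟶ A.obj n) (f : ∀ i, Z ⟶ X.hom (p.src i) (p.tgt i)) : Z ⟶ X.hom a b :=
  prod.lift x (Pi.lift f) ≫ X.act p

lemma comp_op (X : OpCat A) {n : ℕ} {a b : X.obj} (p : Chain X.obj n a b) {Z Z' : V}
    (w : Z' ⟶ Z) (x : Z ⟶ A.obj n) (f : ∀ i, Z ⟶ X.hom (p.src i) (p.tgt i)) :
    w ≫ X.op p x f = X.op p (w ≫ x) (fun i => w ≫ f i) := by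
  rw [op, op, ← Category.assoc]
  congr 1
  ext <;> simp [prod.lift_fst, prod.lift_snd]

/-- A functor of `A`-categories: a morphism of enriched graphs compatible with the actions. -/
structure Hom (X Y : OpCat A) where
  graph : X.toEGraph ⟶ Y.toEGraph
  comm : ∀ {n : ℕ} {a b : X.obj} (p : Chain X.obj n a b) {Z : V} (x : Z ⟶ A.obj n)
    (f : ∀ i, Z ⟶ X.hom (p.src i) (p.tgt i)),
    X.op p x f ≫ graph.hom a b =
      Y.op (p.map graph.obj) x (fun i => f i ≫ graph.hom (p.src i) (p.tgt i))

lemma Hom.ext' {X Y : OpCat A} {f g : Hom X Y} (h : f.graph = g.graph) : f = g := by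
  cases f; cases g; cases h; rfl

noncomputable instance : Category.{v} (OpCat A) where
  Hom := Hom
  id X := ⟨𝟙 _, fun p _ x f =>
    (Category.comp_id _).trans (congrArg (X.op p x) (funext fun _ => (Category.comp_id _).symm))⟩
  comp {X Y Z} f g := ⟨f.graph ≫ g.graph, fun p _ x h =>
    (Category.assoc _ _ _).symm.trans <| (congrArg (· ≫ _) (f.comm p x h)).trans <|
      (g.comm _ x _).trans (congrArg (Z.op _ x) (funext fun _ => Category.assoc _ _ _))⟩
  id_comp f := Hom.ext' (Category.id_comp _)
  comp_id f := Hom.ext' (Category.comp_id _)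
  assoc f g h := Hom.ext' (Category.assoc _ _ _)

lemma hom_ext {X Y : OpCat A} {f g : X ⟶ Y} (h : Hom.graph f = Hom.graph g) : f = g := Hom.ext' h

variable (A) in
/-- The forgetful functor from `A`-categories to enriched graphs. -/
def forget : OpCat A ⥤ EGraph V where
  obj X := X.toEGraph
  map f := Hom.graph f

lemma _root_.Chain.src_congr {α : Type v} {n : ℕ} {a b a' b' : α} {p : Chain α n a b}
    {p' : Chain α n a' b'} (hp : p.pt = p'.pt) (i : Fin n) : p.src i = p'.src i :=
  congrFun hp _

lemma _root_.Chain.tgt_congr {α : Type v} {n : ℕ} {a b a' b' : α} {p : Chain α n a b}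
    {p' : Chain α n a' b'} (hp : p.pt = p'.pt) (i : Fin n) : p.tgt i = p'.tgt i :=
  congrFun hp _

lemma op_congr (X : OpCat A) {n : ℕ} {a b a' b' : X.obj} (ha : a = a') (hb : b = b')
    (p : Chain X.obj n a b) (p' : Chain X.obj n a' b') (hp : p.pt = p'.pt) {Z : V}
    (x : Z ⟶ A.obj n) (f : ∀ i, Z ⟶ X.hom (p.src i) (p.tgt i))
    (f' : ∀ i, Z ⟶ X.hom (p'.src i) (p'.tgt i))
    (hf : ∀ i, f i ≫ eqToHom (congrArg₂ X.hom (Chain.src_congr hp i) (Chain.tgt_congr hp i)) =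
      f' i) :
    X.op p x f ≫ eqToHom (congrArg₂ X.hom ha hb) = X.op p' x f' := by
  subst ha hb
  obtain ⟨q, h1, h2⟩ := p
  obtain ⟨q', h3, h4⟩ := p'
  obtain rfl : q = q' := hp
  obtain rfl : f = f' := by
    funext i
    simpa using hf i
  simp

instance : (forget A).ReflectsIsomorphisms where
  reflects {X Y} f hf := by
    let φ : X.toEGraph ⟶ Y.toEGraph := (forget A).map f
    obtain ⟨ψ, h1, h2⟩ : ∃ ψ : Y.toEGraph ⟶ X.toEGraph,
      φ ≫ ψ = 𝟙 X.toEGraph ∧ ψ ≫ φ = 𝟙 Y.toEGraph := hf.out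
    have ho : ∀ c, c = φ.obj (ψ.obj c) :=
      fun c => (congrArg (fun t => EGraph.Hom.obj t c) h2).symm
    have e2 : ∀ a b, ψ.hom a b ≫ φ.hom (ψ.obj a) (ψ.obj b) =
        eqToHom (congrArg₂ Y.hom (ho a) (ho b)) := fun a b => by
      have := EGraph.hom_congr h2.symm a b
      rw [EGraph.id_hom, EGraph.comp_hom, Category.id_comp] at this
      exact this.symm
    have hmono : ∀ a b, Mono (φ.hom a b) := fun a b => by
      have := EGraph.hom_congr h1.symm a b
      rw [EGraph.id_hom, EGraph.comp_hom, Category.id_comp] at this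
      exact mono_of_mono_fac this.symm
    let g : Y ⟶ X :=
      { graph := ψ
        comm := fun {n a b} p Z x f' => by
          rw [← cancel_mono (φ.hom (ψ.obj a) (ψ.obj b)), Category.assoc, e2]
          refine Eq.trans ?_ (Hom.comm f (p.map ψ.obj) x _).symm
          exact op_congr Y (ho a) (ho b) p _ (funext fun i => ho _) x f' _ fun i =>
            ((Category.assoc _ _ _).trans (congrArg (f' i ≫ ·) (e2 _ _))).symm }
    exact ⟨g, hom_ext h1, hom_ext h2⟩

lemma op_one (X : OpCat A) {a b : X.obj} (p : Chain X.obj 1 a b) {Z : V}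
    (f : ∀ i, Z ⟶ X.hom (p.src i) (p.tgt i)) :
    X.op p (terminal.from Z ≫ A.one) f = f 0 ≫ eqToHom (congrArg₂ X.hom p.first p.last) :=
  X.act_one p f

lemma op_comp (X : OpCat A) {k : ℕ} {m : Fin k → ℕ} {a b : X.obj} (p : Chain X.obj k a b)
    (q : ∀ i, Chain X.obj (m i) (p.src i) (p.tgt i)) (r : Chain X.obj (∑ i, m i) a b)
    (h : p.IsConcat q r) {Z : V} (x : Z ⟶ A.obj k) (y : ∀ i, Z ⟶ A.obj (m i))
    (f : ∀ i j, Z ⟶ X.hom ((q i).src j) ((q i).tgt j))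
    (g : ∀ l, Z ⟶ X.hom (r.src l) (r.tgt l))
    (hg : ∀ i j, g (finSigmaFinEquiv ⟨i, j⟩) =
      f i j ≫ eqToHom (congrArg₂ X.hom (h.src i j).symm (h.tgt i j).symm)) :
    X.op r (prod.lift x (Pi.lift y) ≫ A.comp m) g =
      X.op p x fun i => X.op (q i) (y i) (f i) :=
  X.act_comp p q r h x y f g hg

lemma lift_elem {B Z : V} {n : ℕ} {Y : Fin n → V} (x : Z ⟶ B) (f : ∀ i, Z ⟶ Y i) (i : Fin n) :
    prod.lift x (Pi.lift f) ≫ prod.snd ≫ Pi.π Y i = f i := by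
  rw [prod.lift_snd_assoc, Pi.lift_π]

/-- An `A`-category from an action on generalized elements. -/
noncomputable def ofOp (X : EGraph V)
    (op : ∀ {n : ℕ} {a b : X.obj} (p : Chain X.obj n a b) {Z : V} (_ : Z ⟶ A.obj n)
      (_ : ∀ i, Z ⟶ X.hom (p.src i) (p.tgt i)), Z ⟶ X.hom a b)
    (nat : ∀ {n : ℕ} {a b : X.obj} (p : Chain X.obj n a b) {Z Z' : V} (w : Z' ⟶ Z)
      (x : Z ⟶ A.obj n) (f : ∀ i, Z ⟶ X.hom (p.src i) (p.tgt i)),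
      w ≫ op p x f = op p (w ≫ x) (fun i => w ≫ f i))
    (op_one : ∀ {a b : X.obj} (p : Chain X.obj 1 a b) {Z : V}
      (f : ∀ i, Z ⟶ X.hom (p.src i) (p.tgt i)),
      op p (terminal.from Z ≫ A.one) f = f 0 ≫ eqToHom (congrArg₂ X.hom p.first p.last))
    (op_comp : ∀ {k : ℕ} {m : Fin k → ℕ} {a b : X.obj} (p : Chain X.obj k a b)
      (q : ∀ i, Chain X.obj (m i) (p.src i) (p.tgt i)) (r : Chain X.obj (∑ i, m i) a b)
      (h : p.IsConcat q r) {Z : V} (x : Z ⟶ A.obj k) (y : ∀ i, Z ⟶ A.obj (m i))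
      (f : ∀ i j, Z ⟶ X.hom ((q i).src j) ((q i).tgt j))
      (g : ∀ l, Z ⟶ X.hom (r.src l) (r.tgt l))
      (_ : ∀ i j, g (finSigmaFinEquiv ⟨i, j⟩) =
        f i j ≫ eqToHom (congrArg₂ X.hom (h.src i j).symm (h.tgt i j).symm)),
      op r (prod.lift x (Pi.lift y) ≫ A.comp m) g = op p x fun i => op (q i) (y i) (f i)) :
    OpCat A :=
  have key : ∀ {n : ℕ} {a b : X.obj} (p : Chain X.obj n a b) {Z : V} (x : Z ⟶ A.obj n)
      (f : ∀ i, Z ⟶ X.hom (p.src i) (p.tgt i)),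
      prod.lift x (Pi.lift f) ≫ op p prod.fst (fun i =>
        prod.snd ≫ Pi.π (fun i => X.hom (p.src i) (p.tgt i)) i) = op p x f :=
    fun p _ x f => (nat p _ _ _).trans (congrArg₂ (fun x f => op p x f) (prod.lift_fst _ _)
      (funext fun i => lift_elem x f i))
  { toEGraph := X
    act := fun p => op p prod.fst fun i =>
      prod.snd ≫ Pi.π (fun i => X.hom (p.src i) (p.tgt i)) i
    act_one := fun p Z f => by rw [key, op_one]
    act_comp := fun p q r h Z x y f g hg => by
      simp only [key]
      exact op_comp p q r h x y f g hg }

lemma ofOp_op (X : EGraph V) (op nat op_one op_comp) {n : ℕ} {a b : X.obj}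
    (p : Chain X.obj n a b) {Z : V} (x : Z ⟶ A.obj n)
    (f : ∀ i, Z ⟶ X.hom (p.src i) (p.tgt i)) :
    (ofOp (A := A) X op nat op_one op_comp).op p x f = op p x f :=
  (nat p _ _ _).trans (congrArg₂ (fun x f => op p x f) (prod.lift_fst _ _)
    (funext fun i => lift_elem x f i))

lemma piProj_hom_eqToHom {N : ℕ} (X : Fin N → EGraph V) {a b a' b' : (EGraph.pi X).obj}
    (ha : a = a') (hb : b = b') (j : Fin N) :
    eqToHom (congrArg₂ (EGraph.pi X).hom ha hb) ≫ (EGraph.piProj X j).hom a' b' =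
      (EGraph.piProj X j).hom a b ≫
        eqToHom (congrArg₂ (X j).hom (congrArg (EGraph.piProj X j).obj ha)
          (congrArg (EGraph.piProj X j).obj hb)) := by
  subst ha hb
  exact (Category.id_comp _).trans (Category.comp_id _).symm

lemma pi_hom_ext {N : ℕ} {X : Fin N → EGraph V} {a b : (EGraph.pi X).obj} {Z : V}
    {f g : Z ⟶ (EGraph.pi X).hom a b}
    (h : ∀ j, f ≫ (EGraph.piProj X j).hom a b = g ≫ (EGraph.piProj X j).hom a b) : f = g :=
  Limits.Pi.hom_ext _ _ h

noncomputable def piLift {N : ℕ} {X : Fin N → EGraph V} {a b : (EGraph.pi X).obj} {Z : V}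
    (f : ∀ j, Z ⟶ (X j).hom ((EGraph.piProj X j).obj a) ((EGraph.piProj X j).obj b)) : Z ⟶ (EGraph.pi X).hom a b :=
  Pi.lift f

lemma piLift_proj {N : ℕ} {X : Fin N → EGraph V} {a b : (EGraph.pi X).obj} {Z : V}
    (f : ∀ j, Z ⟶ (X j).hom ((EGraph.piProj X j).obj a) ((EGraph.piProj X j).obj b)) (j : Fin N) :
    piLift f ≫ (EGraph.piProj X j).hom a b = f j :=
  Pi.lift_π _ _

/-- The product of a finite family of `A`-categories. -/
noncomputable def pi {N : ℕ} (X : Fin N → OpCat A) : OpCat A :=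
  let G := fun j => (X j).toEGraph
  ofOp (EGraph.pi G)
    (fun p _ x f => piLift fun j => (X j).op (p.map (EGraph.piProj G j).obj) x fun i =>
      f i ≫ (EGraph.piProj G j).hom (p.src i) (p.tgt i))
    (fun p Z Z' w x f => pi_hom_ext fun j => by
      rw [Category.assoc, piLift_proj, piLift_proj]
      exact (comp_op _ _ _ _ _).trans
        (congrArg _ (funext fun i => (Category.assoc _ _ _).symm)))
    (fun p Z f => pi_hom_ext fun j => by
      rw [piLift_proj, Category.assoc, piProj_hom_eqToHom _ p.first p.last]
      exact (op_one _ _ _).trans (Category.assoc _ _ _))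
    (fun p q r h Z x y f g hg => pi_hom_ext fun j => by
      rw [piLift_proj, piLift_proj]
      refine (op_comp (X j) (p.map (EGraph.piProj G j).obj)
        (fun i => (q i).map (EGraph.piProj G j).obj) (r.map (EGraph.piProj G j).obj)
        (h.map _) x y (fun i i' => f i i' ≫ (EGraph.piProj G j).hom _ _) _
        fun i i' => ?_).trans ?_
      · refine (congrArg (· ≫ _) (hg i i')).trans ?_
        rw [Category.assoc, Category.assoc]
        exact congrArg (f i i' ≫ ·)
          (piProj_hom_eqToHom _ (h.src i i').symm (h.tgt i i').symm j)
      · exact congrArg _ (funext fun i => (piLift_proj (X := G) (fun j =>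
          (X j).op ((q i).map (EGraph.piProj G j).obj) (y i) fun i' =>
            f i i' ≫ (EGraph.piProj G j).hom _ _) j).symm))

/-- The projections of the product of a finite family of `A`-categories. -/
noncomputable def piProj {N : ℕ} (X : Fin N → OpCat A) (j : Fin N) : pi X ⟶ X j where
  graph := EGraph.piProj (fun j => (X j).toEGraph) j
  comm p Z x f := (congrArg (· ≫ _) (ofOp_op _ _ _ _ _ p x f)).trans (piLift_proj _ _)

lemma isLimit_pi {N : ℕ} (X : Fin N → OpCat A) :
    Nonempty (IsLimit (Fan.mk (pi X) (piProj X))) := by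
  have key : ∀ (S : OpCat A) (s : ∀ j, S ⟶ X j), ∃! u : S ⟶ pi X, ∀ j, u ≫ piProj X j = s j := by
    intro S s
    obtain ⟨u, hu, hu'⟩ := EGraph.exists_unique_of_isLimit
      (EGraph.isLimit_pi fun j => (X j).toEGraph).some S.toEGraph fun j => Hom.graph (s j)
    let v : S ⟶ pi X :=
      { graph := ⟨fun a j => (Hom.graph (s j)).obj a,
          fun a b => piLift fun j => (Hom.graph (s j)).hom a b⟩
        comm := fun p Z x f => by
          refine Eq.trans ?_ (ofOp_op _ _ _ _ _ _ x _).symm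
          exact pi_hom_ext fun j => (Category.assoc _ _ _).trans <|
            (congrArg (S.op p x f ≫ ·) (piLift_proj _ j)).trans <|
            ((s j).comm p x f).trans <| Eq.symm <| (piLift_proj _ j).trans <|
            congrArg _ <| funext fun i => (Category.assoc _ _ _).trans <|
            congrArg (f i ≫ ·) (piLift_proj _ j) }
    have hv : ∀ j, v ≫ piProj X j = s j := fun j => hom_ext <|
      EGraph.hom_ext (fun _ => rfl) fun a b =>
        (congrArg (· ≫ eqToHom rfl) (piLift_proj _ j)).trans (Category.comp_id _)
    refine ⟨v, hv, fun w hw => hom_ext ((hu' _ fun j => ?_).trans (hu' _ fun j => ?_).symm)⟩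
    · exact congrArg Hom.graph (hw j)
    · exact congrArg Hom.graph (hv j)
  choose l hl hu using key
  exact ⟨Fan.IsLimit.mk _ (fun s => l s.pt s.proj) (fun s j => hl s.pt s.proj j)
    (fun s _ hm => hu s.pt s.proj _ hm)⟩

instance : HasFiniteProducts (OpCat A) where
  out n :=
    haveI : ∀ X : Fin n → OpCat A, HasProduct X := fun X => ⟨⟨⟨_, (isLimit_pi X).some⟩⟩⟩
    { has_limit := fun _ => hasLimit_of_iso Discrete.natIsoFunctor.symm }

instance : PreservesFiniteProducts (forget A) :=
  EGraph.preservesFiniteProducts_of_fan _ fun _ X => ⟨_, _, isLimit_pi X,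
    EGraph.isLimit_pi fun j => (X j).toEGraph⟩

instance : ReflectsFiniteProducts (forget A) where
  reflects _ := ⟨fun {F} => reflectsLimit_of_reflectsIsomorphisms F (forget A)⟩

section mapOp

variable {D : Type u'} [Category.{v} D] [HasFiniteProducts D] (Q : V ⥤ D)
  [PreservesFiniteProducts Q]

lemma map_comp_elem {Z : D} {Z' : V} (w : Z ⟶ Q.obj Z') {k : ℕ} {m : Fin k → ℕ}
    {x : Z ⟶ Q.obj (A.obj k)} {y : ∀ i, Z ⟶ Q.obj (A.obj (m i))}
    {x₀ : Z' ⟶ A.obj k} {y₀ : ∀ i, Z' ⟶ A.obj (m i)}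
    (hx : x = w ≫ Q.map x₀) (hy : ∀ i, y i = w ≫ Q.map (y₀ i)) :
    prod.lift x (Pi.lift y) ≫ (A.map Q).comp m =
      w ≫ Q.map (prod.lift x₀ (Pi.lift y₀) ≫ A.comp m) := by
  refine (Category.assoc _ _ _).symm.trans
    ((congrArg (· ≫ _) (lift_comparisonInv Q w x₀ y₀ hx hy)).trans ?_)
  exact (Category.assoc _ _ _).trans (congrArg (w ≫ ·) (Q.map_comp _ _).symm)

lemma map_act_elem (X : OpCat A) {Z : D} {Z' : V} (w : Z ⟶ Q.obj Z') {n : ℕ} {a b : X.obj}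
    (p : Chain X.obj n a b) {x : Z ⟶ Q.obj (A.obj n)}
    {f : ∀ i, Z ⟶ Q.obj (X.hom (p.src i) (p.tgt i))}
    {x₀ : Z' ⟶ A.obj n} {f₀ : ∀ i, Z' ⟶ X.hom (p.src i) (p.tgt i)}
    (hx : x = w ≫ Q.map x₀) (hf : ∀ i, f i = w ≫ Q.map (f₀ i)) :
    prod.lift x (Pi.lift f) ≫ comparisonInv Q _ _ ≫ Q.map (X.act p) =
      w ≫ Q.map (X.op p x₀ f₀) := by
  refine (Category.assoc _ _ _).symm.trans
    ((congrArg (· ≫ _) (lift_comparisonInv Q w x₀ f₀ hx hf)).trans ?_)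
  exact (Category.assoc _ _ _).trans (congrArg (w ≫ ·) (Q.map_comp _ _).symm)

/-- A product preserving functor `Q` sends `A`-categories to `Q A`-categories. -/
noncomputable def mapOp : OpCat A ⥤ OpCat (A.map Q) where
  obj X :=
    { toEGraph := (EGraph.map Q).obj X.toEGraph
      act := fun p => comparisonInv Q _ _ ≫ Q.map (X.act p)
      act_one := fun {a b} p Z f => by
        obtain ⟨Z', w, f₀, hf⟩ := exists_elem Q f
        refine (map_act_elem Q X w p (one_elem Q A w) hf).trans ?_
        refine (congrArg (fun t => w ≫ Q.map t) (X.op_one p f₀)).trans ?_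
        rw [hf 0]
        refine Eq.trans ?_ (Category.assoc _ _ _).symm
        refine congrArg (w ≫ ·) ((Q.map_comp _ _).trans (congrArg (Q.map (f₀ 0) ≫ ·) ?_))
        exact eqToHom_map _ _
      act_comp := fun {k m a b} p q r h Z x y f g hg => by
        obtain ⟨Z', w, e, he⟩ := exists_elem Q (J := Unit ⊕ Fin k ⊕ (Σ i, Fin (m i)))
          (Y := Sum.elim (fun _ => A.obj k) (Sum.elim (fun i => A.obj (m i))
            fun x => X.hom ((q x.1).src x.2) ((q x.1).tgt x.2)))
          (fun j => match j with
            | .inl _ => x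
            | .inr (.inl i) => y i
            | .inr (.inr x) => f x.1 x.2)
        have hx : x = w ≫ Q.map (e (.inl ())) := he (.inl ())
        have hy : ∀ i, y i = w ≫ Q.map (e (.inr (.inl i))) := fun i => he (.inr (.inl i))
        let f₀ : ∀ i j, Z' ⟶ X.hom ((q i).src j) ((q i).tgt j) :=
          fun i j => e (.inr (.inr ⟨i, j⟩))
        have hf : ∀ i j, f i j = w ≫ Q.map (f₀ i j) := fun i j => he (.inr (.inr ⟨i, j⟩))
        obtain ⟨g₀, hg₀⟩ := exists_concat (B := fun l => X.hom (r.src l) (r.tgt l))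
          (fun i j => congrArg₂ X.hom (h.src i j).symm (h.tgt i j).symm) f₀
        have hg' : ∀ l, g l = w ≫ Q.map (g₀ l) := by
          intro l
          obtain ⟨⟨i, j⟩, rfl⟩ := finSigmaFinEquiv.surjective l
          rw [hg, hg₀, hf]
          simp only [Q.map_comp, eqToHom_map]
          exact Category.assoc _ _ _
        refine (map_act_elem Q X w r (map_comp_elem Q w hx hy) hg').trans ?_
        refine (congrArg (fun t => w ≫ Q.map t) (op_comp X p q r h _ _ _ _ hg₀)).trans ?_
        exact (map_act_elem Q X w p hx fun i => map_act_elem Q X w (q i) (hy i) (hf i)).symm }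
  map {X Y} f :=
    { graph := (EGraph.map Q).map (Hom.graph f)
      comm := fun p Z x f' => by
        obtain ⟨Z', w, e, he⟩ := exists_elem Q (J := Option (Fin _))
          (Y := fun j => j.elim (A.obj _) fun i => X.hom (p.src i) (p.tgt i))
          (fun j => match j with
            | none => x
            | some i => f' i)
        have hx : x = w ≫ Q.map (e none) := he none
        have hf : ∀ i, f' i = w ≫ Q.map (e (some i)) := fun i => he (some i)
        refine (congrArg (· ≫ _) (map_act_elem Q X w p hx hf)).trans ?_
        refine Eq.trans ?_ (map_act_elem Q Y w (p.map (Hom.graph f).obj) hx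
          (f₀ := fun i => e (some i) ≫ (Hom.graph f).hom _ _) fun i => ?_).symm
        · refine (Category.assoc _ _ _).trans ?_
          exact congrArg (w ≫ ·) ((Q.map_comp _ _).symm.trans
            (congrArg Q.map (Hom.comm f p _ _)))
        · refine (congrArg (· ≫ _) (hf i)).trans ((Category.assoc _ _ _).trans ?_)
          exact congrArg (w ≫ ·) (Q.map_comp _ _).symm }
  map_id X := hom_ext ((EGraph.map Q).map_id _)
  map_comp f g := hom_ext ((EGraph.map Q).map_comp _ _)

instance : PreservesFiniteProducts (mapOp (A := A) Q) :=
  haveI : PreservesFiniteProducts (mapOp (A := A) Q ⋙ forget (A.map Q)) :=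
    inferInstanceAs (PreservesFiniteProducts (forget A ⋙ EGraph.map Q))
  preservesFiniteProducts_of_reflects_of_preserves _ (forget (A.map Q))

end mapOp

end OpCat

end Operads

/-! ### Globular sets, strict higher categories and contractible operads -/

namespace EGraph

variable {V : Type u} [Category.{v} V] [HasInitial V]

variable (V) in
/-- The enriched graph with one object, whose hom is initial. -/
noncomputable def point : EGraph V := ⟨PUnit, fun _ _ => ⊥_ V⟩

/-- The enriched graph with objects `false`, `true` and a single non-initial hom `Z`, leading from
`false` to `true`. -/
noncomputable def edge (Z : V) : EGraph V where
  obj := ULift Bool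
  hom a b := match a.down, b.down with
    | false, true => Z
    | _, _ => ⊥_ V

noncomputable def edgeMap {Z Z' : V} (f : Z ⟶ Z') : edge Z ⟶ edge Z' where
  obj a := a
  hom a b := match a, b with
    | ⟨false⟩, ⟨true⟩ => f
    | ⟨false⟩, ⟨false⟩ => 𝟙 (⊥_ V)
    | ⟨true⟩, ⟨false⟩ => 𝟙 (⊥_ V)
    | ⟨true⟩, ⟨true⟩ => 𝟙 (⊥_ V)

/-- The set of morphisms of enriched graphs consisting of the inclusion of the empty graph into
the one object graph, and of the morphisms `edge S ⟶ edge B` for `S ⟶ B` in `I`. -/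
inductive plus (I : MorphismProperty V) : MorphismProperty (EGraph V)
  | vertex : plus I (initial.to (point V))
  | edge {S B : V} (i : S ⟶ B) (hi : I i) : plus I (edgeMap i)

end EGraph

/-- The category of `n`-globular sets: `0`-globular sets are sets, and `(n+1)`-globular sets are
graphs enriched in `n`-globular sets. -/
def GlobCat : ℕ → Cat.{v, v + 1}
  | 0 => Cat.of (Type v)
  | n + 1 => Cat.of (EGraph (GlobCat n))

instance GlobCat.hasInitial : ∀ n, HasInitial (GlobCat.{v} n)
  | 0 => inferInstanceAs (HasInitial (Type v))
  | n + 1 => inferInstanceAs (HasInitial (EGraph (GlobCat n)))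

/-- The two generating morphisms `∅ ⟶ 1` and `1 + 1 ⟶ 1` of the category of sets. -/
inductive SetBoundaries : MorphismProperty (Type v)
  | empty : SetBoundaries (initial.to (⊤_ (Type v)))
  | fold : SetBoundaries (coprod.desc (𝟙 (⊤_ (Type v))) (𝟙 (⊤_ (Type v))))

/-- The inclusions of the boundaries of the `k`-globes for `k ≤ n`, together with the map
identifying the two parallel `n`-cells of the boundary of the `(n+1)`-globe. -/
def GlobBoundaries : ∀ n, MorphismProperty (GlobCat.{v} n)
  | 0 => SetBoundaries
  | n + 1 => EGraph.plus (GlobBoundaries n)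

/-- A category with finite products over the category of `n`-globular sets. -/
structure OverGlob (n : ℕ) where
  carrier : Type (v + 1)
  [cat : Category.{v} carrier]
  [prod : HasFiniteProducts carrier]
  U : carrier ⥤ GlobCat.{v} n

attribute [instance] OverGlob.cat OverGlob.prod

/-- The category of strict `n`-categories and strict `n`-functors, with its forgetful functor to
`n`-globular sets, by iterated enrichment in cartesian monoidal categories. -/
noncomputable def strictCat : ∀ n, OverGlob.{v} n
  | 0 => { carrier := Type v, prod := inferInstanceAs (HasFiniteProducts (Type v)), U := 𝟭 (Type v) }
  | n + 1 =>
    { carrier := OpCat (NSOperad.terminal (strictCat n).carrier)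
      U := OpCat.forget _ ⋙ EGraph.map (strictCat n).U }

/-- The functor `U : V ⥤ G` exhibits `V` as the category of algebras of the monad `T` on `G`, up
to equivalence over `G`. -/
def IsAlgebrasOf {G : Type*} [Category* G] (T : Monad G) {V : Type*} [Category* V]
    (U : V ⥤ G) : Prop :=
  ∃ e : V ≌ T.Algebra, Nonempty (e.functor ⋙ T.forget ≅ U)

/-- The monad `T` is the monad for strict `n`-categories. -/
def IsStrictMonad (n : ℕ) (T : Monad (GlobCat.{v} n)) : Prop :=
  IsAlgebrasOf T (strictCat n).U

/-- A morphism of `n`-globular sets is bijective on objects if `n = 0` or if it induces a bijection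
on `0`-cells. -/
def GlobCat.IsBijectiveOnObjects : ∀ (n : ℕ) {X Y : GlobCat.{v} n}, (X ⟶ Y) → Prop
  | 0, _, _, _ => True
  | _ + 1, _, _, f => Function.Bijective (EGraph.Hom.obj f)

/-- An operad over a monad `T` on `n`-globular sets: a monad with a cartesian monad morphism to `T`
which is bijective on objects. -/
structure GlobOperad {n : ℕ} (T : Monad (GlobCat.{v} n)) where
  monad : Monad (GlobCat.{v} n)
  proj : monad ⟶ T
  cartesian : proj.toNatTrans.Equifibered
  bijective : ∀ X, GlobCat.IsBijectiveOnObjects n (proj.toNatTrans.app X)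

/-- An operad over the monad for strict `n`-categories is contractible if its components are
trivial fibrations. -/
def GlobOperad.IsContractible {n : ℕ} {T : Monad (GlobCat.{v} n)} (S : GlobOperad T) : Prop :=
  ∀ X, (GlobBoundaries n).rlp (S.proj.toNatTrans.app X)

/-- The functor `U` exhibits its source as the category of algebras of a contractible operad over
the monad for strict `n`-categories. -/
def IsAlgebrasOfContractibleOperad (n : ℕ) {V : Type*} [Category* V] (U : V ⥤ GlobCat.{v} n) :
    Prop :=
  ∃ (T : Monad (GlobCat.{v} n)) (S : GlobOperad T),
    IsStrictMonad n T ∧ S.IsContractible ∧ IsAlgebrasOf S.monad U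

/-! ### Spaces, paths and the Trimble construction -/

/-- An interval in a category `C` with finite limits: an object `I` with two points, such that
for every object `X` and points `a`, `b` of `X` there is an object of paths from `a` to `b`, that is,
an object representing the maps `Z ⨯ I ⟶ X` which are constant with value `a` at the
start and constant with value `b` at the end of the interval. -/
structure PathInterval (C : Type u) [Category.{v} C] [HasFiniteLimits C] where
  I : C
  zero : ⊤_ C ⟶ I
  one : ⊤_ C ⟶ I
  path : ∀ {X : C}, (⊤_ C ⟶ X) → (⊤_ C ⟶ X) → C
  ev : ∀ {X : C} (a b : ⊤_ C ⟶ X), path a b ⨯ I ⟶ X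
  ev_zero : ∀ {X : C} (a b : ⊤_ C ⟶ X),
    prod.lift (𝟙 _) (terminal.from _ ≫ zero) ≫ ev a b = terminal.from _ ≫ a
  ev_one : ∀ {X : C} (a b : ⊤_ C ⟶ X),
    prod.lift (𝟙 _) (terminal.from _ ≫ one) ≫ ev a b = terminal.from _ ≫ b
  existsUnique : ∀ {X : C} (a b : ⊤_ C ⟶ X) {Z : C} (h : Z ⨯ I ⟶ X),
    prod.lift (𝟙 _) (terminal.from _ ≫ zero) ≫ h = terminal.from _ ≫ a →
    prod.lift (𝟙 _) (terminal.from _ ≫ one) ≫ h = terminal.from _ ≫ b →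
    ∃! u : Z ⟶ path a b, prod.map u (𝟙 I) ≫ ev a b = h

namespace PathInterval

variable {C : Type u} [Category.{v} C] [HasFiniteLimits C] (𝕀 : PathInterval C)

lemma lift_map {Z Z' W : C} (u : Z ⟶ Z') (p : ⊤_ C ⟶ W) :
    prod.lift (𝟙 Z) (terminal.from Z ≫ p) ≫ prod.map u (𝟙 W) =
      u ≫ prod.lift (𝟙 Z') (terminal.from Z' ≫ p) := by
  ext
  · simp [prod.lift_fst]
  · simp [prod.lift_snd, ← Category.assoc]

lemma zero_map_ev {X : C} {a b : ⊤_ C ⟶ X} {Z : C} (u : Z ⟶ 𝕀.path a b) :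
    prod.lift (𝟙 _) (terminal.from _ ≫ 𝕀.zero) ≫ prod.map u (𝟙 𝕀.I) ≫ 𝕀.ev a b =
      terminal.from _ ≫ a := by
  rw [← Category.assoc, lift_map, Category.assoc, 𝕀.ev_zero, ← Category.assoc]
  congr 1
  apply Subsingleton.elim

lemma one_map_ev {X : C} {a b : ⊤_ C ⟶ X} {Z : C} (u : Z ⟶ 𝕀.path a b) :
    prod.lift (𝟙 _) (terminal.from _ ≫ 𝕀.one) ≫ prod.map u (𝟙 𝕀.I) ≫ 𝕀.ev a b =
      terminal.from _ ≫ b := by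
  rw [← Category.assoc, lift_map, Category.assoc, 𝕀.ev_one, ← Category.assoc]
  congr 1
  apply Subsingleton.elim

lemma path_ext {X : C} {a b : ⊤_ C ⟶ X} {Z : C} {u u' : Z ⟶ 𝕀.path a b}
    (h : prod.map u (𝟙 𝕀.I) ≫ 𝕀.ev a b = prod.map u' (𝟙 𝕀.I) ≫ 𝕀.ev a b) : u = u' :=
  (𝕀.existsUnique a b _ (𝕀.zero_map_ev u') (𝕀.one_map_ev u')).unique h rfl

/-- The map into an object of paths given by a family of paths. -/
noncomputable def curry {X : C} (a b : ⊤_ C ⟶ X) {Z : C} (h : Z ⨯ 𝕀.I ⟶ X)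
    (h0 : prod.lift (𝟙 _) (terminal.from _ ≫ 𝕀.zero) ≫ h = terminal.from _ ≫ a)
    (h1 : prod.lift (𝟙 _) (terminal.from _ ≫ 𝕀.one) ≫ h = terminal.from _ ≫ b) :
    Z ⟶ 𝕀.path a b :=
  (𝕀.existsUnique a b h h0 h1).choose

lemma curry_ev {X : C} (a b : ⊤_ C ⟶ X) {Z : C} (h : Z ⨯ 𝕀.I ⟶ X) (h0) (h1) :
    prod.map (𝕀.curry a b h h0 h1) (𝟙 𝕀.I) ≫ 𝕀.ev a b = h :=
  (𝕀.existsUnique a b h h0 h1).choose_spec.1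

lemma map_comp_id {Z Z' Z'' W : C} (f : Z ⟶ Z') (g : Z' ⟶ Z'') :
    prod.map (f ≫ g) (𝟙 W) = prod.map f (𝟙 W) ≫ prod.map g (𝟙 W) := by simp

/-- The map of path objects induced by a morphism. -/
noncomputable def pathMap {X Y : C} (f : X ⟶ Y) (a b : ⊤_ C ⟶ X) :
    𝕀.path a b ⟶ 𝕀.path (a ≫ f) (b ≫ f) :=
  𝕀.curry _ _ (𝕀.ev a b ≫ f) (by rw [← Category.assoc, 𝕀.ev_zero, Category.assoc])
    (by rw [← Category.assoc, 𝕀.ev_one, Category.assoc])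

lemma pathMap_ev {X Y : C} (f : X ⟶ Y) (a b : ⊤_ C ⟶ X) :
    prod.map (𝕀.pathMap f a b) (𝟙 𝕀.I) ≫ 𝕀.ev _ _ = 𝕀.ev a b ≫ f :=
  𝕀.curry_ev _ _ _ _ _

lemma eqToHom_ev {X : C} {a b a' b' : ⊤_ C ⟶ X} (ha : a = a') (hb : b = b') :
    prod.map (eqToHom (congrArg₂ 𝕀.path ha hb)) (𝟙 𝕀.I) ≫ 𝕀.ev a' b' = 𝕀.ev a b := by
  subst ha hb
  simp

lemma pathMap_id (X : C) (a b : ⊤_ C ⟶ X) :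
    𝕀.pathMap (𝟙 X) a b ≫
      eqToHom (congrArg₂ 𝕀.path (Category.comp_id a) (Category.comp_id b)) = 𝟙 _ :=
  𝕀.path_ext <| by
    rw [map_comp_id, Category.assoc, eqToHom_ev _ (Category.comp_id a) (Category.comp_id b),
      pathMap_ev]
    simp

lemma pathMap_comp {X Y Z : C} (f : X ⟶ Y) (g : Y ⟶ Z) (a b : ⊤_ C ⟶ X) :
    𝕀.pathMap (f ≫ g) a b ≫ eqToHom (congrArg₂ 𝕀.path (Category.assoc a f g).symm
      (Category.assoc b f g).symm) = 𝕀.pathMap f a b ≫ 𝕀.pathMap g (a ≫ f) (b ≫ f) :=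
  𝕀.path_ext <| by
    rw [map_comp_id, Category.assoc,
      eqToHom_ev _ (Category.assoc a f g).symm (Category.assoc b f g).symm, pathMap_ev,
      map_comp_id, Category.assoc, pathMap_ev, ← Category.assoc (prod.map _ _), pathMap_ev,
      Category.assoc]

lemma existsUnique_pi {n : ℕ} (X : Fin n → C) (a b : ⊤_ C ⟶ ∏ᶜ X) (Z : C)
    (f : ∀ j, Z ⟶ 𝕀.path (a ≫ Pi.π X j) (b ≫ Pi.π X j)) :
    ∃! u : Z ⟶ 𝕀.path a b, ∀ j, u ≫ 𝕀.pathMap (Pi.π X j) a b = f j := by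
  have h0 : prod.lift (𝟙 _) (terminal.from Z ≫ 𝕀.zero) ≫
      Pi.lift (fun j => prod.map (f j) (𝟙 𝕀.I) ≫ 𝕀.ev (a ≫ Pi.π X j) (b ≫ Pi.π X j)) =
      terminal.from _ ≫ a := Limits.Pi.hom_ext _ _ fun j => by
    rw [Category.assoc, Pi.lift_π, zero_map_ev, Category.assoc]
  have h1 : prod.lift (𝟙 _) (terminal.from Z ≫ 𝕀.one) ≫
      Pi.lift (fun j => prod.map (f j) (𝟙 𝕀.I) ≫ 𝕀.ev (a ≫ Pi.π X j) (b ≫ Pi.π X j)) =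
      terminal.from _ ≫ b := Limits.Pi.hom_ext _ _ fun j => by
    rw [Category.assoc, Pi.lift_π, one_map_ev, Category.assoc]
  refine ⟨𝕀.curry a b _ h0 h1, fun j => 𝕀.path_ext ?_, fun m hm => 𝕀.path_ext ?_⟩
  · rw [map_comp_id, Category.assoc, pathMap_ev, ← Category.assoc, curry_ev, Pi.lift_π]
  · rw [curry_ev]
    refine Limits.Pi.hom_ext _ _ fun j => ?_
    rw [Category.assoc, Pi.lift_π, ← pathMap_ev, ← hm j, map_comp_id, Category.assoc]

/-- The functor sending a space `X` to the graph of points of `X` and spaces of paths. -/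
noncomputable def P : C ⥤ EGraph C where
  obj X := ⟨⊤_ C ⟶ X, fun a b => 𝕀.path a b⟩
  map f := ⟨fun a => a ≫ f, fun a b => 𝕀.pathMap f a b⟩
  map_id X := EGraph.hom_ext (fun a => Category.comp_id a) fun a b => 𝕀.pathMap_id X a b
  map_comp f g := EGraph.hom_ext (fun a => (Category.assoc a f g).symm) fun a b =>
    𝕀.pathMap_comp f g a b

instance : PreservesFiniteProducts 𝕀.P :=
  EGraph.preservesFiniteProducts_of_fan _ fun n X => ⟨∏ᶜ X, Pi.π X, ⟨productIsProduct X⟩,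
    EGraph.isLimit_fan _ _
      ⟨fun x y h => Limits.Pi.hom_ext _ _ fun j => congrFun h j,
        fun f => ⟨Pi.lift f, funext fun j => Pi.lift_π _ _⟩⟩
      (𝕀.existsUnique_pi X)⟩

/-- Two points of a space are related if there is a path between them. -/
def Joined {X : C} (a b : ⊤_ C ⟶ X) : Prop :=
  ∃ p : 𝕀.I ⟶ X, 𝕀.zero ≫ p = a ∧ 𝕀.one ≫ p = b

lemma Joined.map {X Y : C} {a b : ⊤_ C ⟶ X} (h : 𝕀.Joined a b) (f : X ⟶ Y) :
    𝕀.Joined (a ≫ f) (b ≫ f) := by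
  obtain ⟨p, rfl, rfl⟩ := h
  exact ⟨p ≫ f, by simp, by simp⟩

/-- The functor sending a space to its set of path components. -/
noncomputable def π₀ : C ⥤ Type v where
  obj X := Quot (𝕀.Joined (X := X))
  map f := ↾(Quot.map (fun a => a ≫ f) fun _ _ h => h.map 𝕀 f)
  map_id X := by
    ext x
    induction x using Quot.ind
    simp [Quot.map]
  map_comp f g := by
    ext x
    induction x using Quot.ind
    simp [Quot.map]

lemma Joined.refl {X : C} (a : ⊤_ C ⟶ X) : 𝕀.Joined a a :=
  ⟨terminal.from _ ≫ a, by rw [← Category.assoc, Subsingleton.elim (𝕀.zero ≫ _) (𝟙 _),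
    Category.id_comp], by rw [← Category.assoc, Subsingleton.elim (𝕀.one ≫ _) (𝟙 _),
    Category.id_comp]⟩

lemma joined_pi {n : ℕ} {X : Fin n → C} {a b : ⊤_ C ⟶ ∏ᶜ X}
    (h : ∀ j, 𝕀.Joined (a ≫ Pi.π X j) (b ≫ Pi.π X j)) : 𝕀.Joined a b := by
  choose p h0 h1 using h
  exact ⟨Pi.lift p, Limits.Pi.hom_ext _ _ fun j => by simp [h0],
    Limits.Pi.hom_ext _ _ fun j => by simp [h1]⟩

lemma eqvGen_pi {n : ℕ} {X : Fin n → C} (s : Finset (Fin n)) : ∀ {a b : ⊤_ C ⟶ ∏ᶜ X},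
    (∀ j, j ∉ s → a ≫ Pi.π X j = b ≫ Pi.π X j) →
    (∀ j, Relation.EqvGen 𝕀.Joined (a ≫ Pi.π X j) (b ≫ Pi.π X j)) →
    Relation.EqvGen 𝕀.Joined a b := by
  induction s using Finset.induction_on with
  | empty =>
    intro a b h _
    obtain rfl : a = b := Limits.Pi.hom_ext _ _ fun j => h j (by simp)
    exact .refl _
  | insert i s hi ih =>
    intro a b h h'
    let upd (x : ⊤_ C ⟶ X i) : ⊤_ C ⟶ ∏ᶜ X :=
      Pi.lift (Function.update (fun j => a ≫ Pi.π X j) i x)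
    have upd_same : ∀ x, upd x ≫ Pi.π X i = x := fun x => by simp [upd]
    have upd_ne : ∀ x j, j ≠ i → upd x ≫ Pi.π X j = a ≫ Pi.π X j :=
      fun x j hj => by simp [upd, hj]
    have key : ∀ x y, Relation.EqvGen 𝕀.Joined x y →
        Relation.EqvGen 𝕀.Joined (upd x) (upd y) := by
      intro x y hxy
      induction hxy with
      | rel x y hxy =>
        refine .rel _ _ (𝕀.joined_pi fun j => ?_)
        by_cases hj : j = i
        · subst hj
          rwa [upd_same, upd_same]
        · rw [upd_ne _ _ hj, upd_ne _ _ hj]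
          exact Joined.refl 𝕀 _
      | refl x => exact .refl _
      | symm x y _ h => exact .symm _ _ h
      | trans x y z _ _ h h' => exact .trans _ _ _ h h'
    have ha : upd (a ≫ Pi.π X i) = a := Limits.Pi.hom_ext _ _ fun j => by
      by_cases hj : j = i
      · subst hj
        rw [upd_same]
      · rw [upd_ne _ _ hj]
    have h1 := key _ _ (h' i)
    rw [ha] at h1
    refine .trans _ _ _ h1 (ih (fun j hj => ?_) fun j => ?_)
    · by_cases hji : j = i
      · subst hji
        rw [upd_same]
      · rw [upd_ne _ _ hji]
        exact h j (by simp [hji, hj])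
    · by_cases hji : j = i
      · subst hji
        rw [upd_same]
        exact .refl _
      · rw [upd_ne _ _ hji]
        exact h' j

instance : PreservesFiniteProducts 𝕀.π₀ :=
  EGraph.preservesFiniteProducts_of_fan _ fun n X => ⟨∏ᶜ X, Pi.π X, ⟨productIsProduct X⟩, by
    have hb : Function.Bijective fun (x : 𝕀.π₀.obj (∏ᶜ X)) (j : Fin n) =>
        𝕀.π₀.map (Pi.π X j) x := by
      constructor
      · intro x y
        induction x using Quot.ind with | _ x
        induction y using Quot.ind with | _ y
        intro h
        exact Quot.eqvGen_sound (𝕀.eqvGen_pi Finset.univ (by simp) fun j =>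
          Quot.eqvGen_exact (congrFun h j))
      · intro f
        choose g hg using fun j => Quot.exists_rep (f j)
        refine ⟨Quot.mk _ (Pi.lift g), funext fun j => Eq.trans ?_ (hg j)⟩
        exact congrArg (Quot.mk _) (Pi.lift_π _ _)
    obtain ⟨g, hg1, hg2⟩ := Function.bijective_iff_has_inverse.1 hb
    exact ⟨Fan.IsLimit.mk _ (fun s => ↾fun x => g fun j => s.proj j x)
      (fun s j => by
        ext x
        exact congrFun (hg2 fun j => s.proj j x) j)
      (fun s m hm => by
        ext x
        refine (hg1 (m x)).symm.trans (congrArg g (funext fun j => ?_))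
        exact ConcreteCategory.congr_hom (hm j) x)⟩⟩

/-! The suspension of spaces, and contractibility of operads. -/

section Suspension

variable [HasFiniteColimits C]

/-- The inclusion of the two ends of the cylinder on `X`. -/
noncomputable def ends (X : C) : X ⨿ X ⟶ X ⨯ 𝕀.I :=
  coprod.desc (prod.lift (𝟙 X) (terminal.from X ≫ 𝕀.zero))
    (prod.lift (𝟙 X) (terminal.from X ≫ 𝕀.one))

/-- The (unreduced) suspension of a space: the cylinder with each of its two ends collapsed to a
point. -/
noncomputable def susp (X : C) : C :=
  pushout (𝕀.ends X) (coprod.map (terminal.from X) (terminal.from X))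

noncomputable def suspMap {X Y : C} (f : X ⟶ Y) : 𝕀.susp X ⟶ 𝕀.susp Y :=
  pushout.map _ _ _ _ (prod.map f (𝟙 𝕀.I)) (𝟙 _) (coprod.map f f)
    (by
      ext
      · simp [ends, prod.lift_fst]
      · simp [ends, ← Category.assoc]
      · simp [ends, prod.lift_fst]
      · simp [ends, ← Category.assoc])
    (by ext <;> simp)

/-- The inclusions `Sⁿ⁻¹ ⟶ Dⁿ`, that is, the iterated suspensions of `∅ ⟶ 1`. -/
inductive Spheres : MorphismProperty C
  | empty : Spheres (initial.to (⊤_ C))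
  | susp {S D : C} (i : S ⟶ D) (hi : Spheres i) : Spheres (𝕀.suspMap i)

/-- An operad in spaces is contractible if all its spaces of operations have the right
lifting property with respect to the inclusions `Sⁿ⁻¹ ⟶ Dⁿ`. -/
def IsContractibleOperad (A : NSOperad C) : Prop :=
  ∀ k, 𝕀.Spheres.rlp (terminal.from (A.obj k))

end Suspension

/-- An action of an operad on path spaces: a natural composition of paths indexed by the
operad, that is, a factorization of the functor `P` through `A`-categories. -/
structure Action (A : NSOperad C) where
  lift : C ⥤ OpCat A
  iso : lift ⋙ OpCat.forget A ≅ 𝕀.P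

namespace Action

variable {𝕀} {A : NSOperad C} (α : 𝕀.Action A)

lemma preservesFiniteProducts : PreservesFiniteProducts α.lift :=
  haveI : PreservesFiniteProducts (α.lift ⋙ OpCat.forget A) :=
    ⟨fun n => preservesLimitsOfShape_of_natIso α.iso.symm⟩
  preservesFiniteProducts_of_reflects_of_preserves _ (OpCat.forget A)

variable (C) in
/-- A category with finite products over the category of `n`-globular sets, with a product
preserving functor from spaces into it. -/
structure _root_.TrimbleStage (n : ℕ) extends OverGlob.{v} n where
  Q : C ⥤ carrier
  preserves : PreservesFiniteProducts Q

attribute [instance] TrimbleStage.preserves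

/-- The category of Trimble `n`-categories associated to the action of an operad `A`, with its
forgetful functor `U` to `n`-globular sets and the fundamental `n`-groupoid functor `Q`. A Trimble
`(n+1)`-category is a category enriched over the operad `Q A` in Trimble `n`-categories. -/
noncomputable def trimble : ∀ n, TrimbleStage.{v} C n
  | 0 =>
    { carrier := Type v
      prod := inferInstanceAs (HasFiniteProducts (Type v))
      U := 𝟭 (Type v)
      Q := 𝕀.π₀
      preserves := inferInstance }
  | n + 1 =>
    { carrier := OpCat (A.map (trimble n).Q)
      U := OpCat.forget _ ⋙ EGraph.map (trimble n).U
      Q := α.lift ⋙ OpCat.mapOp (trimble n).Q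
      preserves :=
        haveI := α.preservesFiniteProducts
        inferInstance }

end Action

end PathInterval

/-! ### Topological spaces, the unit interval and the operad of reparametrisations -/

namespace TopInterval


/-- The unique point of the terminal space. -/
noncomputable def star : (⊤_ TopCat.{0} : TopCat.{0}) :=
  TopCat.terminalIsoPUnit.inv PUnit.unit

lemma eq_star (x : (⊤_ TopCat.{0} : TopCat.{0})) : x = star := by
  have : TopCat.terminalIsoPUnit.inv (TopCat.terminalIsoPUnit.hom x) = x := by
    rw [← ConcreteCategory.comp_apply, Iso.hom_inv_id]
    rfl
  exact this.symm

/-- The element of `X` corresponding to a morphism from the terminal space. -/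
noncomputable def pt {X : TopCat.{0}} (a : ⊤_ TopCat.{0} ⟶ X) : X := a star

lemma from_comp {X Z : TopCat.{0}} (a : ⊤_ TopCat.{0} ⟶ X) (z : Z) :
    (terminal.from Z ≫ a) z = pt a := by
  rw [ConcreteCategory.comp_apply, eq_star (terminal.from Z z)]
  rfl

/-- The pair of two elements as an element of the categorical product. -/
noncomputable def pair {X Y : TopCat.{0}} (x : X) (y : Y) : (X ⨯ Y : TopCat.{0}) :=
  (TopCat.prodIsoProd X Y).inv (x, y)

lemma pair_fst {X Y : TopCat.{0}} (x : X) (y : Y) : (prod.fst : X ⨯ Y ⟶ X) (pair x y) = x := by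
  rw [pair, ← ConcreteCategory.comp_apply, TopCat.prodIsoProd_inv_fst]
  rfl

lemma pair_snd {X Y : TopCat.{0}} (x : X) (y : Y) : (prod.snd : X ⨯ Y ⟶ Y) (pair x y) = y := by
  rw [pair, ← ConcreteCategory.comp_apply, TopCat.prodIsoProd_inv_snd]
  rfl

lemma prod_ext {X Y : TopCat.{0}} {u u' : (X ⨯ Y : TopCat.{0})}
    (h1 : (prod.fst : X ⨯ Y ⟶ X) u = (prod.fst : X ⨯ Y ⟶ X) u')
    (h2 : (prod.snd : X ⨯ Y ⟶ Y) u = (prod.snd : X ⨯ Y ⟶ Y) u') : u = u' := by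
  apply ((ConcreteCategory.bijective_of_isIso (TopCat.prodIsoProd X Y).hom).1)
  rw [TopCat.prodIsoProd_hom_apply, TopCat.prodIsoProd_hom_apply, h1, h2]

lemma continuous_pair {X Y : TopCat.{0}} : Continuous fun q : X × Y => pair q.1 q.2 :=
  (TopCat.prodIsoProd X Y).inv.hom.continuous

lemma lift_fst_apply {Z X Y : TopCat.{0}} (f : Z ⟶ X) (g : Z ⟶ Y) (z : Z) :
    (prod.fst : X ⨯ Y ⟶ X) (prod.lift f g z) = f z := by
  rw [← ConcreteCategory.comp_apply, prod.lift_fst]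

lemma lift_snd_apply {Z X Y : TopCat.{0}} (f : Z ⟶ X) (g : Z ⟶ Y) (z : Z) :
    (prod.snd : X ⨯ Y ⟶ Y) (prod.lift f g z) = g z := by
  rw [← ConcreteCategory.comp_apply, prod.lift_snd]

lemma lift_apply {Z X Y : TopCat.{0}} (f : Z ⟶ X) (g : Z ⟶ Y) (z : Z) :
    prod.lift f g z = pair (f z) (g z) :=
  prod_ext (by rw [lift_fst_apply, pair_fst]) (by rw [lift_snd_apply, pair_snd])

lemma map_pair {Z Z' W : TopCat.{0}} (u : Z ⟶ Z') (z : Z) (w : W) :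
    prod.map u (𝟙 W) (pair z w) = pair (u z) w :=
  prod_ext
    (by rw [← ConcreteCategory.comp_apply, prod.map_fst, ConcreteCategory.comp_apply, pair_fst,
          pair_fst])
    (by rw [← ConcreteCategory.comp_apply, prod.map_snd, Category.comp_id, pair_snd, pair_snd])

lemma pair_eta {X Y : TopCat.{0}} (u : (X ⨯ Y : TopCat.{0})) :
    pair ((prod.fst : X ⨯ Y ⟶ X) u) ((prod.snd : X ⨯ Y ⟶ Y) u) = u :=
  prod_ext (pair_fst _ _) (pair_snd _ _)

/-- The evaluation map on a space of paths. -/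
noncomputable def ev {X : TopCat.{0}} (a b : ⊤_ TopCat.{0} ⟶ X) :
    TopCat.of (Path (pt a) (pt b)) ⨯ TopCat.of unitInterval ⟶ X :=
  (TopCat.prodIsoProd _ _).hom ≫
    TopCat.ofHom ⟨fun q : Path (pt a) (pt b) × unitInterval => q.1 q.2, continuous_eval⟩

lemma ev_pair {X : TopCat.{0}} (a b : ⊤_ TopCat.{0} ⟶ X) (γ : Path (pt a) (pt b))
    (t : unitInterval) :
    ev a b (pair (X := TopCat.of (Path (pt a) (pt b))) (Y := TopCat.of unitInterval) γ t) =
      γ t := by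
  rw [ev, pair, ← ConcreteCategory.comp_apply, Iso.inv_hom_id_assoc]
  rfl

/-- The unit interval, with its spaces of paths in the compact-open topology. -/
noncomputable def unitPathInterval : PathInterval TopCat.{0} where
  I := TopCat.of unitInterval
  zero := TopCat.ofHom (ContinuousMap.const _ 0)
  one := TopCat.ofHom (ContinuousMap.const _ 1)
  path a b := TopCat.of (Path (pt a) (pt b))
  ev := ev
  ev_zero a b := by
    ext γ
    rw [from_comp, ConcreteCategory.comp_apply, lift_apply, from_comp]
    exact (ev_pair a b γ 0).trans γ.source
  ev_one a b := by
    ext γ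
    rw [from_comp, ConcreteCategory.comp_apply, lift_apply, from_comp]
    exact (ev_pair a b γ 1).trans γ.target
  existsUnique {X} a b Z h h0 h1 := by
    have h0' : ∀ z, h (pair z (0 : unitInterval)) = pt a := fun z => by
      have := ConcreteCategory.congr_hom h0 z
      rw [from_comp, ConcreteCategory.comp_apply, lift_apply, from_comp] at this
      exact this
    have h1' : ∀ z, h (pair z (1 : unitInterval)) = pt b := fun z => by
      have := ConcreteCategory.congr_hom h1 z
      rw [from_comp, ConcreteCategory.comp_apply, lift_apply, from_comp] at this
      exact this
    have hc : Continuous fun q : Z × unitInterval => h (pair q.1 (q.2 : TopCat.of unitInterval)) :=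
      h.hom.continuous.comp (continuous_pair (X := Z) (Y := TopCat.of unitInterval))
    let u : Z → Path (pt a) (pt b) := fun z =>
      { toFun := fun t => h (pair z (t : TopCat.of unitInterval))
        continuous_toFun := hc.comp (Continuous.prodMk_right z)
        source' := h0' z
        target' := h1' z }
    have hu : Continuous u := Path.continuous_uncurry_iff.1 hc
    refine ⟨TopCat.ofHom ⟨u, hu⟩, ?_, fun m hm => ?_⟩
    · ext q
      rw [← pair_eta q, ConcreteCategory.comp_apply, map_pair]
      exact ev_pair a b (u _) _
    · ext z t
      have := ConcreteCategory.congr_hom hm (pair z (t : TopCat.of unitInterval))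
      rw [ConcreteCategory.comp_apply, map_pair] at this
      exact (ev_pair a b (m z) t).symm.trans this

end TopInterval

namespace TopInterval

noncomputable def clamp (x : ℝ) : unitInterval := Set.projIcc 0 1 zero_le_one x

lemma continuous_clamp : Continuous clamp :=
  continuous_projIcc (h := zero_le_one)

lemma clamp_of_le {x : ℝ} (h : x ≤ 0) : clamp x = 0 := Set.projIcc_of_le_left _ h

lemma clamp_of_ge {x : ℝ} (h : 1 ≤ x) : clamp x = 1 := Set.projIcc_of_right_le _ h

lemma coe_clamp {x : ℝ} (h0 : 0 ≤ x) (h1 : x ≤ 1) : (clamp x : ℝ) = x := by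
  rw [clamp, Set.projIcc_of_mem _ (Set.mem_Icc.2 ⟨h0, h1⟩)]

lemma clamp_coe (t : unitInterval) : clamp t = t := Set.projIcc_val _ t

lemma sum_clamp (n : ℕ) : ∀ {x : ℝ}, 0 ≤ x → x ≤ n → ∑ i : Fin n, (clamp (x - i) : ℝ) = x := by
  induction n with
  | zero => intro x h0 h1; simp at h1 ⊢; linarith
  | succ n ih =>
    intro x h0 h1
    push_cast at h1
    rw [Fin.sum_univ_castSucc]
    simp only [Fin.val_castSucc, Fin.val_last]
    rcases le_total x n with h | h
    · rw [ih h0 h, clamp_of_le (by linarith)]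
      simp
    · have : ∀ i : Fin n, (clamp (x - i) : ℝ) = 1 := fun i => by
        have : (i : ℝ) + 1 ≤ n := by exact_mod_cast i.2
        rw [clamp_of_ge (by linarith)]
        rfl
      rw [Finset.sum_congr rfl fun i _ => this i, coe_clamp (by linarith) (by linarith)]
      simp

/-- The number of entries in the blocks before the `i`-th one. -/
def before {k : ℕ} (m : Fin k → ℕ) (i : ℕ) (h : i ≤ k) : ℕ := ∑ j : Fin i, m (Fin.castLE h j)

lemma before_eq {k : ℕ} (m : Fin k → ℕ) (i : ℕ) (h : i ≤ k) :
    before m i h = ∑ j : Fin k, if (j : ℕ) < i then m j else 0 := by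
  rw [before, ← Finset.sum_filter]
  refine Finset.sum_nbij (Fin.castLE h) (by simp) (fun x _ y _ h => by simpa using h)
    (fun j hj => ?_) (by simp)
  simp only [Finset.coe_filter, Finset.mem_univ, true_and, Set.mem_ofPred_eq] at hj
  exact ⟨⟨j, hj⟩, by simp, rfl⟩

lemma val_position {k : ℕ} {m : Fin k → ℕ} (i : Fin k) (j : Fin (m i)) :
    (finSigmaFinEquiv ⟨i, j⟩ : ℕ) = before m i i.2.le + j := finSigmaFinEquiv_apply _

lemma before_real {k : ℕ} (m : Fin k → ℕ) (i : Fin k) (z : ℝ) :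
    (before m i i.2.le : ℝ) + z =
      ∑ j : Fin k, ((if j < i then (m j : ℝ) else 0) + if j = i then z else 0) := by
  rw [before_eq, Finset.sum_add_distrib]
  push_cast
  simp

section clampSum

variable {k : ℕ} {m : Fin k → ℕ} {y : Fin k → ℝ} {x : ℝ}

lemma sum_eq (hy0 : ∀ i : Fin k, x ≤ i → y i = 0) (hy1 : ∀ i : Fin k, (i : ℝ) + 1 ≤ x → y i = m i)
    (i : Fin k) (h0 : i ≤ x) (h1 : x ≤ i + 1) :
    ∑ j, y j = before m i i.2.le + y i := by
  rw [before_real]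
  refine Finset.sum_congr rfl fun j _ => ?_
  rcases lt_trichotomy j i with h | rfl | h
  · have : (j : ℝ) + 1 ≤ i := by exact_mod_cast h
    simp [h, h.ne, hy1 j (by linarith)]
  · simp
  · have : (i : ℝ) + 1 ≤ j := by exact_mod_cast h
    simp [h.not_gt, h.ne', hy0 j (by linarith)]

lemma clamp_sum (hy0 : ∀ i : Fin k, x ≤ i → y i = 0)
    (hy1 : ∀ i : Fin k, (i : ℝ) + 1 ≤ x → y i = m i)
    (hn : ∀ i, 0 ≤ y i) (hm : ∀ i, y i ≤ m i) (i : Fin k) (j : Fin (m i)) :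
    clamp (∑ i, y i - (finSigmaFinEquiv ⟨i, j⟩ : Fin (∑ i, m i))) = clamp (y i - j) := by
  rw [val_position]
  push_cast
  rcases lt_or_ge x i with h | h
  · have h1 : ∑ j, y j ≤ before m i i.2.le + 0 := by
      rw [before_real]
      refine Finset.sum_le_sum fun j _ => ?_
      by_cases hj : j < i
      · simp [hj, hm j]
      · have : (i : ℝ) ≤ j := by exact_mod_cast not_lt.1 hj
        simp [hj, hy0 j (by linarith)]
    have h2 : (0 : ℝ) ≤ j := by positivity
    rw [clamp_of_le (by linarith), clamp_of_le (by linarith [hy0 i h.le])]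
  · rcases le_or_gt x (i + 1) with h' | h'
    · rw [sum_eq hy0 hy1 i h h']
      congr 1
      ring
    · have h1 : before m i i.2.le + (m i : ℝ) ≤ ∑ j, y j := by
        rw [before_real]
        refine Finset.sum_le_sum fun l _ => ?_
        rcases lt_trichotomy l i with hj | hj | hj
        · have : (l : ℝ) + 1 ≤ i := by exact_mod_cast hj
          simp [hj, hj.ne, hy1 l (by linarith)]
        · subst hj
          simp [hy1 l h'.le]
        · simp [hj.not_gt, hj.ne', hn l]
      have h2 : (j : ℝ) + 1 ≤ m i := by exact_mod_cast j.2
      rw [clamp_of_ge (by linarith), clamp_of_ge (by linarith [hy1 i h'.le])]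

end clampSum

/-- The concatenation of `n` consecutive paths, parametrised by `[0, n]`. -/
noncomputable def glue {X : Type*} (x₀ : X) : (n : ℕ) → (Fin n → unitInterval → X) → ℝ → X
  | 0, _, _ => x₀
  | n + 1, γ, s =>
    if s ≤ n then glue x₀ n (fun i => γ i.castSucc) s else γ (Fin.last n) (clamp (s - n))

section glue

variable {X : Type*} {x₀ : X}

lemma glue_comp {Y : Type*} (f : X → Y) : ∀ (n : ℕ) (γ : Fin n → unitInterval → X) (s : ℝ),
    f (glue x₀ n γ s) = glue (f x₀) n (fun i t => f (γ i t)) s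
  | 0, _, _ => rfl
  | n + 1, γ, s => by
    rw [glue, glue, apply_ite f, glue_comp f n]

lemma glue_nonpos : ∀ (n : ℕ) (γ : Fin n → unitInterval → X) {s : ℝ}, s ≤ 0 → glue x₀ n γ s = x₀
  | 0, _, _, _ => rfl
  | n + 1, γ, s, h => by
    rw [glue, if_pos (h.trans (by positivity)), glue_nonpos n _ h]

/-- The ends of consecutive paths match. -/
structure Matching {n : ℕ} (x : Fin (n + 1) → X) (γ : Fin n → unitInterval → X) : Prop where
  zero : ∀ i, γ i 0 = x i.castSucc
  one : ∀ i, γ i 1 = x i.succ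

lemma Matching.init {n : ℕ} {x : Fin (n + 2) → X} {γ : Fin (n + 1) → unitInterval → X}
    (h : Matching x γ) : Matching (fun i => x i.castSucc) fun i => γ i.castSucc :=
  ⟨fun i => h.zero _, fun i => h.one _⟩

lemma glue_last : ∀ {n : ℕ} {x : Fin (n + 1) → X} {γ : Fin n → unitInterval → X}
    (h : Matching x γ), glue (x 0) n γ n = x (Fin.last n)
  | 0, _, _, _ => rfl
  | n + 1, x, γ, h => by
    rw [glue, if_neg (by push_cast; linarith), clamp_of_ge (by push_cast; linarith), h.one]
    rfl

lemma glue_mem : ∀ {n : ℕ} {x : Fin (n + 1) → X} {γ : Fin n → unitInterval → X}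
    (h : Matching x γ) (l : Fin n) {s : ℝ} (h0 : l ≤ s) (h1 : s ≤ l + 1),
    glue (x 0) n γ s = γ l (clamp (s - l))
  | 0, _, _, _, l, _, _, _ => l.elim0
  | n + 1, x, γ, h, l, s, h0, h1 => by
    induction l using Fin.lastCases with
    | last =>
      simp only [Fin.val_last] at *
      rw [glue]
      split_ifs with hs
      · obtain rfl : s = n := le_antisymm hs h0
        rw [sub_self, clamp_of_le le_rfl, h.zero]
        exact glue_last h.init
      · rfl
    | cast l =>
      simp only [Fin.val_castSucc] at *
      have : (l : ℝ) + 1 ≤ n := by exact_mod_cast l.2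
      rw [glue, if_pos (by linarith)]
      exact glue_mem h.init l h0 h1

lemma glue_nat {n : ℕ} {x : Fin (n + 1) → X} {γ : Fin n → unitInterval → X}
    (h : Matching x γ) (l : Fin (n + 1)) : glue (x 0) n γ l = x l := by
  induction l using Fin.lastCases with
  | last => exact glue_last h
  | cast l =>
    rw [Fin.val_castSucc, glue_mem h l le_rfl (by linarith), sub_self, clamp_of_le le_rfl, h.zero]

lemma continuous_glue [TopologicalSpace X] {W : Type*} [TopologicalSpace W] :
    ∀ {n : ℕ} {x : Fin (n + 1) → X} {γ : W → Fin n → unitInterval → X}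
    (h : ∀ w, Matching x (γ w)) (hc : ∀ i, Continuous fun q : W × unitInterval => γ q.1 i q.2)
    {s : W → ℝ} (hs : Continuous s), Continuous fun w => glue (x 0) n (γ w) (s w)
  | 0, _, _, _, _, _, _ => continuous_const
  | n + 1, x, γ, h, hc, s, hs => by
    refine Continuous.if_le (continuous_glue (fun w => (h w).init) (fun i => hc _) hs)
      ((hc (Fin.last n)).comp (continuous_id.prodMk
        (continuous_clamp.comp (hs.sub continuous_const)))) hs continuous_const fun w hw => ?_
    rw [hw, sub_self, clamp_of_le le_rfl, (h w).zero]
    exact glue_last (h w).init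

/-- Two-stage gluing agrees with gluing all at once. -/
lemma glue_glue {k : ℕ} {m : Fin k → ℕ} {p : Fin (k + 1) → X} {q : ∀ i, Fin (m i + 1) → X}
    {r : Fin (∑ i, m i + 1) → X}
    (hq0 : ∀ i, q i 0 = p i.castSucc) (hq1 : ∀ i, q i (Fin.last _) = p i.succ)
    (hr : r 0 = p 0)
    (hrt : ∀ i j, r (finSigmaFinEquiv ⟨i, j⟩ : Fin (∑ i, m i)).succ = q i j.succ)
    {γ : ∀ i, Fin (m i) → unitInterval → X} {δ : Fin (∑ i, m i) → unitInterval → X}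
    (hγ : ∀ i, Matching (q i) (γ i)) (hδ : Matching r δ)
    (hδγ : ∀ i j, δ (finSigmaFinEquiv ⟨i, j⟩) = γ i j)
    {y : Fin k → unitInterval → ℝ} (y0 : ∀ i, y i 0 = 0) (y1 : ∀ i, y i 1 = m i)
    (hn : ∀ i t, 0 ≤ y i t) (hm : ∀ i t, y i t ≤ m i) {s : ℝ} (hs0 : 0 ≤ s) (hs1 : s ≤ k) :
    glue (r 0) _ δ (∑ i, y i (clamp (s - i))) =
      glue (p 0) k (fun i t => glue (q i 0) (m i) (γ i) (y i t)) s := by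
  have hM : Matching p fun i t => glue (q i 0) (m i) (γ i) (y i t) :=
    ⟨fun i => by rw [y0, glue_nonpos _ _ le_rfl, hq0],
      fun i => by rw [y1, glue_last (hγ i), hq1]⟩
  have hY0 : ∀ i : Fin k, s ≤ i → y i (clamp (s - i)) = 0 := fun i h => by
    rw [clamp_of_le (by linarith), y0]
  have hY1 : ∀ i : Fin k, (i : ℝ) + 1 ≤ s → y i (clamp (s - i)) = m i := fun i h => by
    rw [clamp_of_ge (by linarith), y1]
  rcases Nat.eq_zero_or_pos k with rfl | hk
  · rw [glue_nonpos _ _ (by simp), glue_nonpos _ _ (by simpa using hs1), hr]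
  have hpos : ∀ (i : ℕ) (h : i ≤ k) (h' : before m i h < ∑ i, m i + 1),
      r ⟨before m i h, h'⟩ = p ⟨i, by omega⟩ := by
    intro i
    induction i with
    | zero =>
      intro h h'
      exact (congrArg r (Fin.ext (by simp [before]))).trans hr
    | succ i ih =>
      intro h h'
      have hb : before m (i + 1) h = before m i (by omega) + m ⟨i, h⟩ := by
        rw [before, Fin.sum_univ_castSucc]
        rfl
      rcases Nat.eq_zero_or_pos (m ⟨i, h⟩) with h0 | h0
      · have e1 : q ⟨i, h⟩ 0 = q ⟨i, h⟩ (Fin.last _) := congrArg _ (Fin.ext (by simp [h0]))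
        rw [hq0, hq1] at e1
        refine Eq.trans ?_ ((ih (by omega) (by omega)).trans e1)
        exact congrArg r (Fin.ext (by simp [hb, h0]))
      · refine Eq.trans ?_ ((hrt ⟨i, h⟩ ⟨m ⟨i, h⟩ - 1, by omega⟩).trans (Eq.trans ?_ (hq1 ⟨i, h⟩)))
        · refine congrArg r (Fin.ext ?_)
          rw [Fin.val_succ, val_position]
          simp only
          omega
        · exact congrArg (q _) (Fin.ext (by simp; omega))
  obtain ⟨i, hi0, hi1⟩ : ∃ i : Fin k, (i : ℝ) ≤ s ∧ s ≤ i + 1 := by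
    rcases eq_or_lt_of_le hs1 with rfl | h
    · refine ⟨⟨k - 1, by omega⟩, ?_, ?_⟩ <;> simp [Nat.cast_sub hk]
    · exact ⟨⟨⌊s⌋₊, (Nat.floor_lt hs0).2 h⟩, Nat.floor_le hs0, (Nat.lt_floor_add_one s).le⟩
  rw [glue_mem hM i hi0 hi1, sum_eq hY0 hY1 i hi0 hi1]
  have hy0' := hn i (clamp (s - i))
  have hy1' := hm i (clamp (s - i))
  set z := y i (clamp (s - i)) with hz
  rcases Nat.eq_zero_or_pos (m i) with h0 | h0
  · have hz0 : z = 0 := le_antisymm (by simpa [h0] using hy1') hy0'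
    have hlt : before m i i.2.le < ∑ i, m i + 1 := by
      rw [before_eq, Nat.lt_succ_iff]
      exact Finset.sum_le_sum fun j _ => by split_ifs <;> simp
    rw [hz0, add_zero, glue_nonpos _ _ le_rfl, hq0]
    exact (glue_nat hδ ⟨before m i i.2.le, hlt⟩).trans (hpos i i.2.le hlt)
  obtain ⟨j, hj0, hj1⟩ : ∃ j : Fin (m i), (j : ℝ) ≤ z ∧ z ≤ j + 1 := by
    rcases eq_or_lt_of_le hy1' with h | h
    · refine ⟨⟨m i - 1, by omega⟩, ?_, ?_⟩ <;> simp [Nat.cast_sub h0, h]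
    · exact ⟨⟨⌊z⌋₊, (Nat.floor_lt hy0').2 h⟩, Nat.floor_le hy0', (Nat.lt_floor_add_one z).le⟩
  rw [glue_mem (hγ i) j hj0 hj1, glue_mem hδ (finSigmaFinEquiv ⟨i, j⟩), hδγ]
  · rw [val_position]
    push_cast
    congr 2
    ring
  · rw [val_position]
    push_cast
    linarith
  · rw [val_position]
    push_cast
    linarith

end glue

end TopInterval

namespace TopInterval

/-- The space of endpoint preserving continuous maps from `[0, 1]` to `[0, k]`. -/
def Reparam (k : ℕ) : Type :=
  {f : C(unitInterval, ℝ) // f 0 = 0 ∧ f 1 = k ∧ ∀ t, f t ∈ Set.Icc 0 (k : ℝ)}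

instance (k : ℕ) : TopologicalSpace (Reparam k) :=
  inferInstanceAs (TopologicalSpace {f : C(unitInterval, ℝ) // _})

namespace Reparam

instance (k : ℕ) : FunLike (Reparam k) unitInterval ℝ where
  coe f := f.1
  coe_injective := DFunLike.coe_injective.comp Subtype.val_injective

variable {k : ℕ}

lemma ext {f g : Reparam k} (h : ∀ t, f t = g t) : f = g := DFunLike.ext _ _ h
lemma zero (f : Reparam k) : f 0 = 0 := f.2.1
lemma one (f : Reparam k) : f 1 = k := f.2.2.1
lemma nonneg (f : Reparam k) (t) : 0 ≤ f t := (f.2.2.2 t).1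
lemma le (f : Reparam k) (t) : f t ≤ k := (f.2.2.2 t).2

lemma continuous_eval' {W : Type*} [TopologicalSpace W] {f : W → Reparam k}
    {t : W → unitInterval} (hf : Continuous f) (ht : Continuous t) :
    Continuous fun w => f w (t w) :=
  Continuous.eval (f := fun w => (f w).1) (continuous_subtype_val.comp hf) ht

lemma continuous_of_eval {W : Type*} [TopologicalSpace W] {f : W → Reparam k}
    (h : Continuous fun q : W × unitInterval => f q.1 q.2) : Continuous f :=
  Continuous.subtype_mk (ContinuousMap.continuous_of_continuous_uncurry (fun w => (f w).1) h) _

/-- Operadic composition of reparametrisations. -/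
noncomputable def comp {m : Fin k → ℕ} (f : Reparam k) (g : ∀ i, Reparam (m i)) :
    Reparam (∑ i, m i) :=
  ⟨⟨fun t => ∑ i, g i (clamp (f t - i)), continuous_finsetSum Finset.univ fun i _ =>
      (g i).1.continuous.comp (continuous_clamp.comp (f.1.continuous.sub continuous_const))⟩, by
    refine ⟨?_, ?_, fun t => ⟨?_, ?_⟩⟩
    · change ∑ i, g i (clamp (f 0 - i)) = 0
      refine Finset.sum_eq_zero fun i _ => ?_
      rw [f.zero, clamp_of_le (by simp), zero]
    · change ∑ i, g i (clamp (f 1 - i)) = _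
      push_cast
      refine Finset.sum_congr rfl fun i _ => ?_
      have : (i : ℝ) + 1 ≤ k := by exact_mod_cast i.2
      rw [f.one, clamp_of_ge (by linarith), one]
    · change 0 ≤ ∑ i, g i (clamp (f t - i))
      exact Finset.sum_nonneg fun i _ => nonneg _ _
    · change ∑ i, g i (clamp (f t - i)) ≤ _
      push_cast
      exact Finset.sum_le_sum fun i _ => le _ _⟩

lemma comp_apply {m : Fin k → ℕ} (f : Reparam k) (g : ∀ i, Reparam (m i)) (t) :
    comp f g t = ∑ i, g i (clamp (f t - i)) := rfl

lemma continuous_comp {m : Fin k → ℕ} {W : Type*} [TopologicalSpace W] {f : W → Reparam k}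
    {g : ∀ i, W → Reparam (m i)} (hf : Continuous f) (hg : ∀ i, Continuous (g i)) :
    Continuous fun w => comp (f w) fun i => g i w :=
  continuous_of_eval <| continuous_finsetSum Finset.univ fun i _ =>
    continuous_eval' ((hg i).comp continuous_fst) <| continuous_clamp.comp <|
      (continuous_eval' (hf.comp continuous_fst) continuous_snd).sub continuous_const

/-- The identity reparametrisation. -/
noncomputable def id : Reparam 1 :=
  ⟨⟨fun t => t, continuous_subtype_val⟩, rfl, by simp, fun t => by simp⟩

lemma id_apply (t : unitInterval) : id t = t := rfl

lemma clamp_comp {m : Fin k → ℕ} (f : Reparam k) (g : ∀ i, Reparam (m i)) (t) (i : Fin k)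
    (j : Fin (m i)) :
    clamp (comp f g t - (finSigmaFinEquiv ⟨i, j⟩ : Fin (∑ i, m i))) =
      clamp (g i (clamp (f t - i)) - j) :=
  clamp_sum (x := f t) (y := fun i => g i (clamp (f t - i)))
    (fun i h => by rw [clamp_of_le (by linarith), zero])
    (fun i h => by rw [clamp_of_ge (by linarith), one])
    (fun i => nonneg _ _) (fun i => le _ _) i j

end Reparam

/-- The value of a generalized element. -/
def el {Z : TopCat.{0}} {n : ℕ} (f : Z ⟶ TopCat.of (Reparam n)) (z : Z) : Reparam n := f z

lemma continuous_el {Z : TopCat.{0}} {n : ℕ} (f : Z ⟶ TopCat.of (Reparam n)) :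
    Continuous (el f) := f.hom.continuous

/-- Two generalized elements of a space of reparametrisations agree if they agree pointwise. -/
lemma reparam_hom_ext {Z : TopCat.{0}} {n : ℕ} {f g : Z ⟶ TopCat.of (Reparam n)}
    (h : ∀ z t, el f z t = el g z t) : f = g :=
  TopCat.hom_ext (ContinuousMap.ext fun z => Reparam.ext (h z))

/-- Composition of reparametrisations as a morphism. -/
noncomputable def compHom {k : ℕ} (m : Fin k → ℕ) :
    TopCat.of (Reparam k) ⨯ (∏ᶜ fun i => TopCat.of (Reparam (m i))) ⟶
      TopCat.of (Reparam (∑ i, m i)) :=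
  TopCat.ofHom ⟨fun u => Reparam.comp (el prod.fst u) fun i => el (prod.snd ≫ Pi.π _ i) u,
    Reparam.continuous_comp (continuous_el _) fun i => continuous_el _⟩

lemma compHom_apply {k : ℕ} (m : Fin k → ℕ) {Z : TopCat.{0}} (f : Z ⟶ TopCat.of (Reparam k))
    (g : ∀ i, Z ⟶ TopCat.of (Reparam (m i))) (z : Z) :
    el (prod.lift f (Pi.lift g) ≫ compHom m) z = Reparam.comp (el f z) fun i => el (g i) z := by
  have h1 : el (prod.fst : TopCat.of (Reparam k) ⨯ (∏ᶜ fun i => TopCat.of (Reparam (m i))) ⟶ _)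
      (prod.lift f (Pi.lift g) z) = el f z := lift_fst_apply _ _ _
  have h2 : ∀ i, el (prod.snd ≫ Pi.π _ i :
        TopCat.of (Reparam k) ⨯ (∏ᶜ fun i => TopCat.of (Reparam (m i))) ⟶ _)
      (prod.lift f (Pi.lift g) z) = el (g i) z := fun i => by
    rw [el, ← ConcreteCategory.comp_apply, OpCat.lift_elem, el]
  exact congrArg₂ (fun (f : Reparam k) (g : ∀ i, Reparam (m i)) => Reparam.comp f g) h1
    (funext h2)

lemma comp_eqToHom_apply {Z : TopCat.{0}} {m n : ℕ} (h : m = n) (f : Z ⟶ TopCat.of (Reparam m))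
    (z : Z) (t : unitInterval) :
    el (f ≫ eqToHom (congrArg (fun n => TopCat.of (Reparam n)) h)) z t = el f z t := by
  subst h
  simp

/-- The operad of endpoint preserving maps `[0, 1] ⟶ [0, k]`. -/
noncomputable def reparamOperad : NSOperad TopCat.{0} where
  obj k := TopCat.of (Reparam k)
  one := TopCat.ofHom (ContinuousMap.const _ Reparam.id)
  comp m := compHom m
  one_comp {Z} n a := reparam_hom_ext fun z t => by
    refine Eq.trans ?_ (comp_eqToHom_apply (by simp) a z t).symm
    refine (congrArg (fun f : Reparam _ => f t) (compHom_apply _ _ _ z)).trans ?_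
    refine (Reparam.comp_apply _ _ t).trans ?_
    rw [Fin.sum_univ_one]
    refine congrArg (el (a) z) ?_
    refine (congrArg clamp ?_).trans (clamp_coe t)
    exact (congrArg (fun x : ℝ => (t : ℝ) - x) Nat.cast_zero).trans (sub_zero (t : ℝ))
  comp_one {Z} n a := reparam_hom_ext fun z t => by
    refine Eq.trans ?_ (comp_eqToHom_apply (by simp) a z t).symm
    refine (congrArg (fun f : Reparam _ => f t) (compHom_apply _ _ _ z)).trans ?_
    refine (Reparam.comp_apply _ _ t).trans ?_
    exact sum_clamp n (Reparam.nonneg _ _) (Reparam.le _ _)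
  assoc {Z k} m n n' hn a b c c' hc := reparam_hom_ext fun z t => by
    refine (congrArg (fun f : Reparam _ => f t) (compHom_apply _ _ _ z)).trans ?_
    rw [← Category.assoc]
    refine Eq.trans ?_ (comp_eqToHom_apply (sum_concat m n n' hn).symm _ z t).symm
    refine Eq.trans ?_ (congrArg (fun f : Reparam _ => f t) (compHom_apply _ _ _ z)).symm
    refine (Reparam.comp_apply _ _ t).trans (Eq.trans ?_ (Reparam.comp_apply _ _ t).symm)
    rw [← Equiv.sum_comp finSigmaFinEquiv, Fintype.sum_sigma]
    refine Finset.sum_congr rfl fun i _ => ?_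
    refine Eq.trans ?_ (congrArg (fun f : Reparam _ => f _) (compHom_apply _ _ _ z)).symm
    refine Eq.trans ?_ (Reparam.comp_apply _ _ _).symm
    refine Finset.sum_congr rfl fun j _ => ?_
    rw [hc i j]
    refine (comp_eqToHom_apply (hn i j).symm (c i j) z _).trans ?_
    refine congrArg (el (c i j) z) ?_
    refine (congrArg (fun f : Reparam _ => clamp (f t - _)) (compHom_apply _ _ _ z)).trans ?_
    exact Reparam.clamp_comp _ _ t i j

end TopInterval

namespace TopInterval

/-- The value of a generalized element of a space of paths. -/
noncomputable def pathEl {X Z : TopCat.{0}} {a b : ⊤_ TopCat.{0} ⟶ X} (f : Z ⟶ unitPathInterval.path a b)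
    (z : Z) : Path (pt a) (pt b) := f.hom z

lemma continuous_pathEl {X Z : TopCat.{0}} {a b : ⊤_ TopCat.{0} ⟶ X}
    (f : Z ⟶ unitPathInterval.path a b) :
    Continuous fun q : Z × unitInterval => pathEl f q.1 q.2 :=
  Path.continuous_uncurry_iff.2 f.hom.continuous

lemma path_hom_ext {X Z : TopCat.{0}} {a b : ⊤_ TopCat.{0} ⟶ X}
    {f g : Z ⟶ unitPathInterval.path a b} (h : ∀ z t, pathEl f z t = pathEl g z t) : f = g :=
  TopCat.hom_ext (ContinuousMap.ext fun z => Path.ext (x := pt a) (y := pt b) (funext (h z)))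

lemma pathEl_eqToHom {X Z : TopCat.{0}} {a b a' b' : ⊤_ TopCat.{0} ⟶ X} (ha : a = a')
    (hb : b = b') (f : Z ⟶ unitPathInterval.path a b) (z : Z) (t : unitInterval) :
    pathEl (f ≫ eqToHom (congrArg₂ unitPathInterval.path ha hb)) z t = pathEl f z t := by
  subst ha hb
  simp

lemma pathEl_pathMap {X Y Z : TopCat.{0}} (φ : X ⟶ Y) {a b : ⊤_ TopCat.{0} ⟶ X}
    (f : Z ⟶ unitPathInterval.path a b) (z : Z) (t : unitInterval) :
    pathEl (f ≫ unitPathInterval.pathMap φ a b) z t = φ (pathEl f z t) := by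
  have := ConcreteCategory.congr_hom (unitPathInterval.pathMap_ev φ a b)
    (pair (X := TopCat.of (Path (pt a) (pt b))) (Y := TopCat.of unitInterval) (pathEl f z) t)
  refine Eq.trans ?_ (this.trans (congrArg φ (ev_pair a b (pathEl f z) t)))
  refine Eq.trans ?_ (congrArg (unitPathInterval.ev (a ≫ φ) (b ≫ φ))
    (map_pair (W := TopCat.of unitInterval) (unitPathInterval.pathMap φ a b) (pathEl f z) t).symm)
  exact (ev_pair _ _ (pathEl (f ≫ unitPathInterval.pathMap φ a b) z) t).symm

section action

variable {X : TopCat.{0}} {n : ℕ} {a b : ⊤_ TopCat.{0} ⟶ X}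
  (p : Chain (⊤_ TopCat.{0} ⟶ X) n a b) {Z : TopCat.{0}}

lemma matching (f : ∀ i, Z ⟶ unitPathInterval.path (p.src i) (p.tgt i)) (z : Z) :
    Matching (fun i => pt (p.pt i)) fun i => pathEl (f i) z :=
  ⟨fun i => (pathEl (f i) z).source, fun i => (pathEl (f i) z).target⟩

/-- The composite of a family of `n` consecutive paths, as specified by a reparametrisation
`[0, 1] ⟶ [0, n]`. -/
noncomputable def opPath (x : Z ⟶ TopCat.of (Reparam n))
    (f : ∀ i, Z ⟶ unitPathInterval.path (p.src i) (p.tgt i)) :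
    Z ⟶ unitPathInterval.path a b :=
  TopCat.ofHom (Y := Path (pt a) (pt b))
    ⟨fun z =>
      { toFun := fun t => glue (pt (p.pt 0)) n (fun i => pathEl (f i) z) (el x z t)
        continuous_toFun :=
          continuous_glue (x := fun i => pt (p.pt i)) (fun _ => matching p f z)
            (fun i => (pathEl (f i) z).continuous.comp continuous_snd) (el x z).1.continuous
        source' := by rw [Reparam.zero, glue_nonpos _ _ le_rfl, p.first]
        target' := by rw [Reparam.one, glue_last (matching p f z), p.last] },
      Path.continuous_uncurry_iff.1 <|
        continuous_glue (x := fun i => pt (p.pt i))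
          (γ := fun (q : Z × unitInterval) i => pathEl (f i) q.1)
          (fun q => matching p f q.1)
          (fun i => (continuous_pathEl (f i)).comp
            ((continuous_fst.comp continuous_fst).prodMk continuous_snd))
          (Reparam.continuous_eval' ((continuous_el x).comp continuous_fst) continuous_snd)⟩

lemma pathEl_opPath (x : Z ⟶ TopCat.of (Reparam n))
    (f : ∀ i, Z ⟶ unitPathInterval.path (p.src i) (p.tgt i)) (z : Z) (t : unitInterval) :
    pathEl (opPath p x f) z t =
      glue (pt (p.pt 0)) n (fun i => pathEl (f i) z) (el x z t) := rfl

end action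

/-- The graph of points and path spaces of a topological space, as a category enriched over the
operad of reparametrisations. -/
noncomputable def pathCat (X : TopCat.{0}) : OpCat reparamOperad :=
  OpCat.ofOp (unitPathInterval.P.obj X) (fun p _ x f => opPath p x f)
    (fun p Z Z' w x f => rfl)
    (fun {a b} p Z f => path_hom_ext fun z t => by
      refine Eq.trans ?_ (pathEl_eqToHom p.first p.last (f 0) z t).symm
      refine (pathEl_opPath (X := X) p _ f z t).trans ?_
      refine (glue_mem (matching (X := X) p f z) (0 : Fin 1) ?_ ?_).trans ?_
      · exact (Nat.cast_zero (R := ℝ)).le.trans t.2.1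
      · exact (show (t : ℝ) ≤ (0 : ℕ) + 1 by simpa using t.2.2)
      · refine congrArg (pathEl (f 0) z) ((congrArg clamp ?_).trans (clamp_coe t))
        exact (congrArg (fun x : ℝ => (t : ℝ) - x) Nat.cast_zero).trans (sub_zero (t : ℝ)))
    (fun {k m a b} p q r h Z x y f g hg => path_hom_ext fun z t => by
      refine (pathEl_opPath (X := X) r _ g z t).trans
        (Eq.trans ?_ (pathEl_opPath (X := X) p x _ z t).symm)
      refine (congrArg (fun e : Reparam _ => glue (pt (r.pt 0)) _ (fun i => pathEl (g i) z) (e t))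
        (compHom_apply m x y z)).trans ?_
      refine glue_glue (p := fun i => pt (p.pt i)) (q := fun i j => pt ((q i).pt j))
        (r := fun i => pt (r.pt i)) (fun i => congrArg pt (q i).first)
        (fun i => congrArg pt (q i).last) (congrArg pt (r.first.trans p.first.symm))
        (fun i j => congrArg pt (h.tgt i j))
        (fun i => matching (X := X) (q i) (f i) z) (matching (X := X) r g z)
        (fun i j => funext fun s => ?_) (y := fun i => el (y i) z)
        (fun i => Reparam.zero _) (fun i => Reparam.one _) (fun i => Reparam.nonneg _)
        (fun i => Reparam.le _) (Reparam.nonneg _ _) (Reparam.le _ _)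
      refine (congrArg (fun e => pathEl (X := X) e z s) (hg i j)).trans ?_
      exact pathEl_eqToHom (X := X) (h.src i j).symm (h.tgt i j).symm (f i j) z s)

lemma pathCat_op (X : TopCat.{0}) {n : ℕ} {a b : ⊤_ TopCat.{0} ⟶ X}
    (p : Chain (⊤_ TopCat.{0} ⟶ X) n a b) {Z : TopCat.{0}} (x : Z ⟶ TopCat.of (Reparam n))
    (f : ∀ i, Z ⟶ unitPathInterval.path (p.src i) (p.tgt i)) :
    (pathCat X).op (n := n) (a := a) (b := b) p x f = opPath p x f :=
  OpCat.ofOp_op (A := reparamOperad) (unitPathInterval.P.obj X) (fun p _ x f => opPath p x f)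
    _ _ _ (n := n) (a := a) (b := b) p x f

/-- The operad of reparametrisations acts on spaces of paths. -/
noncomputable def pathAction : unitPathInterval.Action reparamOperad where
  lift :=
    { obj := pathCat
      map := fun {X Y} φ =>
        { graph := unitPathInterval.P.map φ
          comm := fun {n a b} p Z x f => path_hom_ext fun z t => by
            refine Eq.trans ?_
              (congrArg (fun e => pathEl (X := Y) e z t) (pathCat_op Y _ x _).symm)
            refine (congrArg (fun e => pathEl (X := Y)
              (e ≫ unitPathInterval.pathMap φ a b) z t) (pathCat_op X p x f)).trans ?_
            refine (pathEl_pathMap φ (opPath p x f) z t).trans ?_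
            refine (congrArg φ (pathEl_opPath p x f z t)).trans ?_
            refine (glue_comp φ _ _ _).trans (Eq.trans ?_ (pathEl_opPath (X := Y) _ x _ z t).symm)
            refine congrArg (fun γ => glue _ n γ (el x z t)) (funext fun i => funext fun s => ?_)
            exact (pathEl_pathMap φ (f i) z s).symm }
      map_id := fun X => OpCat.hom_ext (unitPathInterval.P.map_id X)
      map_comp := fun f g => OpCat.hom_ext (unitPathInterval.P.map_comp f g) }
  iso := Iso.refl _

end TopInterval

/-! Trimble `n`-categories are compared with strict `n`-categories by induction on `n`. The
inductive statement is `MonadComparison`: both categories are monadic over `n`-globular sets, by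
functors that preserve finite products and coproducts; a finite product preserving functor `K` from
the strict to the weak side commutes with the forgetful functors; and the morphism φ that `K`
induces between the two monads is cartesian and lifts against the boundary inclusions. This φ is the
contractible operad. For `n = 0` everything is an identity.

The inductive step `MonadComparison.exists_opCat` does not mention spaces. Let `B` be an operad in
`V`, with `U : V ⥤ G` as above. Since products distribute over coproducts in `V`, the free
`B`-category on a graph `Y` has the objects of `Y`, and its hom from `a` to `b` is the coproduct,
over all chains from `a` to `b`, of `B_k × Y(x_0,x_1) × ⋯ × Y(x_{k-1},x_k)`. On homs the new φ is
therefore a coproduct, over chains, of products of the old φ with the maps `U B_k → 1`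
(`GlobComparison.inc_φHom`, `GlobComparison.ω_proj`). Products and coproducts of cartesian squares
are cartesian. A lifting problem with connected codomain against a coproduct reduces to a single
summand, and against a product to the factors. So the only new input is that `U B_k → 1` lifts. For
`B = π_n A` this is the contractibility of `A`, carried to globular sets by
`PathInterval.Action.rlp_trimble`: maps from a suspension are families of paths, so path objects of
a weakly contractible object are again weakly contractible, and its set of path components is a
point.

Distributivity and the good behaviour of coproducts under pullback come from `HasCells`: a family of
functors to sets that preserves finite products, pullbacks and coproducts and jointly reflects
isomorphisms. With such a family these statements may be checked on elements. Cell families pass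
from `V` to graphs enriched in `V`, and back along the monadic functors in question.

Monadicity of `B`-categories (`isEquivalence_comparison_opCat`) is Beck's theorem. An algebra
structure is the identity on objects, so one has to form the quotient of a `B`-category hom by hom.
Coequalizers in `V` need not commute with products, but those which split after applying `U` do,
because `U` preserves products (`IsSplitFork.prod`).

For Trimble's own operad the spaces `A_k` are convex, hence equiconnected. Path spaces of
equiconnected spaces are equiconnected, so maps from spheres are extended to disks by induction
along the suspension (`TopInterval.exists_extension`). -/

/-! ### Coproducts, distributivity and cells -/

section Coprod

universe w

variable {V : Type u} [Category.{v} V] {W : Type u'} [Category.{v} W]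

/-- The universal property of a coproduct. -/
def IsCoprod {J : Type w} {X : J → V} {P : V} (m : ∀ j, X j ⟶ P) : Prop :=
  ∀ ⦃W : V⦄ (f : ∀ j, X j ⟶ W), ∃! u : P ⟶ W, ∀ j, m j ≫ u = f j

/-- The universal property of a product. -/
def IsProd {J : Type w} {X : J → V} {P : V} (p : ∀ j, P ⟶ X j) : Prop :=
  ∀ ⦃W : V⦄ (f : ∀ j, W ⟶ X j), ∃! u : W ⟶ P, ∀ j, u ≫ p j = f j

/-- A functor preserves small coproducts. -/
def PreservesCoprods (F : V ⥤ W) : Prop :=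
  ∀ ⦃J : Type v⦄ ⦃X : J → V⦄ ⦃P : V⦄ (m : ∀ j, X j ⟶ P), IsCoprod m → IsCoprod fun j => F.map (m j)

section

variable {J : Type w} {X : J → V} {P : V} {m : ∀ j, X j ⟶ P}

lemma IsCoprod.hom_ext (h : IsCoprod m) {Z : V} {f g : P ⟶ Z} (e : ∀ j, m j ≫ f = m j ≫ g) :
    f = g :=
  (h fun j => m j ≫ g).unique e fun _ => rfl

/-- The map out of a coproduct given by a family of maps. -/
noncomputable def IsCoprod.desc (h : IsCoprod m) {Z : V} (f : ∀ j, X j ⟶ Z) : P ⟶ Z :=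
  (h f).choose

lemma IsCoprod.fac (h : IsCoprod m) {Z : V} (f : ∀ j, X j ⟶ Z) (j : J) : m j ≫ h.desc f = f j :=
  (h f).choose_spec.1 j

lemma IsCoprod.exists_iso (h : IsCoprod m) {P' : V} {m' : ∀ j, X j ⟶ P'} (h' : IsCoprod m') :
    ∃ e : P ≅ P', ∀ j, m j ≫ e.hom = m' j :=
  ⟨⟨h.desc m', h'.desc m, h.hom_ext fun j => by rw [← Category.assoc, h.fac, h'.fac,
      Category.comp_id], h'.hom_ext fun j => by rw [← Category.assoc, h'.fac, h.fac,
      Category.comp_id]⟩, h.fac m'⟩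

lemma IsCoprod.comp_iso (h : IsCoprod m) {P' : V} (e : P ⟶ P') [IsIso e] :
    IsCoprod fun j => m j ≫ e := by
  intro Z f
  refine ⟨inv e ≫ h.desc f, fun j => by simp [h.fac], fun u hu => ?_⟩
  rw [IsIso.eq_inv_comp]
  exact h.hom_ext fun j => by rw [← Category.assoc, hu, h.fac]

lemma isCoprod_iff_nonempty_isColimit :
    IsCoprod m ↔ Nonempty (IsColimit (Cofan.mk P m)) := by
  constructor
  · intro h
    exact ⟨Cofan.IsColimit.mk _ (fun s => h.desc s.inj) (fun s j => h.fac _ j)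
      fun s u hu => h.hom_ext fun j => (hu j).trans (h.fac _ j).symm⟩
  · rintro ⟨h⟩ Z f
    exact ⟨Cofan.IsColimit.desc h f, fun j => Cofan.IsColimit.fac h f j, fun u hu =>
      Cofan.IsColimit.hom_ext h _ _ fun j => (hu j).trans (Cofan.IsColimit.fac h f j).symm⟩

lemma isProd_iff_nonempty_isLimit {p : ∀ j, P ⟶ X j} :
    IsProd p ↔ Nonempty (IsLimit (Fan.mk P p)) := by
  constructor
  · intro h
    choose u hu hu' using h
    exact ⟨Fan.IsLimit.mk _ (fun s => u s.proj) (fun s j => hu s.proj j)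
      fun s m hm => hu' s.proj m hm⟩
  · rintro ⟨h⟩ Z f
    exact EGraph.exists_unique_of_isLimit h Z f

end

lemma isCoprod_sigma {J : Type w} (X : J → V) [HasCoproduct X] : IsCoprod (Sigma.ι X) :=
  isCoprod_iff_nonempty_isColimit.2 ⟨coproductIsCoproduct X⟩

lemma hasCoproducts_of_isCoprod
    (h : ∀ {J : Type w} (X : J → V), ∃ (P : V) (m : ∀ j, X j ⟶ P), IsCoprod m) :
    HasCoproducts.{w} V := fun J =>
  haveI : ∀ X : J → V, HasCoproduct X := fun X => by
    obtain ⟨P, m, hm⟩ := h X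
    exact ⟨⟨⟨_, (isCoprod_iff_nonempty_isColimit.1 hm).some⟩⟩⟩
  { has_colimit := fun F => hasColimit_of_iso Discrete.natIsoFunctor }

lemma IsProd.map (F : V ⥤ W) [PreservesFiniteProducts F] {J : Type} [Finite J] {X : J → V}
    {P : V} {p : ∀ j, P ⟶ X j} (h : IsProd p) : IsProd fun j => F.map (p j) := by
  obtain ⟨h⟩ := isProd_iff_nonempty_isLimit.1 h
  exact isProd_iff_nonempty_isLimit.2 ⟨isLimitMapConeFanMkEquiv F _ _ (isLimitOfPreserves F h)⟩

lemma IsProd.hom_ext {J : Type w} {X : J → V} {P : V} {p : ∀ j, P ⟶ X j} (h : IsProd p) {Z : V}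
    {f g : Z ⟶ P} (e : ∀ j, f ≫ p j = g ≫ p j) : f = g :=
  (h fun j => g ≫ p j).unique e fun _ => rfl

/-- Coproducts are unique up to isomorphism, so one well chosen coproduct of each family suffices.
-/
lemma preservesCoprods_of_exists {F : V ⥤ W}
    (h : ∀ {J : Type v} (X : J → V), ∃ (P : V) (m : ∀ j, X j ⟶ P), IsCoprod m ∧
      IsCoprod fun j => F.map (m j)) : PreservesCoprods F := by
  intro J X P m hm
  obtain ⟨P', m', hm', hF⟩ := h X
  obtain ⟨e, he⟩ := hm'.exists_iso hm
  have := hF.comp_iso (F.map e.hom)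
  simpa only [← F.map_comp, he] using this

/-- The family of maps to the objects `X` and `Y l` from a product of the form `X ⨯ ∏ Y`. -/
lemma isProd_prod_pi [HasFiniteProducts V] {n : ℕ} (X : V) (Y : Fin n → V) :
    IsProd (J := Option (Fin n)) (X := fun o => o.elim X Y) (P := X ⨯ ∏ᶜ Y)
      (fun o => match o with
        | none => prod.fst
        | some l => prod.snd ≫ Pi.π Y l) := by
  intro Z f
  let f₀ : Z ⟶ X := f none
  let f₁ : ∀ l, Z ⟶ Y l := fun l => f (some l)
  refine ⟨prod.lift f₀ (Pi.lift f₁), ?_, fun u hu => ?_⟩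
  · rintro (_ | l)
    · exact prod.lift_fst _ _
    · exact OpCat.lift_elem f₀ f₁ l
  · have h0 : u ≫ prod.fst = f₀ := hu none
    have h1 : ∀ l, u ≫ prod.snd ≫ Pi.π Y l = f₁ l := fun l => hu (some l)
    ext l
    · rw [h0, prod.lift_fst]
    · rw [Category.assoc, Category.assoc, OpCat.lift_elem, h1]

variable (V) in
/-- Finite products distribute over small coproducts. -/
class DistribCoprod [HasFiniteProducts V] : Prop where
  isCoprod : ∀ {n : ℕ} (X : V) {I : Fin n → Type v} {Y : ∀ l, I l → V} {S : Fin n → V}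
    (m : ∀ l i, Y l i ⟶ S l), (∀ l, IsCoprod (m l)) →
    IsCoprod fun j : (∀ l, I l) => prod.map (𝟙 X) (Limits.Pi.map fun l => m l (j l))

/-- A family of functors to the category of sets which preserves finite products, pullbacks
and coproducts, and jointly reflects isomorphisms. -/
structure IsCellFamily {ι : Type} (Φ : ι → V ⥤ Type v) : Prop where
  isIso : ∀ {X Y : V} (f : X ⟶ Y), (∀ i, Function.Bijective ((Φ i).map f)) → IsIso f
  prod : ∀ (i : ι) {J : Type} [Finite J] {X : J → V} {P : V} (p : ∀ j, P ⟶ X j), IsProd p →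
    Function.Bijective fun (x : (Φ i).obj P) (j : J) => (Φ i).map (p j) x
  coprod : ∀ (i : ι) {J : Type v} {X : J → V} {P : V} (m : ∀ j, X j ⟶ P), IsCoprod m →
    Function.Bijective fun x : Σ j, (Φ i).obj (X j) => (Φ i).map (m x.1) x.2
  pullback : ∀ (i : ι) {P X Y Z : V} (a : P ⟶ X) (b : P ⟶ Y) (f : X ⟶ Z) (g : Y ⟶ Z),
    IsPullback a b f g → ∀ x y, (Φ i).map f x = (Φ i).map g y →
      ∃! p, (Φ i).map a p = x ∧ (Φ i).map b p = y

variable (V) in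
/-- The category `V` has a family of cell functors. -/
class HasCells : Prop where
  out : ∃ (ι : Type) (Φ : ι → V ⥤ Type v), IsCellFamily Φ

/-- Limits and colimits are unique up to isomorphism and functors preserve isomorphisms, so the
conditions may be tested on explicit models. -/
lemma IsCellFamily.of_exists {ι : Type} {Φ : ι → V ⥤ Type v}
    (isIso : ∀ {X Y : V} (f : X ⟶ Y), (∀ i, Function.Bijective ((Φ i).map f)) → IsIso f)
    (prod : ∀ {J : Type} [Finite J] (X : J → V), ∃ (P : V) (p : ∀ j, P ⟶ X j), IsProd p ∧
      ∀ i, Function.Bijective fun (x : (Φ i).obj P) (j : J) => (Φ i).map (p j) x)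
    (coprod : ∀ {J : Type v} (X : J → V), ∃ (P : V) (m : ∀ j, X j ⟶ P), IsCoprod m ∧
      ∀ i, Function.Bijective fun x : Σ j, (Φ i).obj (X j) => (Φ i).map (m x.1) x.2)
    (pullback : ∀ {X Y Z : V} (f : X ⟶ Z) (g : Y ⟶ Z), ∃ (P : V) (a : P ⟶ X) (b : P ⟶ Y),
      IsPullback a b f g ∧ ∀ i x y, (Φ i).map f x = (Φ i).map g y →
        ∃! p, (Φ i).map a p = x ∧ (Φ i).map b p = y) : IsCellFamily Φ := by
  refine ⟨isIso, fun i J _ X P p hp => ?_, fun i J X P m hm => ?_,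
    fun i P X Y Z a b f g hp x y hxy => ?_⟩
  · obtain ⟨P', p', hp', hb⟩ := prod X
    obtain ⟨h⟩ := isProd_iff_nonempty_isLimit.1 hp
    obtain ⟨h'⟩ := isProd_iff_nonempty_isLimit.1 hp'
    let e : P ≅ P' := IsLimit.conePointUniqueUpToIso h h'
    have he : ∀ j, e.hom ≫ p' j = p j := fun j =>
      IsLimit.conePointUniqueUpToIso_hom_comp h h' ⟨j⟩
    convert (hb i).comp (ConcreteCategory.bijective_of_isIso ((Φ i).map e.hom)) with x j
    change _ = (Φ i).map (p' j) ((Φ i).map e.hom x)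
    rw [← ConcreteCategory.comp_apply, ← Functor.map_comp, he]
  · obtain ⟨P', m', hm', hb⟩ := coprod X
    obtain ⟨e, he⟩ := hm'.exists_iso hm
    convert (ConcreteCategory.bijective_of_isIso ((Φ i).map e.hom)).comp (hb i) with x
    change _ = (Φ i).map e.hom ((Φ i).map (m' x.1) x.2)
    rw [← ConcreteCategory.comp_apply, ← Functor.map_comp, he]
  · obtain ⟨P', a', b', hp', hb⟩ := pullback f g
    let e : P ≅ P' := hp.isoIsPullback _ _ hp'
    have ea : e.hom ≫ a' = a := hp.isoIsPullback_hom_fst _ _ hp'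
    have eb : e.hom ≫ b' = b := hp.isoIsPullback_hom_snd _ _ hp'
    have he := ConcreteCategory.bijective_of_isIso ((Φ i).map e.hom)
    have ea' : ∀ p, (Φ i).map a' ((Φ i).map e.hom p) = (Φ i).map a p := fun p => by
      rw [← ConcreteCategory.comp_apply, ← Functor.map_comp, ea]
    have eb' : ∀ p, (Φ i).map b' ((Φ i).map e.hom p) = (Φ i).map b p := fun p => by
      rw [← ConcreteCategory.comp_apply, ← Functor.map_comp, eb]
    obtain ⟨p, ⟨h1, h2⟩, h3⟩ := hb i x y hxy
    obtain ⟨p, rfl⟩ := he.2 p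
    refine ⟨p, ⟨(ea' p).symm.trans h1, (eb' p).symm.trans h2⟩, fun q hq => he.1 ?_⟩
    exact h3 _ ⟨(ea' q).trans hq.1, (eb' q).trans hq.2⟩

/-- The cells of an object of `V` are taken to be the cells of its image under `U`. -/
lemma HasCells.of_functor [HasCells W] (U : V ⥤ W) [U.ReflectsIsomorphisms]
    [PreservesFiniteProducts U] [PreservesLimitsOfShape WalkingCospan U]
    (hU : PreservesCoprods U) : HasCells V := by
  obtain ⟨ι, Φ, h⟩ := HasCells.out (V := W)
  refine ⟨ι, fun i => U ⋙ Φ i, fun f hf => ?_, fun i J _ X P p hp => ?_, fun i J X P m hm => ?_,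
    fun i P X Y Z a b f g hp => ?_⟩
  · have : IsIso (U.map f) := h.isIso _ hf
    exact isIso_of_reflects_iso f U
  · exact h.prod i _ (hp.map U)
  · exact h.coprod i _ (hU _ hm)
  · exact h.pullback i _ _ _ _ (hp.map U)

namespace IsCellFamily

variable {ι : Type} {Φ : ι → V ⥤ Type v} (h : IsCellFamily Φ)
include h

/-- Coproducts are detected by cells. -/
lemma isCoprod [HasCoproducts.{v} V] {J : Type v} {X : J → V} {P : V} (m : ∀ j, X j ⟶ P)
    (hm : ∀ i, Function.Bijective fun x : Σ j, (Φ i).obj (X j) => (Φ i).map (m x.1) x.2) :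
    IsCoprod m := by
  have hs := isCoprod_sigma X
  -- The comparison with an existing coproduct is bijective on cells, hence invertible.
  have : IsIso (Limits.Sigma.desc m) := h.isIso _ fun i => by
    refine (Function.Bijective.of_comp_iff _ (h.coprod i _ hs)).1 ?_
    convert hm i with x
    refine (ConcreteCategory.comp_apply _ _ _).symm.trans ?_
    rw [← Functor.map_comp, Sigma.ι_desc]
  simpa using hs.comp_iso (Limits.Sigma.desc m)

/-- Pullbacks are detected by cells. -/
lemma isPullback [HasPullbacks V] {P X Y Z : V} {a : P ⟶ X} {b : P ⟶ Y} {f : X ⟶ Z} {g : Y ⟶ Z}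
    (w : a ≫ f = b ≫ g)
    (hp : ∀ i x y, (Φ i).map f x = (Φ i).map g y →
      ∃! p, (Φ i).map a p = x ∧ (Φ i).map b p = y) : IsPullback a b f g := by
  have hs := IsPullback.of_hasPullback f g
  have h1 : pullback.lift a b w ≫ pullback.fst f g = a := pullback.lift_fst _ _ _
  have h2 : pullback.lift a b w ≫ pullback.snd f g = b := pullback.lift_snd _ _ _
  have e1 : ∀ i p, (Φ i).map (pullback.fst f g) ((Φ i).map (pullback.lift a b w) p) =
      (Φ i).map a p := fun i p => by
    rw [← ConcreteCategory.comp_apply, ← Functor.map_comp, h1]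
  have e2 : ∀ i p, (Φ i).map (pullback.snd f g) ((Φ i).map (pullback.lift a b w) p) =
      (Φ i).map b p := fun i p => by
    rw [← ConcreteCategory.comp_apply, ← Functor.map_comp, h2]
  have w' : ∀ i p, (Φ i).map f ((Φ i).map (pullback.fst f g) p) =
      (Φ i).map g ((Φ i).map (pullback.snd f g) p) := fun i p => by
    rw [← ConcreteCategory.comp_apply, ← ConcreteCategory.comp_apply, ← Functor.map_comp,
      ← Functor.map_comp, pullback.condition]
  have wp : ∀ i p, (Φ i).map f ((Φ i).map a p) = (Φ i).map g ((Φ i).map b p) := fun i p => by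
    rw [← e1, ← e2, w']
  -- Cells of the actual pullback are compatible pairs of cells, and by `hp` so are cells of `P`;
  -- hence the comparison is bijective on cells.
  have : IsIso (pullback.lift a b w) := h.isIso _ fun i => by
    constructor
    · intro p q hpq
      refine (hp i _ _ (wp i q)).unique ⟨?_, ?_⟩ ⟨rfl, rfl⟩
      · rw [← e1, hpq, e1]
      · rw [← e2, hpq, e2]
    · intro q
      obtain ⟨p, ⟨hp1, hp2⟩, -⟩ := hp i _ _ (w' i q)
      exact ⟨p, (h.pullback i _ _ _ _ hs _ _ (w' i q)).unique
        ⟨(e1 i p).trans hp1, (e2 i p).trans hp2⟩ ⟨rfl, rfl⟩⟩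
  exact IsPullback.of_iso hs (asIso (pullback.lift a b w)).symm (Iso.refl _) (Iso.refl _)
    (Iso.refl _) (by simpa using h1) (by simpa using h2) (by simp) (by simp)

/-- On cells this is distributivity in sets: a cell of the product is a cell of `X` together with
one cell of each `S l`, and each of the latter lies in exactly one summand. -/
lemma distrib [HasFiniteProducts V] [HasCoproducts.{v} V] : DistribCoprod V where
  isCoprod {n} X I Y S m hm := h.isCoprod _ fun i => by
    have hP := h.prod i _ (isProd_prod_pi X S)
    have hj := fun j : (∀ l, I l) => h.prod i _ (isProd_prod_pi X fun l => Y l (j l))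
    have c0 : ∀ (j : ∀ l, I l) (p : (Φ i).obj (X ⨯ ∏ᶜ fun l => Y l (j l))),
        (Φ i).map prod.fst ((Φ i).map (prod.map (𝟙 X) (Limits.Pi.map fun l => m l (j l))) p) =
        (Φ i).map prod.fst p := fun j p => by
      rw [← ConcreteCategory.comp_apply, ← Functor.map_comp, prod.map_fst, Category.comp_id]
    have c1 : ∀ (j : ∀ l, I l) l (p : (Φ i).obj (X ⨯ ∏ᶜ fun l => Y l (j l))),
        (Φ i).map (prod.snd ≫ Pi.π S l)
          ((Φ i).map (prod.map (𝟙 X) (Limits.Pi.map fun l => m l (j l))) p) =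
        (Φ i).map (m l (j l)) ((Φ i).map (prod.snd ≫ Pi.π _ l) p) := fun j l p => by
      rw [← ConcreteCategory.comp_apply, ← Functor.map_comp, ← ConcreteCategory.comp_apply,
        ← Functor.map_comp, prod.map_snd_assoc, Pi.map_π, Category.assoc]
    have hc := fun l => h.coprod i _ (hm l)
    constructor
    · rintro ⟨j, p⟩ ⟨j', p'⟩ (hpp : (Φ i).map _ p = (Φ i).map _ p')
      have key : ∀ l, (⟨j l, (Φ i).map (prod.snd ≫ Pi.π _ l) p⟩ : Σ k, (Φ i).obj (Y l k)) =
          ⟨j' l, (Φ i).map (prod.snd ≫ Pi.π _ l) p'⟩ := fun l => by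
        refine (hc l).1 ?_
        dsimp only
        rw [← c1, ← c1, hpp]
      obtain rfl : j = j' := funext fun l => congrArg Sigma.fst (key l)
      obtain rfl : p = p' := (hj j).1 <| by
        funext o
        cases o with
        | none => exact (c0 j p).symm.trans ((congrArg _ hpp).trans (c0 j p'))
        | some l => exact eq_of_heq (Sigma.mk.inj (key l)).2
      rfl
    · intro p
      choose y hy using fun l => (hc l).2 ((Φ i).map (prod.snd ≫ Pi.π S l) p)
      obtain ⟨q, hq⟩ := (hj fun l => (y l).1).2 fun o => match o with
        | none => (Φ i).map prod.fst p
        | some l => (y l).2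
      refine ⟨⟨fun l => (y l).1, q⟩, hP.1 ?_⟩
      funext o
      cases o with
      | none => exact (c0 _ _).trans (congrFun hq none)
      | some l =>
        refine (c1 _ _ _).trans ((congrArg _ (congrFun hq (some l))).trans (hy l))

/-- A coproduct of pullback squares along a map of index sets is a pullback square. -/
lemma isPullback_coprod [HasPullbacks V] {I J : Type v} (σ : I → J) {P R : I → V} {Q S : J → V}
    {t : ∀ i, P i ⟶ Q (σ i)} {l : ∀ i, P i ⟶ R i} {r : ∀ j, Q j ⟶ S j} {b : ∀ i, R i ⟶ S (σ i)}
    (hs : ∀ i, IsPullback (t i) (l i) (r (σ i)) (b i)) {P' Q' R' S' : V}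
    {p : ∀ i, P i ⟶ P'} {q : ∀ j, Q j ⟶ Q'} {ρ : ∀ i, R i ⟶ R'} {s : ∀ j, S j ⟶ S'}
    (hp : IsCoprod p) (hq : IsCoprod q) (hρ : IsCoprod ρ) (hs' : IsCoprod s)
    {T : P' ⟶ Q'} {L : P' ⟶ R'} {M : Q' ⟶ S'} {B : R' ⟶ S'}
    (hT : ∀ i, p i ≫ T = t i ≫ q (σ i)) (hL : ∀ i, p i ≫ L = l i ≫ ρ i)
    (hM : ∀ j, q j ≫ M = r j ≫ s j) (hB : ∀ i, ρ i ≫ B = b i ≫ s (σ i)) :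
    IsPullback T L M B := by
  refine h.isPullback (hp.hom_ext fun i => ?_) fun c y z hyz => ?_
  · rw [← Category.assoc, hT, Category.assoc, hM, ← Category.assoc, (hs i).w, ← Category.assoc,
      hL, Category.assoc, Category.assoc, hB]
  · have eT : ∀ i x, (Φ c).map T ((Φ c).map (p i) x) = (Φ c).map (q (σ i)) ((Φ c).map (t i) x) :=
      fun i x => by simp only [← ConcreteCategory.comp_apply, ← Functor.map_comp, hT]
    have eL : ∀ i x, (Φ c).map L ((Φ c).map (p i) x) = (Φ c).map (ρ i) ((Φ c).map (l i) x) :=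
      fun i x => by simp only [← ConcreteCategory.comp_apply, ← Functor.map_comp, hL]
    have eM : ∀ j x, (Φ c).map M ((Φ c).map (q j) x) = (Φ c).map (s j) ((Φ c).map (r j) x) :=
      fun i x => by simp only [← ConcreteCategory.comp_apply, ← Functor.map_comp, hM]
    have eB : ∀ i x, (Φ c).map B ((Φ c).map (ρ i) x) = (Φ c).map (s (σ i)) ((Φ c).map (b i) x) :=
      fun i x => by simp only [← ConcreteCategory.comp_apply, ← Functor.map_comp, hB]
    obtain ⟨⟨j, y⟩, rfl⟩ := (h.coprod c _ hq).2 y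
    obtain ⟨⟨i, z⟩, rfl⟩ := (h.coprod c _ hρ).2 z
    dsimp only at hyz
    rw [eM, eB] at hyz
    -- A cell of `S'` lies in only one summand, so `y` and `z` can have the same image only if `j`
    -- is the index `σ i`.
    have := (h.coprod c _ hs').1 (a₁ := ⟨j, (Φ c).map (r j) y⟩)
      (a₂ := ⟨σ i, (Φ c).map (b i) z⟩) hyz
    obtain rfl : j = σ i := congrArg Sigma.fst this
    have hyz' : (Φ c).map (r (σ i)) y = (Φ c).map (b i) z := eq_of_heq (Sigma.mk.inj this).2
    obtain ⟨x, ⟨hx1, hx2⟩, hx3⟩ := h.pullback c _ _ _ _ (hs i) _ _ hyz'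
    refine ⟨(Φ c).map (p i) x, ⟨?_, ?_⟩, ?_⟩
    · dsimp only
      rw [eT, hx1]
    · dsimp only
      rw [eL, hx2]
    · rintro x' ⟨h1, h2⟩
      obtain ⟨⟨i', x'⟩, rfl⟩ := (h.coprod c _ hp).2 x'
      dsimp only at h1 h2 ⊢
      rw [eT] at h1
      rw [eL] at h2
      have h2' := (h.coprod c _ hρ).1 (a₁ := ⟨i', (Φ c).map (l i') x'⟩) (a₂ := ⟨i, z⟩) h2
      obtain rfl : i' = i := congrArg Sigma.fst h2'
      have h1' := (h.coprod c _ hq).1 (a₁ := ⟨σ i', (Φ c).map (t i') x'⟩) (a₂ := ⟨σ i', y⟩) h1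
      rw [hx3 x' ⟨eq_of_heq (Sigma.mk.inj h1').2, eq_of_heq (Sigma.mk.inj h2').2⟩]

end IsCellFamily

instance (priority := low) DistribCoprod.of_hasCells [HasFiniteProducts V] [HasCoproducts.{v} V]
    [HasCells V] : DistribCoprod V := by
  obtain ⟨_, _, h⟩ := HasCells.out (V := V)
  exact h.distrib

end Coprod

/-- The identity functor alone is a cell family: elements are maps from a point. -/
instance hasCells_type : HasCells (Type v) := by
  refine ⟨Unit, fun _ => 𝟭 _, fun f hf => ?_, fun i J _ X P p hp => ?_, fun i J X P m hm => ?_,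
    fun i P X Y Z a b f g hp x y hxy => ?_⟩
  · exact (isIso_iff_bijective f).2 (hf ())
  · constructor
    · intro x y hxy
      have := (hp fun j => ↾(fun _ : PUnit => p j x)).unique (y₁ := ↾fun _ => x)
        (y₂ := ↾fun _ => y) (fun j => rfl) (fun j => by ext; exact (congrFun hxy j).symm)
      exact ConcreteCategory.congr_hom this PUnit.unit
    · intro f
      obtain ⟨u, hu, -⟩ := hp fun j => ↾(fun _ : PUnit => f j)
      exact ⟨u PUnit.unit, funext fun j => ConcreteCategory.congr_hom (hu j) PUnit.unit⟩
  · obtain ⟨hm⟩ := isCoprod_iff_nonempty_isColimit.1 hm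
    exact (Cofan.nonempty_isColimit_iff_bijective_fromSigma _).1 ⟨hm⟩
  · obtain ⟨hi, hs⟩ := (Types.isPullback_iff _ _ _ _).1 hp |>.2
    obtain ⟨p, h1, h2⟩ := hs x y hxy
    exact ⟨p, ⟨h1, h2⟩, fun p' h' => hi _ _ ⟨h'.1.trans h1.symm, h'.2.trans h2.symm⟩⟩

lemma isPullback_of_existsUnique {V : Type u} [Category.{v} V] {P X Y Z : V} {a : P ⟶ X}
    {b : P ⟶ Y} {f : X ⟶ Z} {g : Y ⟶ Z} (w : a ≫ f = b ≫ g)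
    (h : ∀ ⦃S : V⦄ (s : S ⟶ X) (t : S ⟶ Y), s ≫ f = t ≫ g → ∃! u, u ≫ a = s ∧ u ≫ b = t) :
    IsPullback a b f g := by
  choose l hl hl' using h
  exact ⟨⟨w⟩, ⟨PullbackCone.IsLimit.mk w (fun s => l s.fst s.snd s.condition)
    (fun s => (hl s.fst s.snd s.condition).1) (fun s => (hl s.fst s.snd s.condition).2)
    fun s m h1 h2 => hl' s.fst s.snd s.condition m ⟨h1, h2⟩⟩⟩

/-! ### Pullbacks, disjoint unions and cells of enriched graphs. -/

namespace EGraph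

variable {V : Type u} [Category.{v} V] {W : Type u'} [Category.{v} W]

lemma obj_congr {X Y : EGraph V} {f g : X ⟶ Y} (h : f = g) (a : X.obj) : f.obj a = g.obj a := by
  rw [h]

lemma eqToHom_hom {X Y : EGraph V} (f : X ⟶ Y) {a b a' b' : X.obj} (ha : a = a') (hb : b = b') :
    eqToHom (congrArg₂ X.hom ha hb) ≫ f.hom a' b' =
      f.hom a b ≫ eqToHom (congrArg₂ Y.hom (congrArg f.obj ha) (congrArg f.obj hb)) := by
  subst ha hb
  simp

/-- Pullbacks of graphs are formed on objects and then on homs. The transport is there because the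
two composites on objects agree only propositionally, so that the two legs would otherwise end in
different homs of `Z`. -/
lemma isPullback {P X Y Z : EGraph V} {a : P ⟶ X} {b : P ⟶ Y} {f : X ⟶ Z} {g : Y ⟶ Z}
    (w : a ≫ f = b ≫ g) (ho : ∀ x y, f.obj x = g.obj y → ∃! p, a.obj p = x ∧ b.obj p = y)
    (hh : ∀ p q, IsPullback (a.hom p q) (b.hom p q) (f.hom (a.obj p) (a.obj q))
      (g.hom (b.obj p) (b.obj q) ≫
        eqToHom (congrArg₂ Z.hom (obj_congr w p).symm (obj_congr w q).symm))) :
    IsPullback a b f g := by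
  refine isPullback_of_existsUnique w fun S s t hst => ?_
  choose l hl hl' using fun c => ho _ _ (obj_congr hst c)
  obtain ⟨so, sh⟩ := s
  obtain ⟨ta, th⟩ := t
  obtain rfl : so = fun c => a.obj (l c) := funext fun c => (hl c).1.symm
  obtain rfl : ta = fun c => b.obj (l c) := funext fun c => (hl c).2.symm
  have hc : ∀ c d, sh c d ≫ f.hom _ _ = th c d ≫ g.hom _ _ ≫
      eqToHom (congrArg₂ Z.hom (obj_congr w (l c)).symm (obj_congr w (l d)).symm) := fun c d => by
    have := hom_congr hst c d
    rw [comp_hom, comp_hom] at this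
    dsimp only at this
    rw [← Category.assoc (th c d), ← this]
    simp
  refine ⟨⟨l, fun c d => (hh (l c) (l d)).lift _ _ (hc c d)⟩, ⟨?_, ?_⟩, ?_⟩
  · exact hom_ext (fun _ => rfl) fun c d => by
      rw [comp_hom]
      simp
  · exact hom_ext (fun _ => rfl) fun c d => by
      rw [comp_hom]
      simp
  · rintro ⟨mo, mh⟩ ⟨h1, h2⟩
    obtain rfl : mo = l := funext fun c => hl' c _ ⟨obj_congr h1 c, obj_congr h2 c⟩
    refine hom_ext (fun _ => rfl) fun c d => ?_
    refine (Category.comp_id _).trans ((hh _ _).hom_ext ?_ ?_)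
    · have := hom_congr h1 c d
      rw [comp_hom] at this
      simpa using this
    · have := hom_congr h2 c d
      rw [comp_hom] at this
      simpa using this

/-- The explicit pullback of enriched graphs. -/
lemma exists_isPullback [HasPullbacks V] {X Y Z : EGraph V} (f : X ⟶ Z) (g : Y ⟶ Z) :
    ∃ (P : EGraph V) (a : P ⟶ X) (b : P ⟶ Y) (w : a ≫ f = b ≫ g),
      (∀ x y, f.obj x = g.obj y → ∃! p, a.obj p = x ∧ b.obj p = y) ∧
      (∀ p q, IsPullback (a.hom p q) (b.hom p q) (f.hom (a.obj p) (a.obj q))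
        (g.hom (b.obj p) (b.obj q) ≫
          eqToHom (congrArg₂ Z.hom (obj_congr w p).symm (obj_congr w q).symm))) := by
  let P : EGraph V :=
    { obj := {p : X.obj × Y.obj // f.obj p.1 = g.obj p.2}
      hom := fun p q => Limits.pullback (f.hom p.1.1 q.1.1) (g.hom p.1.2 q.1.2 ≫
        eqToHom (congrArg₂ Z.hom p.2.symm q.2.symm)) }
  let a : P ⟶ X := ⟨fun p => p.1.1, fun p q => pullback.fst _ _⟩
  let b : P ⟶ Y := ⟨fun p => p.1.2, fun p q => pullback.snd _ _⟩
  have w : a ≫ f = b ≫ g := hom_ext (fun p => p.2) fun p q => by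
    have h := pullback.condition (f := f.hom p.1.1 q.1.1) (g := g.hom p.1.2 q.1.2 ≫
        eqToHom (congrArg₂ Z.hom p.2.symm q.2.symm))
    rw [comp_hom, comp_hom]
    refine (congrArg (· ≫ eqToHom _) h).trans ?_
    simp
    rfl
  refine ⟨P, a, b, w, fun x y h => ⟨⟨⟨x, y⟩, h⟩, ⟨rfl, rfl⟩, ?_⟩, fun p q =>
    IsPullback.of_hasPullback _ _⟩
  rintro ⟨⟨x', y'⟩, h'⟩ ⟨rfl, rfl⟩
  rfl

instance [HasPullbacks V] : HasPullbacks (EGraph V) :=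
  haveI : ∀ {X Y Z : EGraph V} {f : X ⟶ Z} {g : Y ⟶ Z}, HasLimit (cospan f g) :=
    fun {X Y Z f g} => by
      obtain ⟨P, a, b, w, h1, h2⟩ := exists_isPullback f g
      exact (isPullback w h1 h2).hasPullback
  hasPullbacks_of_hasLimit_cospan _

/-- A family of morphisms of enriched graphs exhibits its target as a disjoint union. -/
structure IsSum {J : Type v} {X : J → EGraph V} {P : EGraph V} (m : ∀ j, X j ⟶ P) : Prop where
  obj : Function.Bijective fun x : Σ j, (X j).obj => (m x.1).obj x.2
  iso : ∀ j a b, IsIso ((m j).hom a b)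
  initial : ∀ j j' a b, j ≠ j' → Nonempty (IsInitial (P.hom ((m j).obj a) ((m j').obj b)))

namespace IsSum

variable {J : Type v} {X : J → EGraph V} {P : EGraph V} {m : ∀ j, X j ⟶ P} (h : IsSum m)
include h

lemma exists_obj (p : P.obj) : ∃ j a, (m j).obj a = p := by
  obtain ⟨⟨j, a⟩, hp⟩ := h.obj.2 p
  exact ⟨j, a, hp⟩

lemma inj {j j' : J} {a : (X j).obj} {a' : (X j').obj} (e : (m j).obj a = (m j').obj a') :
    (⟨j, a⟩ : Σ j, (X j).obj) = ⟨j', a'⟩ := h.obj.1 e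

/-- On each summand the map out is prescribed, and between different summands the homs are initial,
so there is exactly one way to complete it. -/
lemma isCoprod : IsCoprod m := by
  intro W f
  choose i r hr using h.exists_obj
  have ho : ∀ j a, (f (i ((m j).obj a))).obj (r ((m j).obj a)) = (f j).obj a := fun j a => by
    have := h.inj (hr ((m j).obj a))
    exact congrArg (fun x : Σ j, (X j).obj => (f x.1).obj x.2) this
  -- Only the values of the object map on the summands matter; the chosen representatives are
  -- forgotten.
  generalize ho' : (fun p => (f (i p)).obj (r p)) = o at ho
  replace ho : ∀ j a, o ((m j).obj a) = (f j).obj a := by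
    subst ho'
    exact ho
  clear hr ho'
  -- Quantifying over all representatives of `p` and `q` pins down the hom map without a choice. It
  -- is forced by the isomorphism with a hom of the summand, or else by initiality.
  have key : ∀ p q, ∃! u : P.hom p q ⟶ W.hom (o p) (o q),
      ∀ j a b (ha : (m j).obj a = p) (hb : (m j).obj b = q),
        (m j).hom a b ≫ eqToHom (congrArg₂ P.hom ha hb) ≫ u =
          (f j).hom a b ≫ eqToHom (by rw [← ha, ← hb, ho, ho]) := fun p q => by
    obtain ⟨j, a, rfl⟩ := h.exists_obj p
    obtain ⟨j', b, rfl⟩ := h.exists_obj q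
    by_cases hj : j = j'
    · subst hj
      have := h.iso j a b
      refine ⟨inv ((m j).hom a b) ≫ (f j).hom a b ≫ eqToHom (by rw [ho, ho]),
        fun j' a' b' ha hb => ?_, fun u hu => ?_⟩
      · have h1 := h.inj ha
        have h2 := h.inj hb
        obtain rfl : j' = j := congrArg Sigma.fst h1
        obtain rfl : a' = a := eq_of_heq (Sigma.mk.inj h1).2
        obtain rfl : b' = b := eq_of_heq (Sigma.mk.inj h2).2
        simp
      · rw [IsIso.eq_inv_comp, ← hu j a b rfl rfl]
        simp
    · obtain ⟨hI⟩ := h.initial j j' a b hj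
      refine ⟨hI.to _, fun k a' b' ha hb => ?_, fun u _ => hI.hom_ext _ _⟩
      have h1 : k = j := congrArg Sigma.fst (h.inj ha)
      have h2 : k = j' := congrArg Sigma.fst (h.inj hb)
      exact absurd (h1.symm.trans h2) hj
  choose u hu hu' using key
  refine ⟨⟨o, u⟩, fun j => hom_ext (ho j) fun a b => ?_, fun n hn => ?_⟩
  · have := hu _ _ j a b rfl rfl
    rw [eqToHom_refl, Category.id_comp] at this
    rw [comp_hom]
    refine (congrArg (· ≫ _) this).trans ?_
    simp
  · obtain ⟨no, nh⟩ := n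
    obtain rfl : no = o := funext fun p => by
      obtain ⟨j, a, rfl⟩ := h.exists_obj p
      exact (obj_congr (hn j) a).trans (ho j a).symm
    refine hom_ext (fun _ => rfl) fun p q => (Category.comp_id _).trans (hu' p q _ ?_)
    rintro j a b rfl rfl
    have := hom_congr (hn j).symm a b
    rw [comp_hom] at this
    rw [eqToHom_refl, Category.id_comp]
    exact this.symm

end IsSum

/-- Such a morphism exhibits its target as a disjoint union with one summand, and the universal
property of this coproduct yields the inverse. -/
lemma isIso_of_bijective {X Y : EGraph V} (f : X ⟶ Y) (ho : Function.Bijective f.obj)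
    (hh : ∀ a b, IsIso (f.hom a b)) : IsIso f := by
  have h : IsSum (J := PUnit) (X := fun _ => X) (fun _ => f) :=
    { obj := ⟨fun ⟨_, x⟩ ⟨_, y⟩ e => by
        obtain rfl : x = y := ho.1 e
        rfl, fun y => by
        obtain ⟨x, rfl⟩ := ho.2 y
        exact ⟨⟨⟨⟩, x⟩, rfl⟩⟩
      iso := fun _ => hh
      initial := fun _ _ _ _ h => absurd rfl h }
  obtain ⟨u, hu, -⟩ := h.isCoprod fun _ => 𝟙 X
  replace hu : f ≫ u = 𝟙 X := hu ⟨⟩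
  refine ⟨u, hu, h.isCoprod.hom_ext fun _ => ?_⟩
  rw [← Category.assoc, hu, Category.id_comp, Category.comp_id]

open Classical in
/-- The disjoint union of a family of enriched graphs. -/
noncomputable def sum [HasInitial V] {J : Type v} (X : J → EGraph V) : EGraph V where
  obj := Σ j, (X j).obj
  hom x y := if h : x.1 = y.1 then (X y.1).hom (h ▸ x.2) y.2 else ⊥_ V

lemma sum_hom [HasInitial V] {J : Type v} (X : J → EGraph V) (j : J) (a b : (X j).obj) :
    (X j).hom a b = (sum X).hom ⟨j, a⟩ ⟨j, b⟩ := by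
  simp [sum]

noncomputable def sumι [HasInitial V] {J : Type v} (X : J → EGraph V) (j : J) : X j ⟶ sum X where
  obj a := ⟨j, a⟩
  hom a b := eqToHom (sum_hom X j a b)

lemma isSum_sumι [HasInitial V] {J : Type v} (X : J → EGraph V) : IsSum (sumι X) where
  obj := Function.bijective_id
  iso j a b := inferInstanceAs (IsIso (eqToHom (sum_hom X j a b)))
  initial j j' a b h := by
    have : (sum X).hom ⟨j, a⟩ ⟨j', b⟩ = ⊥_ V := dif_neg h
    exact ⟨initialIsInitial.ofIso (eqToIso this.symm)⟩

/-- Apart from isomorphisms, the only homs in a disjoint union that need care are the initial ones.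
-/
lemma IsSum.map {J : Type v} {X : J → EGraph V} {P : EGraph V} {m : ∀ j, X j ⟶ P} (h : IsSum m)
    (F : V ⥤ W) (hF : ∀ I : V, Nonempty (IsInitial I) → Nonempty (IsInitial (F.obj I))) :
    IsSum fun j => (EGraph.map F).map (m j) where
  obj := h.obj
  iso j a b :=
    haveI := h.iso j a b
    inferInstanceAs (IsIso (F.map _))
  initial j j' a b hj := hF _ (h.initial j j' a b hj)

/-- The cells of positive dimension of an enriched graph. -/
def arrows (F : V ⥤ Type v) : EGraph V ⥤ Type v where
  obj X := Σ a b, F.obj (X.hom a b)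
  map f := ↾fun x => ⟨f.obj x.1, f.obj x.2.1, F.map (f.hom x.1 x.2.1) x.2.2⟩
  map_id X := by
    refine ConcreteCategory.hom_ext _ _ fun ⟨a, b, x⟩ => ?_
    exact congrArg (fun y => (⟨a, b, y⟩ : Σ a b, F.obj (X.hom a b)))
      (ConcreteCategory.congr_hom (F.map_id _) x)
  map_comp {X Y Z} f g := by
    refine ConcreteCategory.hom_ext _ _ fun ⟨a, b, x⟩ => ?_
    exact congrArg (fun y => (⟨g.obj (f.obj a), g.obj (f.obj b), y⟩ : Σ a b, F.obj (Z.hom a b)))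
      (ConcreteCategory.congr_hom (F.map_comp _ _) x)

/-- The set of objects of an enriched graph. -/
def objects (V : Type u) [Category.{v} V] : EGraph V ⥤ Type v where
  obj X := X.obj
  map f := ↾f.obj

/-- Replaces heterogeneous equality of cells by a transport along `eqToHom`, which functors respect.
-/
lemma arrow_mk_eq {F : V ⥤ Type v} {X : EGraph V} {a b a' b' : X.obj} {x : F.obj (X.hom a b)}
    {x' : F.obj (X.hom a' b')} :
    (⟨a, b, x⟩ : Σ a b, F.obj (X.hom a b)) = ⟨a', b', x'⟩ ↔
      ∃ (ha : a = a') (hb : b = b'), F.map (eqToHom (congrArg₂ X.hom ha hb)) x = x' := by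
  constructor
  · intro h
    obtain rfl := congrArg Sigma.fst h
    obtain rfl := congrArg Sigma.fst (eq_of_heq (Sigma.mk.inj h).2)
    refine ⟨rfl, rfl, ?_⟩
    have := eq_of_heq (Sigma.mk.inj (eq_of_heq (Sigma.mk.inj h).2)).2
    subst this
    simp
  · rintro ⟨rfl, rfl, rfl⟩
    simp

lemma arrows_map_bijective {F : V ⥤ Type v} {X Y : EGraph V} (f : X ⟶ Y)
    (ho : Function.Injective f.obj) (h : Function.Bijective ((arrows F).map f)) (a b : X.obj) :
    Function.Bijective (F.map (f.hom a b)) := by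
  constructor
  · intro x y hxy
    have := h.1 (a₁ := ⟨a, b, x⟩) (a₂ := ⟨a, b, y⟩)
      (congrArg (Sigma.mk (f.obj a)) (congrArg (Sigma.mk (f.obj b)) hxy))
    exact eq_of_heq (Sigma.mk.inj (eq_of_heq (Sigma.mk.inj this).2)).2
  · intro y
    obtain ⟨⟨a', b', x⟩, hx⟩ := h.2 ⟨f.obj a, f.obj b, y⟩
    obtain rfl : a' = a := ho (congrArg Sigma.fst hx)
    have hx' := eq_of_heq (Sigma.mk.inj hx).2
    obtain rfl : b' = b := ho (congrArg Sigma.fst hx')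
    exact ⟨x, eq_of_heq (Sigma.mk.inj hx').2⟩

lemma isProd_proj {J : Type} {X : J → EGraph V} (P : EGraph V) (p : ∀ j, P ⟶ X j)
    (hb : Function.Bijective (fun (x : P.obj) (j : J) => (p j).obj x))
    (hl : ∀ a b, IsProd fun j => (p j).hom a b) : IsProd p :=
  isProd_iff_nonempty_isLimit.2 (isLimit_fan P p hb hl)

/-- The cells of a graph are its objects and the cells of its homs, indexed by `none` and `some i`.
All the constructions involved are computed on objects and homs, so the properties are inherited
from `Φ`. -/
lemma isCellFamily {ι : Type} {Φ : ι → V ⥤ Type v} (h : IsCellFamily Φ) [HasFiniteProducts V]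
    [HasPullbacks V] [HasInitial V] :
    IsCellFamily fun o : Option ι => o.elim (objects V) fun i => arrows (Φ i) := by
  refine .of_exists (fun {X Y} f hf => ?_) (fun {J} _ X => ?_) (fun {J} X => ?_)
    (fun {X Y Z} f g => ?_)
  · have ho : Function.Bijective f.obj := hf none
    exact isIso_of_bijective f ho fun a b => h.isIso _ fun i =>
      arrows_map_bijective f ho.1 (hf (some i)) a b
  · let P : EGraph V := ⟨∀ j, (X j).obj, fun a b => ∏ᶜ fun j => (X j).hom (a j) (b j)⟩
    let p : ∀ j, P ⟶ X j := fun j => ⟨fun a => a j, fun a b => Pi.π _ j⟩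
    have hh : ∀ a b, IsProd fun j => (p j).hom a b := fun a b =>
      isProd_iff_nonempty_isLimit.2 ⟨productIsProduct fun j => (X j).hom (a j) (b j)⟩
    refine ⟨P, p, isProd_proj P p Function.bijective_id hh, ?_⟩
    rintro (_ | i)
    · exact Function.bijective_id
    · have hb := fun a b => h.prod i _ (hh a b)
      constructor
      · rintro ⟨a, b, x⟩ ⟨a', b', y⟩ hxy
        have hj : ∀ j, _ := fun j => arrow_mk_eq.1 (congrFun hxy j)
        obtain rfl : a = a' := funext fun j => (hj j).1
        obtain rfl : b = b' := funext fun j => (hj j).2.1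
        obtain rfl : x = y := (hb a b).1 (funext fun j => by
          obtain ⟨_, _, e⟩ := hj j
          simpa using e)
        rfl
      · intro y
        obtain ⟨x, hx⟩ := (hb (fun j => (y j).1) fun j => (y j).2.1).2 fun j => (y j).2.2
        refine ⟨⟨_, _, x⟩, funext fun j => ?_⟩
        exact congrArg (fun z => (⟨(y j).1, (y j).2.1, z⟩ : Σ a b, (Φ i).obj ((X j).hom a b)))
          (congrFun hx j)
  · refine ⟨_, _, (isSum_sumι X).isCoprod, ?_⟩
    have hs := isSum_sumι X
    rintro (_ | i)
    · exact Function.bijective_id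
    · constructor
      · rintro ⟨j, a, b, x⟩ ⟨j', a', b', x'⟩ hxy
        obtain ⟨ha, hb, e⟩ := arrow_mk_eq.1 hxy
        have h1 := hs.inj ha
        have h2 := hs.inj hb
        obtain rfl : j = j' := congrArg Sigma.fst h1
        obtain rfl : a = a' := eq_of_heq (Sigma.mk.inj h1).2
        obtain rfl : b = b' := eq_of_heq (Sigma.mk.inj h2).2
        have := hs.iso j a b
        obtain rfl : x = x' := (ConcreteCategory.bijective_of_isIso
          ((Φ i).map ((sumι X j).hom a b))).1 (by simpa using e)
        rfl
      · rintro ⟨⟨j, a⟩, ⟨j', b⟩, x⟩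
        by_cases hj : j = j'
        · subst hj
          have := hs.iso j a b
          obtain ⟨y, hy⟩ := (ConcreteCategory.bijective_of_isIso
            ((Φ i).map ((sumι X j).hom a b))).2 x
          exact ⟨⟨j, a, b, y⟩, congrArg (fun z => (⟨⟨j, a⟩, ⟨j, b⟩, z⟩ :
            Σ a b, (Φ i).obj ((sum X).hom a b))) hy⟩
        · obtain ⟨hI⟩ := hs.initial j j' a b hj
          -- An initial object is an empty coproduct, so it has no cells: no cell joins different
          -- summands.
          have : IsCoprod (J := PEmpty) (X := fun _ => ⊥_ V) (P := (sum X).hom ⟨j, a⟩ ⟨j', b⟩)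
            (fun j => j.elim) := fun W f => ⟨hI.to W, fun j => j.elim, fun u _ => hI.hom_ext _ _⟩
          obtain ⟨⟨k, _⟩, _⟩ := (h.coprod i _ this).2 x
          exact k.elim
  · obtain ⟨P, a, b, w, h1, h2⟩ := exists_isPullback f g
    refine ⟨P, a, b, isPullback w h1 h2, ?_⟩
    rintro (_ | i)
    · exact h1
    · rintro ⟨x₁, x₂, x⟩ ⟨y₁, y₂, y⟩ hxy
      obtain ⟨e1, e2, e⟩ := arrow_mk_eq.1 hxy
      obtain ⟨p, ⟨rfl, rfl⟩, hp⟩ := h1 x₁ y₁ e1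
      obtain ⟨q, ⟨rfl, rfl⟩, hq⟩ := h1 x₂ y₂ e2
      have e' : (Φ i).map (f.hom (a.obj p) (a.obj q)) x = (Φ i).map (g.hom (b.obj p) (b.obj q) ≫
          eqToHom (congrArg₂ Z.hom (obj_congr w p).symm (obj_congr w q).symm)) y := by
        rw [Functor.map_comp, ConcreteCategory.comp_apply, ← e, ← ConcreteCategory.comp_apply,
          ← Functor.map_comp, eqToHom_trans]
        simp
      obtain ⟨z, ⟨hz1, hz2⟩, hz⟩ := h.pullback i _ _ _ _ (h2 p q) x y e'
      refine ⟨⟨p, q, z⟩, ⟨?_, ?_⟩, ?_⟩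
      · exact congrArg (fun z => (⟨a.obj p, a.obj q, z⟩ : Σ a b, (Φ i).obj (X.hom a b))) hz1
      · exact congrArg (fun z => (⟨b.obj p, b.obj q, z⟩ : Σ a b, (Φ i).obj (Y.hom a b))) hz2
      · rintro ⟨p', q', z'⟩ ⟨k1, k2⟩
        obtain ⟨m1, m2, m3⟩ := arrow_mk_eq.1 k1
        obtain ⟨n1, n2, n3⟩ := arrow_mk_eq.1 k2
        obtain rfl : p' = p := hp _ ⟨m1, n1⟩
        obtain rfl : q' = q := hq _ ⟨m2, n2⟩
        rw [hz z' ⟨by simpa using m3, by simpa using n3⟩]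

instance [HasFiniteProducts V] [HasPullbacks V] [HasInitial V] [HasCells V] :
    HasCells (EGraph V) := by
  obtain ⟨ι, Φ, h⟩ := HasCells.out (V := V)
  exact ⟨_, _, isCellFamily h⟩

/-- Applying adjoint functors to all homs gives adjoint functors between categories of enriched
graphs. -/
def mapAdjunction {F : V ⥤ W} {U : W ⥤ V} (adj : F ⊣ U) : map F ⊣ map U where
  unit :=
    { app := fun X => ⟨id, fun a b => adj.unit.app (X.hom a b)⟩
      naturality := fun X Y f => hom_ext (fun _ => rfl) fun a b =>
        (Category.comp_id _).trans (adj.unit.naturality (f.hom a b)) }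
  counit :=
    { app := fun X => ⟨id, fun a b => adj.counit.app (X.hom a b)⟩
      naturality := fun X Y f => hom_ext (fun _ => rfl) fun a b =>
        (Category.comp_id _).trans (adj.counit.naturality (f.hom a b)) }
  left_triangle_components X := hom_ext (fun _ => rfl) fun a b =>
    (Category.comp_id _).trans (adj.left_triangle_components (X.hom a b))
  right_triangle_components X := hom_ext (fun _ => rfl) fun a b =>
    (Category.comp_id _).trans (adj.right_triangle_components (X.hom a b))

end EGraph

/-! ### Strict initial objects and chains in disjoint unions. -/

section

variable {V : Type u} [Category.{v} V]

/-- Initial objects are strict when products distribute over coproducts. -/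
lemma DistribCoprod.strict [HasFiniteProducts V] [DistribCoprod V] {I Z : V} (hI : IsInitial I)
    (f : Z ⟶ I) : Nonempty (IsInitial Z) := by
  -- Distributivity over the empty coproduct makes the product of `Z` and `I` initial. The map `f`
  -- exhibits `Z` as a retract of this product, which makes `Z` initial as well.
  have h := DistribCoprod.isCoprod (n := 1) Z (I := fun _ => PEmpty) (Y := fun _ _ => I)
    (S := fun _ => I) (fun _ i => i.elim)
    (fun _ W g => ⟨hI.to W, fun i => i.elim, fun u _ => hI.hom_ext _ _⟩)
  refine ⟨IsInitial.ofUniqueHom (fun W => prod.lift (𝟙 Z) (Pi.lift fun _ => f) ≫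
    h.desc fun j => (j 0).elim) fun W u => ?_⟩
  have e : prod.fst ≫ u = h.desc fun j => (j 0).elim := h.hom_ext fun j => (j 0).elim
  rw [← e, ← Category.assoc, prod.lift_fst, Category.id_comp]

lemma exists_comp_eq {Z : V} {n : ℕ} {X P : Fin n → V} (m : ∀ l, X l ⟶ P l) [∀ l, IsIso (m l)]
    (f : ∀ l, Z ⟶ P l) : ∃ f' : ∀ l, Z ⟶ X l, f = fun l => f' l ≫ m l :=
  ⟨fun l => f l ≫ inv (m l), by simp⟩

/-- An initial object is a coproduct of the empty family. -/
lemma PreservesCoprods.initial {W : Type u'} [Category.{v} W] {F : V ⥤ W}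
    (hF : PreservesCoprods F) (I : V) (hI : Nonempty (IsInitial I)) :
    Nonempty (IsInitial (F.obj I)) := by
  obtain ⟨hI⟩ := hI
  have := hF (J := PEmpty) (X := fun j => j.elim) (P := I) (fun j => j.elim)
    fun W g => ⟨hI.to W, fun i => i.elim, fun u _ => hI.hom_ext _ _⟩
  exact ⟨IsInitial.ofUniqueHom (fun W => this.desc fun j => j.elim)
    fun W u => this.hom_ext fun j => j.elim⟩

end

lemma Chain.ext_pt {α : Type v} {n : ℕ} {a b : α} {p q : Chain α n a b}
    (h : ∀ i, p.pt i = q.pt i) : p = q := by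
  cases p
  cases q
  congr
  exact funext h

namespace EGraph.IsSum

variable {V : Type u} [Category.{v} V] {J : Type v} {X : J → EGraph V} {P : EGraph V}
  {m : ∀ j, X j ⟶ P} (h : IsSum m)
include h

lemma inj_obj {j : J} {a a' : (X j).obj} (e : (m j).obj a = (m j).obj a') : a = a' :=
  eq_of_heq (Sigma.mk.inj (h.inj e)).2

/-- A chain in a disjoint union lies in one of the summands unless it has a step whose hom is
initial. -/
lemma chain {n : ℕ} {a b : P.obj} (p : Chain P.obj n a b) :
    (∃ l, Nonempty (IsInitial (P.hom (p.src l) (p.tgt l)))) ∨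
      ∃ (j : J) (a' b' : (X j).obj) (p' : Chain (X j).obj n a' b'),
        (m j).obj a' = a ∧ (m j).obj b' = b ∧ ∀ i, p.pt i = (m j).obj (p'.pt i) := by
  choose c r hr using h.exists_obj
  -- Either some step changes the summand, and its hom is initial, or the summand is constant along
  -- the chain.
  by_cases hc : ∃ l, c (p.src l) ≠ c (p.tgt l)
  · obtain ⟨l, hl⟩ := hc
    have := h.initial _ _ (r (p.src l)) (r (p.tgt l)) hl
    rw [hr, hr] at this
    exact .inl ⟨l, this⟩
  · push Not at hc
    have h0 : ∀ i, c (p.pt i) = c a := by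
      intro i
      induction i using Fin.induction with
      | zero => rw [p.first]
      | succ i ih => exact (hc i).symm.trans ih
    have h1 : ∀ i, ∃ x : (X (c a)).obj, p.pt i = (m (c a)).obj x := fun i => by
      rw [← h0 i]
      exact ⟨_, (hr _).symm⟩
    choose x hx using h1
    exact .inr ⟨c a, x 0, x (Fin.last n), ⟨x, rfl, rfl⟩, (hx 0).symm.trans p.first,
      (hx _).symm.trans p.last, hx⟩

lemma chain_of_ends {n : ℕ} {j : J} {a b : (X j).obj}
    (p : Chain P.obj n ((m j).obj a) ((m j).obj b)) :
    (∃ l, Nonempty (IsInitial (P.hom (p.src l) (p.tgt l)))) ∨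
      ∃ p' : Chain (X j).obj n a b, p = p'.map (m j).obj := by
  refine (h.chain p).imp id ?_
  rintro ⟨j', a', b', p', ha, hb, hp⟩
  have h1 := h.inj ha
  have h2 := h.inj hb
  obtain rfl : j' = j := congrArg Sigma.fst h1
  obtain rfl : a' = a := eq_of_heq (Sigma.mk.inj h1).2
  obtain rfl : b' = b := eq_of_heq (Sigma.mk.inj h2).2
  exact ⟨p', Chain.ext_pt hp⟩

end EGraph.IsSum

/-! ### Coproducts of categories over an operad. -/

namespace OpCat

variable {V : Type u} [Category.{v} V] [HasFiniteProducts V] {A : NSOperad V}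

variable [DistribCoprod V]

/-- A disjoint union of `A`-categories is a coproduct. -/
lemma isCoprod_of_isSum {J : Type v} {X : J → OpCat A} {P : OpCat A} (m : ∀ j, X j ⟶ P)
    (h : EGraph.IsSum fun j => Hom.graph (m j)) : IsCoprod m := by
  intro W f
  obtain ⟨u, hu, hu'⟩ := h.isCoprod fun j => Hom.graph (f j)
  have hc : ∀ j {n : ℕ} {a b : (X j).obj} (p : Chain (X j).obj n a b) {Z : V} (x : Z ⟶ A.obj n)
      (g : ∀ i, Z ⟶ (X j).hom (p.src i) (p.tgt i)),
      (X j).op p x g ≫ (Hom.graph (m j) ≫ u : EGraph.Hom _ _).hom a b =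
        W.op (p.map (Hom.graph (m j) ≫ u : EGraph.Hom _ _).obj) x
          (fun i => g i ≫ (Hom.graph (m j) ≫ u : EGraph.Hom _ _).hom (p.src i) (p.tgt i)) :=
    fun j => by
      rw [show (Hom.graph (m j) ≫ u : EGraph.Hom _ _) = Hom.graph (f j) from hu j]
      exact (f j).comm
  refine ⟨⟨u, fun {n a b} p Z x g => ?_⟩, fun j => hom_ext (hu j), fun v hv =>
    hom_ext (hu' _ fun j => congrArg Hom.graph (hv j))⟩
  -- If a step of the chain has an initial hom, then `Z` maps to an initial object and is itself
  -- initial by strictness, so nothing is left to check. Otherwise everything happens in one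
  -- summand.
  rcases h.chain p with ⟨l, ⟨hl⟩⟩ | ⟨j, a, b, p', rfl, rfl, hp⟩
  · obtain ⟨hZ⟩ := DistribCoprod.strict hl (g l)
    exact hZ.hom_ext _ _
  · obtain rfl : p = p'.map (Hom.graph (m j)).obj := Chain.ext_pt hp
    have := h.iso j
    obtain ⟨g', rfl⟩ := exists_comp_eq
      (fun l => (Hom.graph (m j)).hom (p'.src l) (p'.tgt l)) g
    rw [← (m j).comm p' x g', Category.assoc]
    refine (hc j p' x g').trans (congrArg (W.op _ x) (funext fun i => ?_))
    exact (Category.assoc _ _ _).symm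

/-- The action on a disjoint union is transported from the summands along chains that stay in one
summand. Along any other chain the generalized elements have initial source, so the action exists
uniquely and its axioms are void. -/
lemma exists_isSum {J : Type v} (X : J → OpCat A) {P : EGraph V}
    (m : ∀ j, (X j).toEGraph ⟶ P) (h : EGraph.IsSum m) :
    ∃ (Q : OpCat A) (μ : ∀ j, X j ⟶ Q), EGraph.IsSum fun j => Hom.graph (μ j) := by
  have iso := h.iso
  -- Unique existence defines the action by its values on chains in the summands, whichever way such
  -- a chain is presented.
  have key : ∀ {n : ℕ} {a b : P.obj} (p : Chain P.obj n a b) {Z : V} (x : Z ⟶ A.obj n)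
      (f : ∀ l, Z ⟶ P.hom (p.src l) (p.tgt l)), ∃! u : Z ⟶ P.hom a b,
      ∀ j a' b' (p' : Chain (X j).obj n a' b') (ha : (m j).obj a' = a) (hb : (m j).obj b' = b)
        (hp : ∀ i, (m j).obj (p'.pt i) = p.pt i)
        (f' : ∀ l, Z ⟶ (X j).hom (p'.src l) (p'.tgt l)),
        (∀ l, f l = f' l ≫ (m j).hom _ _ ≫ eqToHom (congrArg₂ P.hom (hp _) (hp _))) →
        u = (X j).op p' x f' ≫ (m j).hom a' b' ≫ eqToHom (congrArg₂ P.hom ha hb) := by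
    intro n a b p Z x f
    rcases h.chain p with ⟨l, ⟨hl⟩⟩ | ⟨j, a, b, p', rfl, rfl, hp⟩
    · obtain ⟨hZ⟩ := DistribCoprod.strict hl (f l)
      exact ⟨hZ.to _, fun _ _ _ _ _ _ _ _ _ => hZ.hom_ext _ _, fun u _ => hZ.hom_ext _ _⟩
    · obtain rfl : p = p'.map (m j).obj := Chain.ext_pt hp
      obtain ⟨f', rfl⟩ := exists_comp_eq (fun l => (m j).hom (p'.src l) (p'.tgt l)) f
      refine ⟨(X j).op p' x f' ≫ (m j).hom a b, fun j' a' b' q ha hb hq g hg => ?_, fun u hu => ?_⟩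
      · have h1 := h.inj ha
        have h2 := h.inj hb
        obtain rfl : j' = j := congrArg Sigma.fst h1
        obtain rfl : a' = a := eq_of_heq (Sigma.mk.inj h1).2
        obtain rfl : b' = b := eq_of_heq (Sigma.mk.inj h2).2
        obtain rfl : q = p' := Chain.ext_pt fun i => h.inj_obj (hq i)
        obtain rfl : f' = g := funext fun l => by
          have := hg l
          rw [eqToHom_refl, Category.comp_id] at this
          exact (cancel_mono _).1 this
        simp
      · have := hu j a b p' rfl rfl (fun i => rfl) f' fun l => by simp
        simpa using this
  choose op hop hop' using @key
  have op_map : ∀ {j : J} {n : ℕ} {a b : (X j).obj} (p : Chain (X j).obj n a b) {Z : V}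
      (x : Z ⟶ A.obj n) (f : ∀ l, Z ⟶ (X j).hom (p.src l) (p.tgt l)),
      op (p.map (m j).obj) x (fun l => f l ≫ (m j).hom _ _) = (X j).op p x f ≫ (m j).hom a b :=
    fun {j n a b} p Z x f => by
      have := hop (p.map (m j).obj) x (fun l => f l ≫ (m j).hom _ _) j a b p rfl rfl
        (fun i => rfl) f fun l => by simp
      simpa using this
  let Q : OpCat A := ofOp P op
    (fun {n a b} p Z Z' w x f => by
      rcases h.chain p with ⟨l, ⟨hl⟩⟩ | ⟨j, a, b, p', rfl, rfl, hp⟩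
      · obtain ⟨hZ⟩ := DistribCoprod.strict hl (w ≫ f l)
        exact hZ.hom_ext _ _
      · obtain rfl : p = p'.map (m j).obj := Chain.ext_pt hp
        obtain ⟨f', rfl⟩ := exists_comp_eq (fun l => (m j).hom (p'.src l) (p'.tgt l)) f
        have e : (fun i => w ≫ f' i ≫ (m j).hom (p'.src i) (p'.tgt i)) =
            fun i => (w ≫ f' i) ≫ (m j).hom (p'.src i) (p'.tgt i) := by simp
        rw [e, op_map, op_map, ← Category.assoc, comp_op])
    (fun {a b} p Z f => by
      rcases h.chain p with ⟨l, ⟨hl⟩⟩ | ⟨j, a, b, p', rfl, rfl, hp⟩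
      · obtain ⟨hZ⟩ := DistribCoprod.strict hl (f l)
        exact hZ.hom_ext _ _
      · obtain rfl : p = p'.map (m j).obj := Chain.ext_pt hp
        obtain ⟨f', rfl⟩ := exists_comp_eq (fun l => (m j).hom (p'.src l) (p'.tgt l)) f
        rw [op_map, op_one, Category.assoc, Category.assoc]
        exact congrArg (f' 0 ≫ ·) (EGraph.eqToHom_hom (m j) p'.first p'.last))
    (fun {k n a b} p q r hr Z x y f g hg => by
      -- As soon as one element lies in an initial hom, `Z` is initial and both sides agree. This
      -- disposes of every chain that leaves a summand.
      have initial_of : ∀ {a b : P.obj}, Nonempty (IsInitial (P.hom a b)) → (Z ⟶ P.hom a b) →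
          op r (prod.lift x (Pi.lift y) ≫ A.comp n) g = op p x fun i => op (q i) (y i) (f i) := by
        rintro a b ⟨hI⟩ t
        obtain ⟨hZ⟩ := DistribCoprod.strict hI t
        exact hZ.hom_ext _ _
      rcases h.chain p with ⟨l, hl⟩ | ⟨j, a, b, p', rfl, rfl, hp⟩
      · exact initial_of hl (op (q l) (y l) (f l))
      obtain rfl : p = p'.map (m j).obj := Chain.ext_pt hp
      by_cases hq : ∃ i l, Nonempty (IsInitial (P.hom ((q i).src l) ((q i).tgt l)))
      · obtain ⟨i, l, hl⟩ := hq
        exact initial_of hl (f i l)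
      have hq' : ∀ i, ∃ q' : Chain (X j).obj (n i) (p'.src i) (p'.tgt i),
          q i = q'.map (m j).obj := fun i =>
        (h.chain_of_ends (q i)).resolve_left fun hl => hq ⟨i, hl⟩
      choose q' hq' using hq'
      obtain rfl : q = fun i => (q' i).map (m j).obj := funext hq'
      rcases h.chain_of_ends r with ⟨l, hl⟩ | ⟨r', rfl⟩
      · exact initial_of hl (g l)
      have hr' : p'.IsConcat q' r' :=
        ⟨fun i l => h.inj_obj (hr.src i l), fun i l => h.inj_obj (hr.tgt i l)⟩
      choose f' hf' using fun i =>
        exists_comp_eq (fun l => (m j).hom ((q' i).src l) ((q' i).tgt l)) (f i)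
      obtain rfl : f = fun i l => f' i l ≫ (m j).hom _ _ := funext hf'
      obtain ⟨g', rfl⟩ := exists_comp_eq (fun l => (m j).hom (r'.src l) (r'.tgt l)) g
      have hg' : ∀ i l, g' (finSigmaFinEquiv ⟨i, l⟩) = f' i l ≫
          eqToHom (congrArg₂ (X j).hom (hr'.src i l).symm (hr'.tgt i l).symm) := fun i l => by
        rw [← cancel_mono ((m j).hom _ _), Category.assoc, EGraph.eqToHom_hom (m j)
          (hr'.src i l).symm (hr'.tgt i l).symm]
        simpa using hg i l
      rw [op_map, op_comp (X j) p' q' r' hr' x y f' g' hg', ← op_map]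
      exact congrArg (op _ x) (funext fun i => (op_map _ _ _).symm))
  refine ⟨Q, fun j => ⟨m j, fun p Z x f => ?_⟩, h⟩
  exact ((ofOp_op P op _ _ _ _ _ _).trans (op_map p x f)).symm

variable [HasInitial V]

instance : HasCoproducts.{v} (OpCat A) := hasCoproducts_of_isCoprod fun X => by
  obtain ⟨Q, μ, h⟩ := exists_isSum X _ (EGraph.isSum_sumι fun j => (X j).toEGraph)
  exact ⟨Q, μ, isCoprod_of_isSum μ h⟩

/-- Coproducts are disjoint unions, and these survive the application of `F` to homs because `F`
preserves initial objects. -/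
lemma preservesCoprods {W : Type u'} [Category.{v} W] {F : V ⥤ W} (hF : PreservesCoprods F) :
    PreservesCoprods (forget A ⋙ EGraph.map F) :=
  preservesCoprods_of_exists fun X => by
    obtain ⟨Q, μ, h⟩ := exists_isSum X _ (EGraph.isSum_sumι fun j => (X j).toEGraph)
    exact ⟨Q, μ, isCoprod_of_isSum μ h, (h.map F hF.initial).isCoprod⟩

end OpCat

/-! ### Concatenation of chains -/

namespace TopInterval

variable {k : ℕ} (m : Fin k → ℕ)

lemma before_succ (i : Fin k) : before m (i + 1) i.2 = before m i i.2.le + m i := by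
  rw [before, Fin.sum_univ_castSucc]
  rfl

lemma before_mono {i j : ℕ} (h : i ≤ j) (hj : j ≤ k) : before m i (h.trans hj) ≤ before m j hj := by
  rw [before_eq, before_eq]
  refine Finset.sum_le_sum fun l _ => ?_
  split_ifs <;> omega

lemma position_lt {i i' : Fin k} (h : i' < i) (j : Fin (m i)) (j' : Fin (m i')) :
    (finSigmaFinEquiv ⟨i', j'⟩ : ℕ) < finSigmaFinEquiv ⟨i, j⟩ := by
  rw [val_position, val_position]
  have h1 := before_mono m (show (i' : ℕ) + 1 ≤ i from h) i.2.le
  have h2 := before_succ m i'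
  omega

/-- Associativity of concatenation at the level of indices: both sides count the entries that
precede a given one in blocks of blocks. -/
lemma position_position (n : Fin (∑ i, m i) → ℕ) (i : Fin k) (j : Fin (m i))
    (s : Fin (n (finSigmaFinEquiv ⟨i, j⟩))) :
    (finSigmaFinEquiv ⟨finSigmaFinEquiv ⟨i, j⟩, s⟩ : ℕ) =
      (finSigmaFinEquiv (n := fun i => ∑ j, n (finSigmaFinEquiv ⟨i, j⟩))
        ⟨i, finSigmaFinEquiv (n := fun j => n (finSigmaFinEquiv ⟨i, j⟩)) ⟨j, s⟩⟩ : ℕ) := by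
  refine (val_position _ s).trans (Eq.trans ?_ ((val_position i _).trans
    (congrArg _ (val_position (m := fun j => n (finSigmaFinEquiv ⟨i, j⟩)) j s))).symm)
  rw [← add_assoc]
  congr 1
  rw [before_eq, before_eq, before_eq, ← Equiv.sum_comp finSigmaFinEquiv, Fintype.sum_sigma]
  have : ∀ z : ℕ, z = ∑ i', if i' = i then z else 0 := fun z => by simp
  rw [this (∑ j' : Fin (m i), if (j' : ℕ) < j then n (finSigmaFinEquiv ⟨i, j'⟩) else 0), ← Finset.sum_add_distrib]
  -- Sorted by outer block: all of a block before `i` counts, only the part before `j` of block `i`,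
  -- and nothing of a later block.
  refine Finset.sum_congr rfl fun i' _ => ?_
  rcases lt_trichotomy i' i with h | rfl | h
  · rw [if_pos (Fin.lt_def.1 h), if_neg h.ne, add_zero]
    exact Finset.sum_congr rfl fun j' _ => if_pos (position_lt m h j j')
  · rw [if_neg (lt_irrefl _), if_pos rfl, zero_add]
    refine Finset.sum_congr rfl fun j' _ => ?_
    rw [val_position, val_position]
    simp
  · rw [if_neg (not_lt.2 (Fin.le_def.1 h.le)), if_neg h.ne', add_zero]
    exact Finset.sum_eq_zero fun j' _ => if_neg (not_lt.2 (position_lt m h j' j).le)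

end TopInterval

namespace Chain

open TopInterval

variable {α : Type v}

lemma ext_tgt {n : ℕ} {a b : α} {p q : Chain α n a b} (h : ∀ i, p.tgt i = q.tgt i) : p = q :=
  ext_pt fun i => by
    induction i using Fin.cases with
    | zero => rw [p.first, q.first]
    | succ i => exact h i

/-- The blocks are glued one at a time to a sequence indexed by `ℕ`, so that the index type does not
change during the induction. Consecutive blocks match because both use the points of `p`; this
includes blocks of length zero. -/
lemma exists_isConcat {k : ℕ} {m : Fin k → ℕ} {a b : α} (p : Chain α k a b)
    (q : ∀ i, Chain α (m i) (p.src i) (p.tgt i)) :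
    ∃ r : Chain α (∑ i, m i) a b, p.IsConcat q r := by
  have key : ∀ N (hN : N ≤ k), ∃ P : ℕ → α, P 0 = a ∧ P (before m N hN) = p.pt ⟨N, by omega⟩ ∧
      ∀ i : Fin k, i < N → ∀ j : Fin (m i + 1), P (before m i i.2.le + j) = (q i).pt j := by
    intro N
    induction N with
    | zero => exact fun _ => ⟨fun _ => a, rfl, p.first.symm, fun i hi => absurd hi (by omega)⟩
    | succ N ih =>
      intro hN
      obtain ⟨P, h0, h1, h2⟩ := ih (by omega)
      let i₀ : Fin k := ⟨N, hN⟩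
      have e1 : (q i₀).pt 0 = P (before m N (by omega)) := (q i₀).first.trans h1.symm
      have e2 : (q i₀).pt (Fin.last _) = p.pt ⟨N + 1, by omega⟩ := (q i₀).last
      have e3 : before m (N + 1) hN = before m N (by omega) + m i₀ := before_succ m i₀
      -- The minimum only keeps the index in range; the values after the new block are irrelevant.
      let P' : ℕ → α := fun t => if h : t ≤ before m N (by omega) then P t else
        (q i₀).pt ⟨min (t - before m N (by omega)) (m i₀), by omega⟩
      have e4 : ∀ j : Fin (m i₀ + 1), P' (before m N (by omega) + j) = (q i₀).pt j := fun j => by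
        by_cases hj : (j : ℕ) = 0
        · obtain rfl : j = 0 := Fin.ext hj
          rw [e1]
          exact dif_pos (by simp)
        · refine (dif_neg (by omega)).trans (congrArg _ (Fin.ext ?_))
          dsimp only
          omega
      refine ⟨P', (dif_pos (Nat.zero_le _)).trans h0, ?_, fun i hi j => ?_⟩
      · rw [e3]
        exact (e4 (Fin.last _)).trans e2
      · by_cases h : (i : ℕ) = N
        · obtain rfl : i = i₀ := Fin.ext h
          exact e4 j
        · rw [← h2 i (by omega) j]
          refine dif_pos ?_
          have h3 := before_mono m (show (i : ℕ) + 1 ≤ N by omega) (by omega)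
          have h4 := before_succ m i
          omega
  obtain ⟨P, h0, h1, h2⟩ := key k le_rfl
  refine ⟨⟨fun t => P t, h0, h1.trans p.last⟩, fun i j => ?_, fun i j => ?_⟩
  · exact (congrArg P (val_position i j)).trans (h2 i i.2 j.castSucc)
  · refine (congrArg P ?_).trans (h2 i i.2 j.succ)
    rw [Fin.val_succ, Fin.val_succ, val_position, add_assoc]

/-- The concatenation of the chains `q i`. -/
noncomputable def concat {k : ℕ} {m : Fin k → ℕ} {a b : α} (p : Chain α k a b)
    (q : ∀ i, Chain α (m i) (p.src i) (p.tgt i)) : Chain α (∑ i, m i) a b :=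
  (exists_isConcat p q).choose

lemma isConcat_concat {k : ℕ} {m : Fin k → ℕ} {a b : α} (p : Chain α k a b)
    (q : ∀ i, Chain α (m i) (p.src i) (p.tgt i)) : p.IsConcat q (p.concat q) :=
  (exists_isConcat p q).choose_spec

/-- The same sequence with other names for its ends. -/
abbrev copy {n : ℕ} {a b a' b' : α} (p : Chain α n a b) (ha : a = a') (hb : b = b') :
    Chain α n a' b' := ⟨p.pt, p.first.trans ha, p.last.trans hb⟩

/-- The chain with a single step. -/
def single (a b : α) : Chain α 1 a b := ⟨![a, b], rfl, rfl⟩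

lemma src_one {a b : α} (p : Chain α 1 a b) (i : Fin 1) : p.src i = a := by
  obtain rfl : i = 0 := Subsingleton.elim _ _
  exact p.first

lemma tgt_one {a b : α} (p : Chain α 1 a b) (i : Fin 1) : p.tgt i = b := by
  obtain rfl : i = 0 := Subsingleton.elim _ _
  exact p.last

end Chain

/-! ### Free categories over an operad -/

section

variable {V : Type u} [Category.{v} V]

/-- To compare two natural families of maps out of generalized elements of `X` and of coproducts
`S l`, it is enough to consider elements of the summands. -/
lemma DistribCoprod.local_ext [HasFiniteProducts V] [DistribCoprod V] {n : ℕ} {X : V}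
    {I : Fin n → Type v} {Y : ∀ l, I l → V} {S : Fin n → V} {m : ∀ l i, Y l i ⟶ S l}
    (hm : ∀ l, IsCoprod (m l)) {W : V}
    (u w : ∀ {Z : V}, (Z ⟶ X) → (∀ l, Z ⟶ S l) → (Z ⟶ W))
    (hu : ∀ {Z Z' : V} (t : Z' ⟶ Z) (x : Z ⟶ X) (f : ∀ l, Z ⟶ S l),
      t ≫ u x f = u (t ≫ x) fun l => t ≫ f l)
    (hw : ∀ {Z Z' : V} (t : Z' ⟶ Z) (x : Z ⟶ X) (f : ∀ l, Z ⟶ S l),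
      t ≫ w x f = w (t ≫ x) fun l => t ≫ f l)
    (h : ∀ {Z : V} (x : Z ⟶ X) (j : ∀ l, I l) (f : ∀ l, Z ⟶ Y l (j l)),
      u x (fun l => f l ≫ m l (j l)) = w x fun l => f l ≫ m l (j l))
    {Z : V} (x : Z ⟶ X) (f : ∀ l, Z ⟶ S l) : u x f = w x f := by
  have e : ∀ j : (∀ l, I l), prod.map (𝟙 X) (Limits.Pi.map fun l => m l (j l)) ≫
      prod.snd = prod.snd ≫ Limits.Pi.map fun l => m l (j l) := fun j => prod.map_snd _ _
  -- By naturality it is enough to compare both families on the universal element, given by the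
  -- projections of `X ⨯ ∏ᶜ S`. By distributivity its source is a coproduct over choices of
  -- summands.
  have key : u (prod.fst : X ⨯ ∏ᶜ S ⟶ X) (fun l => prod.snd ≫ Pi.π S l) =
      w prod.fst fun l => prod.snd ≫ Pi.π S l := by
    refine (DistribCoprod.isCoprod X m hm).hom_ext fun j => ?_
    rw [hu, hw, prod.map_fst, Category.comp_id]
    have e' : ∀ l, prod.map (𝟙 X) (Limits.Pi.map fun l => m l (j l)) ≫ prod.snd ≫ Pi.π S l =
        (prod.snd ≫ Pi.π (fun l => Y l (j l)) l) ≫ m l (j l) := fun l => by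
      rw [← Category.assoc, e, Category.assoc, Pi.map_π, Category.assoc]
    rw [funext e']
    exact h _ j _
  have e1 : prod.lift x (Pi.lift f) ≫ prod.fst = x := prod.lift_fst _ _
  have e2 : (fun l => prod.lift x (Pi.lift f) ≫ prod.snd ≫ Pi.π S l) = f :=
    funext fun l => OpCat.lift_elem x f l
  have := congrArg (fun t => prod.lift x (Pi.lift f) ≫ t) key
  rwa [hu, hw, e1, e2] at this

end

namespace EGraph

variable {V : Type u} [Category.{v} V]

/-- A generalized element of a hom of an enriched graph, together with its ends. -/
abbrev arrow (Y : EGraph V) {Z : V} {a b : Y.obj} (f : Z ⟶ Y.hom a b) :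
    Σ a b, (Z ⟶ Y.hom a b) := ⟨a, b, f⟩

/-- Transports disappear once an element carries its ends, so letters of words along different
chains can be compared. -/
lemma arrow_comp_eqToHom (Y : EGraph V) {Z : V} {a b a' b' : Y.obj} (f : Z ⟶ Y.hom a b)
    (ha : a = a') (hb : b = b') : Y.arrow (f ≫ eqToHom (congrArg₂ Y.hom ha hb)) = Y.arrow f := by
  subst ha hb
  simp

end EGraph

namespace FreeOpCat

section

variable {V : Type u} [Category.{v} V] [HasFiniteProducts V]

lemma comp_lift {Z Z' X : V} {n : ℕ} {T : Fin n → V} (w : Z' ⟶ Z) (x : Z ⟶ X)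
    (f : ∀ i, Z ⟶ T i) :
    w ≫ prod.lift x (Pi.lift f) = prod.lift (w ≫ x) (Pi.lift fun i => w ≫ f i) := by
  ext <;> simp [prod.lift_fst, prod.lift_snd]

lemma lift_eta {Z X : V} {n : ℕ} {T : Fin n → V} (w : Z ⟶ X ⨯ ∏ᶜ T) :
    prod.lift (w ≫ prod.fst) (Pi.lift fun i => w ≫ prod.snd ≫ Pi.π T i) = w := by
  ext <;> simp [prod.lift_fst, prod.lift_snd]

end

variable {V : Type u} [Category.{v} V] [HasFiniteProducts V] [HasCoproducts.{v} V]
  {B : NSOperad V} {Y : EGraph V}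

/-- The object of composable sequences along a chain, labelled by an operation. -/
noncomputable abbrev word (B : NSOperad V) (Y : EGraph V) {k : ℕ} {a b : Y.obj}
    (p : Chain Y.obj k a b) : V := B.obj k ⨯ ∏ᶜ fun i => Y.hom (p.src i) (p.tgt i)

variable (B Y) in
/-- The homs of the free category over `B` on an enriched graph. -/
noncomputable def graph : EGraph V :=
  ⟨Y.obj, fun a b => ∐ fun s : (Σ k, Chain Y.obj k a b) => word B Y s.2⟩

/-- The inclusion of the words along a chain. -/
noncomputable def ι {k : ℕ} {a b : Y.obj} (p : Chain Y.obj k a b) :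
    word B Y p ⟶ (graph B Y).hom a b :=
  Sigma.ι (fun s : (Σ k, Chain Y.obj k a b) => word B Y s.2) ⟨k, p⟩

lemma isCoprod_ι (a b : Y.obj) :
    IsCoprod fun s : (Σ k, Chain Y.obj k a b) => (ι s.2 : word B Y s.2 ⟶ _) :=
  isCoprod_sigma _

/-- The generalized element of a hom of the free category given by a word. -/
noncomputable def elem {k : ℕ} {a b : Y.obj} (p : Chain Y.obj k a b) {Z : V} (x : Z ⟶ B.obj k)
    (f : ∀ i, Z ⟶ Y.hom (p.src i) (p.tgt i)) : Z ⟶ (graph B Y).hom a b :=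
  prod.lift x (Pi.lift f) ≫ ι p

lemma comp_elem {k : ℕ} {a b : Y.obj} (p : Chain Y.obj k a b) {Z Z' : V} (w : Z' ⟶ Z)
    (x : Z ⟶ B.obj k) (f : ∀ i, Z ⟶ Y.hom (p.src i) (p.tgt i)) :
    w ≫ elem p x f = elem p (w ≫ x) fun i => w ≫ f i := by
  rw [elem, ← Category.assoc, comp_lift, elem]

lemma elem_eta {k : ℕ} {a b : Y.obj} (p : Chain Y.obj k a b) {Z : V} (w : Z ⟶ word B Y p) :
    w ≫ ι p = elem p (w ≫ prod.fst) fun i => w ≫ prod.snd ≫ Pi.π _ i := by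
  rw [elem, lift_eta]

/-- The letters carry their ends, so they determine the chain, and no equality of chains is needed
as a hypothesis. The lengths may be equal only propositionally, so letters are matched by position.
-/
lemma elem_congr {k k' : ℕ} {a b : Y.obj} {p : Chain Y.obj k a b} {p' : Chain Y.obj k' a b}
    {Z : V} {x : Z ⟶ B.obj k} {x' : Z ⟶ B.obj k'} {f : ∀ i, Z ⟶ Y.hom (p.src i) (p.tgt i)}
    {f' : ∀ i, Z ⟶ Y.hom (p'.src i) (p'.tgt i)} (hk : k = k')
    (hx : x ≫ eqToHom (congrArg B.obj hk) = x')
    (hf : ∀ (i : Fin k) (i' : Fin k'), (i : ℕ) = i' → Y.arrow (f i) = Y.arrow (f' i')) :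
    elem p x f = elem p' x' f' := by
  subst hk
  obtain rfl : p = p' := Chain.ext_tgt fun i =>
    congrArg (fun s : Σ a b, (Z ⟶ Y.hom a b) => s.2.1) (hf i i rfl)
  obtain rfl : f = f' := funext fun i =>
    eq_of_heq (Sigma.mk.inj (eq_of_heq (Sigma.mk.inj (hf i i rfl)).2)).2
  obtain rfl : x = x' := by simpa using hx
  rfl

lemma elem_comp_eqToHom {k : ℕ} {a b a' b' : Y.obj} (p : Chain Y.obj k a b) {Z : V}
    (x : Z ⟶ B.obj k) (f : ∀ i, Z ⟶ Y.hom (p.src i) (p.tgt i)) (ha : a = a') (hb : b = b') :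
    elem p x f ≫ eqToHom (congrArg₂ (graph B Y).hom ha hb) = elem (p.copy ha hb) x f := by
  subst ha hb
  simp

section concat

variable {k : ℕ} {m : Fin k → ℕ} {a b : Y.obj} {p : Chain Y.obj k a b}
    {q : ∀ i, Chain Y.obj (m i) (p.src i) (p.tgt i)} {Z : V}

lemma exists_concatElem (f : ∀ i j, Z ⟶ Y.hom ((q i).src j) ((q i).tgt j)) :
    ∃ g : ∀ l, Z ⟶ Y.hom ((p.concat q).src l) ((p.concat q).tgt l),
      ∀ i j, g (finSigmaFinEquiv ⟨i, j⟩) = f i j ≫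
        eqToHom (congrArg₂ Y.hom ((p.isConcat_concat q).src i j).symm
          ((p.isConcat_concat q).tgt i j).symm) :=
  exists_concat (B := fun l => Y.hom ((p.concat q).src l) ((p.concat q).tgt l))
    (fun i j => congrArg₂ Y.hom ((p.isConcat_concat q).src i j).symm
      ((p.isConcat_concat q).tgt i j).symm) f

/-- The concatenation of families of elements. -/
noncomputable def concatElem (f : ∀ i j, Z ⟶ Y.hom ((q i).src j) ((q i).tgt j)) :
    ∀ l, Z ⟶ Y.hom ((p.concat q).src l) ((p.concat q).tgt l) := (exists_concatElem f).choose

lemma concatElem_apply (f : ∀ i j, Z ⟶ Y.hom ((q i).src j) ((q i).tgt j)) (i j) :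
    concatElem f (finSigmaFinEquiv ⟨i, j⟩) = f i j ≫
      eqToHom (congrArg₂ Y.hom ((p.isConcat_concat q).src i j).symm
        ((p.isConcat_concat q).tgt i j).symm) := (exists_concatElem f).choose_spec i j

lemma arrow_concatElem (f : ∀ i j, Z ⟶ Y.hom ((q i).src j) ((q i).tgt j)) (i j) :
    Y.arrow (concatElem f (finSigmaFinEquiv ⟨i, j⟩)) = Y.arrow (f i j) := by
  rw [concatElem_apply]
  exact Y.arrow_comp_eqToHom _ ((p.isConcat_concat q).src i j).symm
    ((p.isConcat_concat q).tgt i j).symm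

lemma comp_concatElem {Z' : V} (w : Z' ⟶ Z) (f : ∀ i j, Z ⟶ Y.hom ((q i).src j) ((q i).tgt j)) :
    (fun l => w ≫ concatElem f l) = concatElem fun i j => w ≫ f i j := by
  funext l
  obtain ⟨⟨i, j⟩, rfl⟩ := finSigmaFinEquiv.surjective l
  rw [concatElem_apply, concatElem_apply, Category.assoc]

end concat

variable [DistribCoprod V]

/-- Distributivity, in the form that allows the action on the free category to be defined on
sequences of words. -/
lemma isCoprod_words {k : ℕ} {a b : Y.obj} (p : Chain Y.obj k a b) :
    IsCoprod fun j : (∀ l, Σ n, Chain Y.obj n (p.src l) (p.tgt l)) =>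
      prod.map (𝟙 (B.obj k)) (Limits.Pi.map fun l =>
        (ι (j l).2 : word B Y (j l).2 ⟶ (graph B Y).hom (p.src l) (p.tgt l))) :=
  DistribCoprod.isCoprod (I := fun l => Σ n, Chain Y.obj n (p.src l) (p.tgt l))
    (Y := fun l s => word B Y s.2) (S := fun l => (graph B Y).hom (p.src l) (p.tgt l))
    (B.obj k) (fun l s => ι s.2) fun l => isCoprod_ι (p.src l) (p.tgt l)

/-- The action of an operation on a sequence of words. -/
noncomputable def actWord {k : ℕ} {m : Fin k → ℕ} {a b : Y.obj} (p : Chain Y.obj k a b)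
    (q : ∀ i, Chain Y.obj (m i) (p.src i) (p.tgt i)) :
    B.obj k ⨯ (∏ᶜ fun i => word B Y (q i)) ⟶ (graph B Y).hom a b :=
  elem (p.concat q)
    (prod.lift prod.fst
      (Pi.lift fun i => prod.snd ≫ Pi.π (fun i => word B Y (q i)) i ≫ prod.fst) ≫ B.comp m)
    (concatElem fun i j => prod.snd ≫ Pi.π (fun i => word B Y (q i)) i ≫ prod.snd ≫
      Pi.π (fun j => Y.hom ((q i).src j) ((q i).tgt j)) j)

lemma lift_actWord {k : ℕ} {m : Fin k → ℕ} {a b : Y.obj} (p : Chain Y.obj k a b)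
    (q : ∀ i, Chain Y.obj (m i) (p.src i) (p.tgt i)) {Z : V} (x : Z ⟶ B.obj k)
    (y : ∀ i, Z ⟶ B.obj (m i)) (f : ∀ i j, Z ⟶ Y.hom ((q i).src j) ((q i).tgt j)) :
    prod.lift x (Pi.lift fun i => prod.lift (y i) (Pi.lift (f i))) ≫ actWord p q =
      elem (p.concat q) (prod.lift x (Pi.lift y) ≫ B.comp m) (concatElem f) := by
  have e1 : ∀ i, prod.lift x (Pi.lift fun i => prod.lift (y i) (Pi.lift (f i))) ≫ prod.snd ≫
      Pi.π (fun i => word B Y (q i)) i ≫ prod.fst = y i := fun i => by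
    rw [prod.lift_snd_assoc, Pi.lift_π_assoc, prod.lift_fst]
  have e2 : ∀ i j, prod.lift x (Pi.lift fun i => prod.lift (y i) (Pi.lift (f i))) ≫ prod.snd ≫
      Pi.π (fun i => word B Y (q i)) i ≫ prod.snd ≫
      Pi.π (fun j => Y.hom ((q i).src j) ((q i).tgt j)) j = f i j := fun i j => by
    rw [prod.lift_snd_assoc, Pi.lift_π_assoc, prod.lift_snd_assoc, Pi.lift_π]
  rw [actWord, comp_elem, ← Category.assoc, comp_lift, prod.lift_fst, comp_concatElem]
  simp only [e1, e2]

/-- The action of the operad on the free category. -/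
noncomputable def act {k : ℕ} {a b : Y.obj} (p : Chain Y.obj k a b) :
    B.obj k ⨯ (∏ᶜ fun i => (graph B Y).hom (p.src i) (p.tgt i)) ⟶ (graph B Y).hom a b :=
  (isCoprod_words p).desc fun j => actWord p fun i => (j i).2

lemma map_act {k : ℕ} {m : Fin k → ℕ} {a b : Y.obj} (p : Chain Y.obj k a b)
    (q : ∀ i, Chain Y.obj (m i) (p.src i) (p.tgt i)) :
    prod.map (𝟙 (B.obj k)) (Limits.Pi.map fun i =>
      (ι (q i) : word B Y (q i) ⟶ (graph B Y).hom (p.src i) (p.tgt i))) ≫ act p = actWord p q :=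
  (isCoprod_words p).fac (fun j => actWord p fun i => (j i).2) fun i => ⟨m i, q i⟩

noncomputable def op {k : ℕ} {a b : Y.obj} (p : Chain Y.obj k a b) {Z : V} (x : Z ⟶ B.obj k)
    (f : ∀ i, Z ⟶ (graph B Y).hom (p.src i) (p.tgt i)) : Z ⟶ (graph B Y).hom a b :=
  prod.lift x (Pi.lift f) ≫ act p

lemma comp_op {k : ℕ} {a b : Y.obj} (p : Chain Y.obj k a b) {Z Z' : V} (w : Z' ⟶ Z)
    (x : Z ⟶ B.obj k) (f : ∀ i, Z ⟶ (graph B Y).hom (p.src i) (p.tgt i)) :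
    w ≫ op p x f = op p (w ≫ x) fun i => w ≫ f i := by
  rw [op, ← Category.assoc, comp_lift, op]

/-- The rule for computing in the free category: labels are composed in the operad and words are
concatenated. -/
lemma op_elem {k : ℕ} {m : Fin k → ℕ} {a b : Y.obj} (p : Chain Y.obj k a b)
    (q : ∀ i, Chain Y.obj (m i) (p.src i) (p.tgt i)) {Z : V} (x : Z ⟶ B.obj k)
    (y : ∀ i, Z ⟶ B.obj (m i)) (f : ∀ i j, Z ⟶ Y.hom ((q i).src j) ((q i).tgt j)) :
    op p x (fun i => elem (q i) (y i) (f i)) =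
      elem (p.concat q) (prod.lift x (Pi.lift y) ≫ B.comp m) (concatElem f) := by
  rw [← lift_actWord, ← map_act, ← Category.assoc, op]
  congr 1
  ext
  · simp [prod.lift_fst]
  · simp [prod.lift_snd_assoc, elem]

/-- Two natural families of maps out of words of elements of the free category agree if they
agree on words of words. -/
lemma local_ext {n : ℕ} {X : V} {s t : Fin n → Y.obj} {W : V}
    (u w : ∀ {Z : V}, (Z ⟶ X) → (∀ l, Z ⟶ (graph B Y).hom (s l) (t l)) → (Z ⟶ W))
    (hu : ∀ {Z Z' : V} (r : Z' ⟶ Z) (x : Z ⟶ X) (f : ∀ l, Z ⟶ (graph B Y).hom (s l) (t l)),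
      r ≫ u x f = u (r ≫ x) fun l => r ≫ f l)
    (hw : ∀ {Z Z' : V} (r : Z' ⟶ Z) (x : Z ⟶ X) (f : ∀ l, Z ⟶ (graph B Y).hom (s l) (t l)),
      r ≫ w x f = w (r ≫ x) fun l => r ≫ f l)
    (h : ∀ {Z : V} (x : Z ⟶ X) (m : Fin n → ℕ) (q : ∀ l, Chain Y.obj (m l) (s l) (t l))
      (y : ∀ l, Z ⟶ B.obj (m l)) (f : ∀ l i, Z ⟶ Y.hom ((q l).src i) ((q l).tgt i)),
      u x (fun l => elem (q l) (y l) (f l)) = w x fun l => elem (q l) (y l) (f l))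
    {Z : V} (x : Z ⟶ X) (f : ∀ l, Z ⟶ (graph B Y).hom (s l) (t l)) : u x f = w x f :=
  DistribCoprod.local_ext (fun l => isCoprod_ι (s l) (t l)) u w hu hw (fun {Z} x j f => by
    have := h x (fun l => (j l).1) (fun l => (j l).2) (fun l => f l ≫ prod.fst)
      fun l i => f l ≫ prod.snd ≫ Pi.π _ i
    simpa only [← elem_eta] using this) x f

end FreeOpCat

/-! ### Axioms and universal property of the free category. -/

namespace FreeOpCat

variable {V : Type u} [Category.{v} V] [HasFiniteProducts V] [HasCoproducts.{v} V]
  {B : NSOperad V} {Y : EGraph V} [DistribCoprod V]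

/-- On a single word this is the left unit law for labels, and concatenating one block changes
nothing. -/
lemma op_one {a b : Y.obj} (p : Chain Y.obj 1 a b) {Z : V}
    (f : ∀ i, Z ⟶ (graph B Y).hom (p.src i) (p.tgt i)) :
    op p (terminal.from Z ≫ B.one) f = f 0 ≫ eqToHom (congrArg₂ (graph B Y).hom p.first p.last) := by
  refine local_ext (X := ⊤_ V) (s := p.src) (t := p.tgt) (fun x f => op p (x ≫ B.one) f)
    (fun x f => f 0 ≫ eqToHom (congrArg₂ (graph B Y).hom p.first p.last))
    (fun w x f => ?_) (fun w x f => (Category.assoc _ _ _).symm) (fun {Z} x m q y f => ?_) _ f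
  · rw [comp_op, Category.assoc]
  · obtain ⟨n, rfl⟩ : ∃ n, m = fun _ => n := ⟨m 0, funext fun i => congrArg m (Subsingleton.elim _ _)⟩
    obtain ⟨y, rfl⟩ : ∃ y', y = fun _ => y' :=
      ⟨y 0, funext fun i => by obtain rfl : i = 0 := Subsingleton.elim _ _; rfl⟩
    obtain rfl : x = terminal.from Z := Subsingleton.elim _ _
    refine (op_elem p q _ _ f).trans
      (Eq.trans ?_ (elem_comp_eqToHom (q 0) y (f 0) p.first p.last).symm)
    refine elem_congr (by simp) ?_ fun i i' h => ?_
    · rw [B.one_comp]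
      simp
    · have : i = finSigmaFinEquiv (m := 1) (n := fun _ => n) ⟨0, i'⟩ :=
        Fin.ext (h.trans (by simp))
      subst this
      exact arrow_concatElem f 0 i'

/-- It is enough to let the elements of the free category be words. Then the labels agree by
associativity of the operad, and the letters by `TopInterval.position_position`. -/
lemma op_comp {k : ℕ} {m : Fin k → ℕ} {a b : Y.obj} (p : Chain Y.obj k a b)
    (q : ∀ i, Chain Y.obj (m i) (p.src i) (p.tgt i)) (r : Chain Y.obj (∑ i, m i) a b)
    (h : p.IsConcat q r) {Z : V} (x : Z ⟶ B.obj k) (y : ∀ i, Z ⟶ B.obj (m i))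
    (f : ∀ i j, Z ⟶ (graph B Y).hom ((q i).src j) ((q i).tgt j))
    (g : ∀ l, Z ⟶ (graph B Y).hom (r.src l) (r.tgt l))
    (hg : ∀ i j, g (finSigmaFinEquiv ⟨i, j⟩) =
      f i j ≫ eqToHom (congrArg₂ (graph B Y).hom (h.src i j).symm (h.tgt i j).symm)) :
    op r (prod.lift x (Pi.lift y) ≫ B.comp m) g = op p x fun i => op (q i) (y i) (f i) := by
  -- `local_ext` allows a single parameter besides the words, so the operation `x` and the
  -- operations `y i` are packed into one element of a product. The `f i j` are recovered from `g`.
  have key := fun (Z : V) => local_ext (X := B.obj k ⨯ ∏ᶜ fun i => B.obj (m i)) (s := r.src)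
    (t := r.tgt) (fun x g => op r (x ≫ B.comp m) g)
    (fun x g => op p (x ≫ prod.fst) fun i => op (q i) (x ≫ prod.snd ≫ Pi.π _ i) fun j =>
      g (finSigmaFinEquiv ⟨i, j⟩) ≫
        eqToHom (congrArg₂ (graph B Y).hom (h.src i j) (h.tgt i j)))
    (fun w x f => by rw [comp_op, Category.assoc])
    (fun w x f => by simp only [comp_op, Category.assoc])
    (fun {Z} x n q' c e => ?_) (Z := Z)
  · have := key Z (prod.lift x (Pi.lift y)) g
    rw [this, prod.lift_fst]
    congr 1
    funext i
    rw [OpCat.lift_elem]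
    congr 1
    funext j
    rw [hg]
    simp
  · let q₂ : ∀ i j, Chain Y.obj (n (finSigmaFinEquiv ⟨i, j⟩)) ((q i).src j) ((q i).tgt j) :=
      fun i j => (q' (finSigmaFinEquiv ⟨i, j⟩)).copy (h.src i j) (h.tgt i j)
    have R := fun i => (congrArg (op (q i) (x ≫ prod.snd ≫ Pi.π (fun i => B.obj (m i)) i))
      (funext fun j => elem_comp_eqToHom (q' (finSigmaFinEquiv ⟨i, j⟩)) (c _) (e _)
        (h.src i j) (h.tgt i j))).trans (op_elem (q i) (q₂ i) _ (fun j => c (finSigmaFinEquiv ⟨i, j⟩))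
        fun j => e (finSigmaFinEquiv ⟨i, j⟩))
    refine (op_elem r q' (x ≫ B.comp m) c e).trans
      (Eq.trans ?_ ((congrArg (op p (x ≫ prod.fst)) (funext R)).trans (op_elem p _ _ _ _)).symm)
    refine elem_congr (sum_concat m _ n fun _ _ => rfl) ?_ fun l l' hl => ?_
    · have := B.assoc m (fun i j => n (finSigmaFinEquiv ⟨i, j⟩)) n (fun _ _ => rfl)
        (x ≫ prod.fst) (fun i => x ≫ prod.snd ≫ Pi.π (fun i => B.obj (m i)) i)
        (fun i j => c (finSigmaFinEquiv ⟨i, j⟩)) c fun _ _ => by simp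
      rw [lift_eta] at this
      rw [this]
      simp
    · obtain ⟨⟨i, t⟩, rfl⟩ := finSigmaFinEquiv.surjective l'
      obtain ⟨⟨j, s⟩, rfl⟩ := finSigmaFinEquiv.surjective t
      obtain rfl : l = finSigmaFinEquiv ⟨finSigmaFinEquiv ⟨i, j⟩, s⟩ :=
        Fin.ext (hl.trans (TopInterval.position_position m n i j s).symm)
      exact (arrow_concatElem e _ s).trans ((arrow_concatElem _ i _).trans
        (arrow_concatElem (q := q₂ i) (fun j => e (finSigmaFinEquiv ⟨i, j⟩)) j s)).symm

variable (B Y) in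
/-- The free category over an operad on an enriched graph. -/
noncomputable def free : OpCat B :=
  OpCat.ofOp (graph B Y) (fun p _ x f => op (Y := Y) p x f) (comp_op (Y := Y)) (op_one (Y := Y))
    fun p q r h _ x y f g hg => op_comp (Y := Y) p q r h x y f g hg

lemma free_op {n : ℕ} {a b : Y.obj} (p : Chain Y.obj n a b) {Z : V} (x : Z ⟶ B.obj n)
    (f : ∀ i, Z ⟶ (graph B Y).hom (p.src i) (p.tgt i)) :
    (free B Y).op (a := a) (b := b) p x f = op p x f :=
  OpCat.ofOp_op (A := B) (graph B Y) (fun p _ x f => op (Y := Y) p x f) _ _ _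
    (a := a) (b := b) p x f

variable (B Y) in
/-- The inclusion of a graph into the free category. -/
noncomputable def unit : Y ⟶ graph B Y :=
  ⟨id, fun a b => elem (Chain.single a b) (terminal.from _ ≫ B.one) fun i =>
    eqToHom (congrArg₂ Y.hom (Chain.src_one _ i).symm (Chain.tgt_one _ i).symm)⟩

lemma comp_unit {a b : Y.obj} {Z : V} (f : Z ⟶ Y.hom a b) :
    f ≫ (unit B Y).hom a b = elem (Chain.single a b) (terminal.from Z ≫ B.one) fun i =>
      f ≫ eqToHom (congrArg₂ Y.hom (Chain.src_one _ i).symm (Chain.tgt_one _ i).symm) := by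
  refine (comp_elem _ _ _ _).trans ?_
  rw [← Category.assoc, Subsingleton.elim (f ≫ terminal.from _) (terminal.from Z)]

/-- Words are composites of words of length one. -/
lemma elem_eq_op {k : ℕ} {a b : Y.obj} (p : Chain Y.obj k a b) {Z : V} (x : Z ⟶ B.obj k)
    (f : ∀ i, Z ⟶ Y.hom (p.src i) (p.tgt i)) :
    elem p x f = op p x fun i => f i ≫ (unit B Y).hom (p.src i) (p.tgt i) := by
  refine Eq.trans ?_ ((congrArg (op p x) (funext fun i => comp_unit (f i))).trans
    (op_elem p (fun i => Chain.single (p.src i) (p.tgt i)) x _ _)).symm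
  refine (elem_congr (by simp) ?_ fun i i' h => ?_).symm
  · rw [B.comp_one]
    simp
  · obtain rfl : i = finSigmaFinEquiv (n := fun _ => 1) ⟨i', 0⟩ := Fin.ext (h.trans (by simp))
    exact (arrow_concatElem _ i' 0).trans (Y.arrow_comp_eqToHom _
      (Chain.src_one (Chain.single (p.src i') (p.tgt i')) 0).symm
      (Chain.tgt_one (Chain.single (p.src i') (p.tgt i')) 0).symm)

/-- The functor out of a free category induced by a morphism of graphs. -/
noncomputable def hatHom (X : OpCat B) (g : Y ⟶ X.toEGraph) : graph B Y ⟶ X.toEGraph :=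
  ⟨g.obj, fun a b => (isCoprod_ι (B := B) (Y := Y) a b).desc fun s =>
    X.op (s.2.map g.obj) prod.fst fun i =>
      (prod.snd ≫ Pi.π (fun i => Y.hom (s.2.src i) (s.2.tgt i)) i) ≫ g.hom _ _⟩

lemma elem_hatHom (X : OpCat B) (g : Y ⟶ X.toEGraph) {k : ℕ} {a b : Y.obj}
    (p : Chain Y.obj k a b) {Z : V} (x : Z ⟶ B.obj k)
    (f : ∀ i, Z ⟶ Y.hom (p.src i) (p.tgt i)) :
    elem p x f ≫ (hatHom X g).hom a b =
      X.op (p.map g.obj) x fun i => f i ≫ g.hom (p.src i) (p.tgt i) := by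
  rw [elem, Category.assoc]
  refine (congrArg (prod.lift x (Pi.lift f) ≫ ·) ((isCoprod_ι a b).fac _ ⟨k, p⟩)).trans ?_
  refine (X.comp_op _ _ _ _).trans ?_
  rw [prod.lift_fst]
  congr 1
  funext i
  rw [← Category.assoc, OpCat.lift_elem]

/-- On words of words this is the associativity of the action on `X`. -/
lemma op_hatHom (X : OpCat B) (g : Y ⟶ X.toEGraph) {n : ℕ} {a b : Y.obj}
    (p : Chain Y.obj n a b) {Z : V} (x : Z ⟶ B.obj n)
    (f : ∀ i, Z ⟶ (graph B Y).hom (p.src i) (p.tgt i)) :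
    op p x f ≫ (hatHom X g).hom a b =
      X.op (p.map g.obj) x fun i => f i ≫ (hatHom X g).hom (p.src i) (p.tgt i) := by
  refine local_ext (s := p.src) (t := p.tgt) (fun x f => op p x f ≫ (hatHom X g).hom a b)
    (fun x f => X.op (p.map g.obj) x fun i => f i ≫ (hatHom X g).hom (p.src i) (p.tgt i))
    (fun w x f => ?_) (fun w x f => ?_) (fun {Z} x m q y f => ?_) x f
  · rw [← Category.assoc, comp_op]
  · exact (X.comp_op _ _ _ _).trans (congrArg _ (funext fun i => (Category.assoc _ _ _).symm))
  · refine (congrArg (· ≫ _) (op_elem p q x y f)).trans ((elem_hatHom X g _ _ _).trans ?_)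
    refine (X.op_comp (p.map g.obj) (fun i => (q i).map g.obj) _
      ((p.isConcat_concat q).map g.obj) x y (fun i j => f i j ≫ g.hom _ _) _ fun i j => ?_).trans
      (congrArg _ (funext fun i => (elem_hatHom X g (q i) (y i) (f i)).symm))
    rw [concatElem_apply, Category.assoc, Category.assoc]
    exact congrArg (f i j ≫ ·) (EGraph.eqToHom_hom g
      ((p.isConcat_concat q).src i j).symm ((p.isConcat_concat q).tgt i j).symm)

/-- The functor out of a free category induced by a morphism of graphs. -/
noncomputable def hat (X : OpCat B) (g : Y ⟶ X.toEGraph) : free B Y ⟶ X where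
  graph := hatHom X g
  comm {n a b} p Z x f :=
    (congrArg (· ≫ (hatHom X g).hom a b) (free_op (Y := Y) p x f)).trans
      (op_hatHom X g (a := a) (b := b) p x f)

lemma unit_hat (X : OpCat B) (g : Y ⟶ X.toEGraph) : unit B Y ≫ hatHom X g = g := by
  refine EGraph.hom_ext (fun _ => rfl) fun a b => ?_
  have := elem_hatHom X g (Chain.single a b) (terminal.from _ ≫ B.one) fun i =>
    eqToHom (congrArg₂ Y.hom (Chain.src_one _ i).symm (Chain.tgt_one _ i).symm)
  refine (Category.comp_id _).trans (this.trans ((X.op_one _ _).trans ?_))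
  exact (Category.comp_id _).trans (Category.id_comp _)

/-- A word is the composite of its letters, so a functor out of the free category is determined by
its values on letters. -/
lemma elem_comp {X : OpCat B} (h : free B Y ⟶ X) {k : ℕ} {a b : Y.obj}
    (p : Chain Y.obj k a b) {Z : V} (x : Z ⟶ B.obj k)
    (f : ∀ i, Z ⟶ Y.hom (p.src i) (p.tgt i)) :
    elem p x f ≫ (OpCat.Hom.graph h).hom a b = X.op (p.map (OpCat.Hom.graph h).obj) x fun i =>
      f i ≫ (unit B Y).hom (p.src i) (p.tgt i) ≫ (OpCat.Hom.graph h).hom _ _ := by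
  have e1 := OpCat.Hom.comm h (n := k) (a := a) (b := b) p x
    fun i => f i ≫ (unit B Y).hom (p.src i) (p.tgt i)
  have e2 := free_op (Y := Y) p x fun i => f i ≫ (unit B Y).hom (p.src i) (p.tgt i)
  have e3 := (elem_eq_op p x f).trans e2.symm
  refine (congrArg (· ≫ _) e3).trans (e1.trans ?_)
  exact congrArg _ (funext fun i => Category.assoc _ _ _)

lemma hat_unique (X : OpCat B) (g : Y ⟶ X.toEGraph) (h : free B Y ⟶ X)
    (hh : unit B Y ≫ OpCat.Hom.graph h = g) : h = hat X g := by
  subst hh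
  refine OpCat.hom_ext (EGraph.hom_ext (fun _ => rfl) fun a b => ?_)
  refine (Category.comp_id _).trans ((isCoprod_ι (B := B) (Y := Y) a b).hom_ext fun s => ?_)
  have e := (elem_eta (B := B) s.2 (𝟙 _))
  rw [Category.id_comp] at e
  rw [e]
  exact (elem_comp h _ _ _).trans (elem_hatHom X (unit B Y ≫ OpCat.Hom.graph h) _ _ _).symm

variable (B Y) in
/-- The universal property of the free category. -/
noncomputable def homEquiv (X : OpCat B) : (free B Y ⟶ X) ≃ (Y ⟶ (OpCat.forget B).obj X) where
  toFun h := unit B Y ≫ OpCat.Hom.graph h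
  invFun g := hat X g
  left_inv h := (hat_unique X _ h rfl).symm
  right_inv g := unit_hat X g

lemma homEquiv_comp {X X' : OpCat B} (g : X ⟶ X') (h : free B Y ⟶ X) :
    homEquiv B Y X' (h ≫ g) = homEquiv B Y X h ≫ (OpCat.forget B).map g :=
  (Category.assoc (unit B Y) (OpCat.Hom.graph h) (OpCat.Hom.graph g)).symm

variable (B) in
/-- The free category functor, left adjoint to the forgetful functor. -/
noncomputable def functor : EGraph V ⥤ OpCat B :=
  Adjunction.leftAdjointOfEquiv (G := OpCat.forget B) (F_obj := fun Y => free B Y)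
    (fun Y X => homEquiv B Y X) fun Y X X' g h => homEquiv_comp g h

variable (B) in
noncomputable def adjunction : functor B ⊣ OpCat.forget B :=
  Adjunction.adjunctionOfEquivLeft (G := OpCat.forget B) (F_obj := fun Y => free B Y)
    (fun Y X => homEquiv B Y X) fun Y X X' g h => homEquiv_comp g h

lemma functor_map {Y Y' : EGraph V} (f : Y ⟶ Y') :
    (functor B).map f = hat (free B Y') (f ≫ unit B Y') :=
  congrArg (fun t => hat (free B Y') (f ≫ t)) (Category.comp_id (unit B Y'))

lemma homEquiv_adjunction (Y : EGraph V) (X : OpCat B) :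
    (adjunction B).homEquiv Y X = homEquiv B Y X := by
  ext g
  refine ((adjunction B).homEquiv_unit _ _ _).trans ?_
  have : (adjunction B).unit.app Y = homEquiv B Y (free B Y) (𝟙 _) := by
    simp [adjunction, Adjunction.adjunctionOfEquivLeft]
    rfl
  rw [this]
  exact (homEquiv_comp g (𝟙 _)).symm.trans (congrArg _ (Category.id_comp g))

lemma adjunction_unit (Y : EGraph V) : (adjunction B).unit.app Y = unit B Y := by
  refine ((adjunction B).homEquiv_id Y).symm.trans ?_
  rw [homEquiv_adjunction]
  exact Category.comp_id (unit B Y)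

end FreeOpCat

/-! ### Monadicity -/

section Monadicity

universe v₁ u₁ u₂

variable {V : Type u₁} [Category.{v₁} V]

/-- The universal property of a coequalizer. -/
structure IsCoequalizer {X Y Z : V} (f g : X ⟶ Y) (e : Y ⟶ Z) : Prop where
  w : f ≫ e = g ≫ e
  existsUnique : ∀ ⦃W : V⦄ (h : Y ⟶ W), f ≫ h = g ≫ h → ∃! u : Z ⟶ W, e ≫ u = h

lemma IsCoequalizer.epi {X Y Z : V} {f g : X ⟶ Y} {e : Y ⟶ Z} (h : IsCoequalizer f g e) :
    Epi e :=
  ⟨fun a b hab => (h.existsUnique (e ≫ b) (by rw [← Category.assoc, h.w, Category.assoc])).unique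
    hab rfl⟩

lemma IsCoequalizer.of_isColimit {X Y Z : V} {f g : X ⟶ Y} {e : Y ⟶ Z} (w : f ≫ e = g ≫ e)
    (h : IsColimit (Cofork.ofπ e w)) : IsCoequalizer f g e where
  w := w
  existsUnique W k hk := ⟨Cofork.IsColimit.desc h k hk, Cofork.IsColimit.π_desc' h k hk,
    fun u hu => Cofork.IsColimit.hom_ext h (hu.trans (Cofork.IsColimit.π_desc' h k hk).symm)⟩

variable {G : Type u₂} [Category.{v₁} G]

/-- The functor `U` sends the fork `f, g, e` to a split coequalizer. -/
structure IsSplitFork (U : V ⥤ G) {X Y Z : V} (f g : X ⟶ Y) (e : Y ⟶ Z) : Prop where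
  w : f ≫ e = g ≫ e
  split : ∃ (s : U.obj Z ⟶ U.obj Y) (t : U.obj Y ⟶ U.obj X),
    s ≫ U.map e = 𝟙 _ ∧ t ≫ U.map g = 𝟙 _ ∧ t ≫ U.map f = U.map e ≫ s

lemma isCoequalizer_of_split {X Y Z : V} {f g : X ⟶ Y} {e : Y ⟶ Z} (w : f ≫ e = g ≫ e)
    (s : Z ⟶ Y) (t : Y ⟶ X) (hs : s ≫ e = 𝟙 _) (hg : t ≫ g = 𝟙 _) (hf : t ≫ f = e ≫ s) :
    IsCoequalizer f g e where
  w := w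
  existsUnique W h hh := by
    refine ⟨s ≫ h, ?_, fun u hu => ?_⟩
    · change e ≫ s ≫ h = h
      rw [← Category.assoc, ← hf, Category.assoc, hh, ← Category.assoc, hg, Category.id_comp]
    · rw [← hu, ← Category.assoc, hs, Category.id_comp]

lemma IsSplitFork.isCoequalizer_map {U : V ⥤ G} {X Y Z : V} {f g : X ⟶ Y} {e : Y ⟶ Z}
    (h : IsSplitFork U f g e) : IsCoequalizer (U.map f) (U.map g) (U.map e) := by
  obtain ⟨w, s, t, hs, hg, hf⟩ := h
  exact isCoequalizer_of_split (by rw [← U.map_comp, w, U.map_comp]) s t hs hg hf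

lemma IsSplitFork.isSplitPair {U : V ⥤ G} {X Y Z : V} {f g : X ⟶ Y} {e : Y ⟶ Z}
    (h : IsSplitFork U f g e) : U.IsSplitPair f g := by
  obtain ⟨w, s, t, hs, hg, hf⟩ := h
  exact ⟨_, U.map e,
    ⟨{ rightSection := s
       leftSection := t
       condition := by rw [← U.map_comp, w, U.map_comp]
       rightSection_π := hs
       leftSection_bottom := hg
       leftSection_top := hf }⟩⟩

/-- A monadic functor creates coequalizers of pairs that become split after applying it. -/
lemma exists_isCoequalizer (U : V ⥤ G) [MonadicRightAdjoint U] {X Y : V} (f g : X ⟶ Y)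
    [U.IsSplitPair f g] : ∃ (Z : V) (e : Y ⟶ Z), IsCoequalizer f g e ∧
      IsCoequalizer (U.map f) (U.map g) (U.map e) := by
  have := Monad.createsGSplitCoequalizersOfMonadic U f g
  have : HasColimit (parallelPair f g ⋙ U) :=
    haveI : HasColimit (parallelPair ((parallelPair f g ⋙ U).map WalkingParallelPairHom.left)
        ((parallelPair f g ⋙ U).map WalkingParallelPairHom.right)) :=
      inferInstanceAs (HasCoequalizer (U.map f) (U.map g))
    hasColimit_of_iso (diagramIsoParallelPair (parallelPair f g ⋙ U))
  have : HasCoequalizer f g := hasColimit_of_created _ U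
  exact ⟨_, coequalizer.π f g, .of_isColimit (coequalizer.condition f g) (coequalizerIsCoequalizer f g),
    .of_isColimit _ (isColimitOfHasCoequalizerOfPreservesColimit U f g)⟩

lemma IsCoequalizer.exists_iso {X Y Z Z' : V} {f g : X ⟶ Y} {e : Y ⟶ Z} {e' : Y ⟶ Z'}
    (h : IsCoequalizer f g e) (h' : IsCoequalizer f g e') : ∃ i : Z ≅ Z', e ≫ i.hom = e' := by
  obtain ⟨u, hu, -⟩ := h.existsUnique e' h'.w
  obtain ⟨w, hw, -⟩ := h'.existsUnique e h.w
  have := h.epi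
  have := h'.epi
  exact ⟨⟨u, w, by rw [← cancel_epi e, ← Category.assoc, hu, hw, Category.comp_id],
    by rw [← cancel_epi e', ← Category.assoc, hw, hu, Category.comp_id]⟩, hu⟩

lemma reflectsIsomorphisms_of_monadic (U : V ⥤ G) [MonadicRightAdjoint U] :
    U.ReflectsIsomorphisms where
  reflects {X Y} f hf := by
    have h1 : IsIso ((Monad.comparison (monadicAdjunction U)).map f) :=
      haveI : IsIso ((Monad.forget (monadicAdjunction U).toMonad).map
        ((Monad.comparison (monadicAdjunction U)).map f)) := hf
      isIso_of_reflects_iso _ (Monad.forget _)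
    exact isIso_of_reflects_iso _ (Monad.comparison (monadicAdjunction U))

/-- The given fork is compared with the coequalizer created by `U`. After applying `U` both are
coequalizers of the same pair, so the comparison becomes invertible, and `U` reflects isomorphisms.
-/
lemma IsSplitFork.isCoequalizer {U : V ⥤ G} [MonadicRightAdjoint U] {X Y Z : V} {f g : X ⟶ Y}
    {e : Y ⟶ Z} (h : IsSplitFork U f g e) : IsCoequalizer f g e := by
  have := h.isSplitPair
  obtain ⟨Z', e', h1, h2⟩ := exists_isCoequalizer U f g
  obtain ⟨i, hi⟩ := h2.exists_iso h.isCoequalizer_map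
  obtain ⟨u, hu, -⟩ := h1.existsUnique e h.w
  have : IsIso (U.map u) := by
    have := h2.epi
    have : U.map u = i.hom := by rw [← cancel_epi (U.map e'), ← U.map_comp, hu, hi]
    rw [this]
    infer_instance
  have := reflectsIsomorphisms_of_monadic U
  have := isIso_of_reflects_iso u U
  refine ⟨h.w, fun W k hk => ?_⟩
  obtain ⟨l, hl, hl'⟩ := h1.existsUnique k hk
  refine ⟨inv u ≫ l, ?_, fun l' h' => ?_⟩
  · change e ≫ inv u ≫ l = k
    rw [← hu, Category.assoc, IsIso.hom_inv_id_assoc, hl]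
  · rw [IsIso.eq_inv_comp]
    refine hl' _ ?_
    change e' ≫ u ≫ l' = k
    rw [← Category.assoc, hu, h']

/-- A splitting through an object of `G` moves along the isomorphism of that object with the image
of the created coequalizer. -/
lemma exists_isSplitFork (U : V ⥤ G) [MonadicRightAdjoint U] {X Y : V} (f g : X ⟶ Y) {W : G}
    (π : U.obj Y ⟶ W) (s : W ⟶ U.obj Y) (t : U.obj Y ⟶ U.obj X) (w : U.map f ≫ π = U.map g ≫ π)
    (hs : s ≫ π = 𝟙 _) (hg : t ≫ U.map g = 𝟙 _) (hf : t ≫ U.map f = π ≫ s) :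
    ∃ (Z : V) (e : Y ⟶ Z), IsSplitFork U f g e := by
  have : U.IsSplitPair f g := ⟨W, π, ⟨⟨s, t, w, hs, hg, hf⟩⟩⟩
  obtain ⟨Z, e, h1, h2⟩ := exists_isCoequalizer U f g
  obtain ⟨i, hi⟩ := (isCoequalizer_of_split w s t hs hg hf).exists_iso h2
  refine ⟨Z, e, h1.w, i.inv ≫ s, t, ?_, hg, ?_⟩
  · rw [← hi, Category.assoc, reassoc_of% hs, Iso.inv_hom_id]
  · rw [← hi, Category.assoc, Iso.hom_inv_id_assoc, hf]

/-- The structure map `a` coequalizes the canonical pair and so factors through `U.map e`; the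
section `η A` of `a` provides the inverse. Thus the coequalizer has underlying object `A`. -/
lemma isCoequalizer_counit_of_exists {U : V ⥤ G} {F : G ⥤ V} [U.ReflectsIsomorphisms]
    (η : ∀ A, A ⟶ U.obj (F.obj A)) (ε : ∀ X, F.obj (U.obj X) ⟶ X)
    (hη : ∀ {A B : G} (f : A ⟶ B), f ≫ η B = η A ≫ U.map (F.map f))
    (hε : ∀ {X Y : V} (f : X ⟶ Y), F.map (U.map f) ≫ ε Y = ε X ≫ f)
    (h2 : ∀ X, η (U.obj X) ≫ U.map (ε X) = 𝟙 _)
    {A : G} {a : U.obj (F.obj A) ⟶ A} (ha : η A ≫ a = 𝟙 A)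
    (ha' : U.map (F.map a) ≫ a = U.map (ε (F.obj A)) ≫ a) {Z : V} {e : F.obj A ⟶ Z}
    (he : IsCoequalizer (U.map (F.map a)) (U.map (ε (F.obj A))) (U.map e)) :
    ∃ φ : A ≅ U.obj Z, φ.hom = η A ≫ U.map e ∧ a ≫ φ.hom = U.map e := by
  obtain ⟨u, hu, -⟩ := he.existsUnique a ha'
  have e1 : a ≫ η A ≫ U.map e = U.map e := by
    rw [← Category.assoc, hη, Category.assoc, he.w, ← Category.assoc, h2, Category.id_comp]
  have := he.epi
  exact ⟨⟨η A ≫ U.map e, u, by rw [Category.assoc, hu, ha],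
    by rw [← cancel_epi (U.map e), ← Category.assoc, hu, e1, Category.comp_id]⟩, rfl, e1⟩

/-- A form of Beck's monadicity theorem. -/
theorem isEquivalence_comparison {U : V ⥤ G} {F : G ⥤ V} (adj : F ⊣ U) [U.ReflectsIsomorphisms]
    (η : ∀ A, A ⟶ U.obj (F.obj A)) (ε : ∀ X, F.obj (U.obj X) ⟶ X)
    (hη : ∀ A, adj.unit.app A = η A) (hε : ∀ X, adj.counit.app X = ε X)
    (h : ∀ (A : G) (a : U.obj (F.obj A) ⟶ A), η A ≫ a = 𝟙 A →
      U.map (F.map a) ≫ a = U.map (ε (F.obj A)) ≫ a → ∃ (Z : V) (e : F.obj A ⟶ Z),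
      IsCoequalizer (F.map a) (ε (F.obj A)) e ∧
      IsCoequalizer (U.map (F.map a)) (U.map (ε (F.obj A))) (U.map e)) :
    (Monad.comparison adj).IsEquivalence := by
  have nη : ∀ {A B : G} (f : A ⟶ B), f ≫ η B = η A ≫ U.map (F.map f) := fun f => by
    rw [← hη, ← hη]; exact adj.unit.naturality f
  have nε : ∀ {X Y : V} (f : X ⟶ Y), F.map (U.map f) ≫ ε Y = ε X ≫ f := fun f => by
    rw [← hε, ← hε]; exact adj.counit.naturality f
  have h1 : ∀ A, F.map (η A) ≫ ε (F.obj A) = 𝟙 _ := fun A => by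
    rw [← hη, ← hε]; exact adj.left_triangle_components A
  have h2 : ∀ X, η (U.obj X) ≫ U.map (ε X) = 𝟙 _ := fun X => by
    rw [← hη, ← hε]; exact adj.right_triangle_components X
  -- Every object has a canonical presentation by free ones: the coequalizer supplied by `h` for the
  -- algebra `U X` has the same underlying object as `X`, hence is `X`, as `U` reflects
  -- isomorphisms.
  have main : ∀ X : V, IsCoequalizer (F.map (U.map (ε X))) (ε (F.obj (U.obj X))) (ε X) := by
    intro X
    have ha' : U.map (F.map (U.map (ε X))) ≫ U.map (ε X) =
        U.map (ε (F.obj (U.obj X))) ≫ U.map (ε X) := by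
      rw [← U.map_comp, ← U.map_comp, nε]
    obtain ⟨Z, e, k1, k2⟩ := h (U.obj X) (U.map (ε X)) (h2 X) ha'
    obtain ⟨φ, -, hφ⟩ := isCoequalizer_counit_of_exists η ε nη nε h2 (h2 X) ha' k2
    obtain ⟨u, hu, -⟩ := k1.existsUnique (ε X) (nε (ε X))
    have hU : U.map u = φ.inv := by
      have := k2.epi
      rw [← cancel_epi (U.map e), ← U.map_comp, hu, ← hφ, Category.assoc, φ.hom_inv_id,
        Category.comp_id]
    have : IsIso (U.map u) := by rw [hU]; infer_instance
    have hi := isIso_of_reflects_iso u U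
    refine ⟨nε _, fun W k hk => ?_⟩
    obtain ⟨l, hl, hl'⟩ := k1.existsUnique k hk
    refine ⟨inv u ≫ l, ?_, fun l' h' => ?_⟩
    · change ε X ≫ inv u ≫ l = k
      rw [← hu, Category.assoc, IsIso.hom_inv_id_assoc, hl]
    · rw [IsIso.eq_inv_comp]
      refine hl' _ ?_
      change e ≫ u ≫ l' = k
      rw [← Category.assoc, hu, h']
  have hfaith : (Monad.comparison adj).Faithful := ⟨fun {X Y f g} hfg => by
    have := (main X).epi
    have hU : U.map f = U.map g := congrArg Monad.Algebra.Hom.f hfg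
    rw [← cancel_epi (ε X), ← nε, hU, nε]⟩
  -- For an algebra morphism `k'`, the transpose `F.map k' ≫ ε Y` coequalizes the canonical pair of
  -- `X`. Its factorization through `ε X` is the preimage of `k`.
  have hfull : (Monad.comparison adj).Full := ⟨fun {X Y} k => by
    let k' : U.obj X ⟶ U.obj Y := k.f
    have hk : U.map (F.map k') ≫ U.map (ε Y) = U.map (ε X) ≫ k' := by
      rw [← hε, ← hε]; exact k.h
    obtain ⟨u, hu, -⟩ := (main X).existsUnique (F.map k' ≫ ε Y) (by
      rw [← Category.assoc, ← F.map_comp, ← hk, ← U.map_comp, nε])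
    refine ⟨u, Monad.Algebra.Hom.ext ?_⟩
    change U.map u = k'
    have := congrArg (fun t => η (U.obj X) ≫ U.map t) hu
    rw [U.map_comp, ← Category.assoc, h2, U.map_comp, hk] at this
    rw [← Category.id_comp (U.map u), this, ← Category.assoc, h2, Category.id_comp]⟩
  have hess : (Monad.comparison adj).EssSurj := ⟨fun A => by
    have ha : η A.A ≫ A.a = 𝟙 A.A := by rw [← hη]; exact A.unit
    have ha' : U.map (F.map A.a) ≫ A.a = U.map (ε (F.obj A.A)) ≫ A.a := by
      rw [← hε]; exact A.assoc.symm
    obtain ⟨Z, e, k1, k2⟩ := h A.A A.a ha ha'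
    obtain ⟨φ, hφ, hφ'⟩ := isCoequalizer_counit_of_exists η ε nη nε h2 ha ha' k2
    refine ⟨Z, ⟨(Monad.Algebra.isoMk (A := A) (B := (Monad.comparison adj).obj Z) φ ?_).symm⟩⟩
    refine Eq.trans ?_ hφ'.symm
    change U.map (F.map φ.hom) ≫ U.map (adj.counit.app Z) = _
    rw [hε, hφ, ← U.map_comp, F.map_comp]
    refine congrArg U.map ((Category.assoc _ _ _).trans ((congrArg (_ ≫ ·) (nε e)).trans ?_))
    exact (Category.assoc _ _ _).symm.trans ((congrArg (· ≫ e) (h1 A.A)).trans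
      (Category.id_comp e))⟩
  exact { faithful := hfaith, full := hfull, essSurj := hess }

end Monadicity

/-! ### Coequalizers of categories over an operad -/

section

variable {V : Type u} [Category.{v} V] [HasFiniteProducts V] {G : Type u'} [Category.{v} G]

/-- The splittings exist only in `G`, but `U` preserves products, so they can be assembled there
factor by factor. -/
lemma IsSplitFork.prod (U : V ⥤ G) [PreservesFiniteProducts U] {n : ℕ} (X : V)
    {P Q R : Fin n → V} {f g : ∀ l, P l ⟶ Q l} {e : ∀ l, Q l ⟶ R l}
    (h : ∀ l, IsSplitFork U (f l) (g l) (e l)) :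
    IsSplitFork U (prod.map (𝟙 X) (Limits.Pi.map f)) (prod.map (𝟙 X) (Limits.Pi.map g))
      (prod.map (𝟙 X) (Limits.Pi.map e)) := by
  choose s t hs hg hf using fun l => (h l).split
  have exists_lift : ∀ {K L : Fin n → V} (k : ∀ l, U.obj (K l) ⟶ U.obj (L l)),
      ∃ r : U.obj (X ⨯ ∏ᶜ K) ⟶ U.obj (X ⨯ ∏ᶜ L), r ≫ U.map prod.fst = U.map prod.fst ∧
        ∀ l, r ≫ U.map (prod.snd ≫ Pi.π L l) = U.map (prod.snd ≫ Pi.π K l) ≫ k l := by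
    intro K L k
    obtain ⟨r, hr, -⟩ := (isProd_prod_pi X L).map U (fun o => match o with
      | none => U.map prod.fst
      | some l => U.map (prod.snd ≫ Pi.π K l) ≫ k l)
    exact ⟨r, hr none, fun l => hr (some l)⟩
  have hext : ∀ {K L : Fin n → V} {r r' : U.obj (X ⨯ ∏ᶜ K) ⟶ U.obj (X ⨯ ∏ᶜ L)},
      r ≫ U.map prod.fst = r' ≫ U.map prod.fst →
      (∀ l, r ≫ U.map (prod.snd ≫ Pi.π L l) = r' ≫ U.map (prod.snd ≫ Pi.π L l)) → r = r' :=
    fun {K L r r'} h h' => ((isProd_prod_pi X L).map U).hom_ext fun o => match o with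
      | none => h
      | some l => h' l
  have e0 : ∀ {K L : Fin n → V} (k : ∀ l, K l ⟶ L l),
      U.map (prod.map (𝟙 X) (Limits.Pi.map k)) ≫ U.map prod.fst = U.map prod.fst := fun k => by
    rw [← U.map_comp, prod.map_fst, Category.comp_id]
  have e1 : ∀ {K L : Fin n → V} (k : ∀ l, K l ⟶ L l) (l),
      U.map (prod.map (𝟙 X) (Limits.Pi.map k)) ≫ U.map (prod.snd ≫ Pi.π L l) =
        U.map (prod.snd ≫ Pi.π K l) ≫ U.map (k l) := fun k l => by
    rw [← U.map_comp, ← U.map_comp, prod.map_snd_assoc, Pi.map_π, Category.assoc]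
  obtain ⟨S, hS, hS'⟩ := exists_lift s
  obtain ⟨T, hT, hT'⟩ := exists_lift t
  refine ⟨?_, S, T, hext ?_ fun l => ?_, hext ?_ fun l => ?_, hext ?_ fun l => ?_⟩
  · rw [prod.map_map, prod.map_map]
    congr 1
    ext l
    simp [(h l).w]
  · rw [Category.assoc, e0, hS, Category.id_comp]
  · rw [Category.assoc, e1, ← Category.assoc, hS', Category.assoc, hs, Category.comp_id,
      Category.id_comp]
  · rw [Category.assoc, e0, hT, Category.id_comp]
  · rw [Category.assoc, e1, ← Category.assoc, hT', Category.assoc, hg, Category.comp_id,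
      Category.id_comp]
  · rw [Category.assoc, e0, hT, Category.assoc, hS, e0]
  · rw [Category.assoc, e1, ← Category.assoc, hT', Category.assoc, hf, Category.assoc, hS',
      ← Category.assoc, ← Category.assoc, e1]

namespace OpCat

variable {B : NSOperad V}

/-- A pair of functors into a category `Y` over an operad which are bijective on objects, with
quotients of the homs of `Y` which become split after applying the functor `U`. -/
structure SplitFork (U : V ⥤ G) (Y : OpCat B) where
  src : Y.obj → Y.obj → V
  op : ∀ {n : ℕ} {a b : Y.obj} (p : Chain Y.obj n a b) {Z : V}, (Z ⟶ B.obj n) →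
    (∀ i, Z ⟶ src (p.src i) (p.tgt i)) → (Z ⟶ src a b)
  f : ∀ a b, src a b ⟶ Y.hom a b
  g : ∀ a b, src a b ⟶ Y.hom a b
  tgt : Y.obj → Y.obj → V
  e : ∀ a b, Y.hom a b ⟶ tgt a b
  op_f : ∀ {n : ℕ} {a b : Y.obj} (p : Chain Y.obj n a b) {Z : V} (x : Z ⟶ B.obj n)
    (k : ∀ i, Z ⟶ src (p.src i) (p.tgt i)), op p x k ≫ f a b = Y.op p x fun i => k i ≫ f _ _
  op_g : ∀ {n : ℕ} {a b : Y.obj} (p : Chain Y.obj n a b) {Z : V} (x : Z ⟶ B.obj n)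
    (k : ∀ i, Z ⟶ src (p.src i) (p.tgt i)), op p x k ≫ g a b = Y.op p x fun i => k i ≫ g _ _
  fork : ∀ a b, IsSplitFork U (f a b) (g a b) (e a b)

namespace SplitFork

variable {U : V ⥤ G} [PreservesFiniteProducts U] [MonadicRightAdjoint U] {Y : OpCat B}
  (S : SplitFork U Y)

/-- Products do not preserve coequalizers in general. They preserve `U`-split forks, and for monadic
`U` these are coequalizers. This is what lets actions descend to quotients of homs. -/
lemma isCoequalizer {k : ℕ} (X : V) (s t : Fin k → Y.obj) :
    IsCoequalizer (prod.map (𝟙 X) (Limits.Pi.map fun i => S.f (s i) (t i)))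
      (prod.map (𝟙 X) (Limits.Pi.map fun i => S.g (s i) (t i)))
      (prod.map (𝟙 X) (Limits.Pi.map fun i => S.e (s i) (t i))) :=
  (IsSplitFork.prod U X fun i => S.fork (s i) (t i)).isCoequalizer

lemma lift_map {X Z : V} {n : ℕ} {P Q : Fin n → V} (k : ∀ l, P l ⟶ Q l) (x : Z ⟶ X)
    (f : ∀ l, Z ⟶ P l) : prod.lift x (Pi.lift f) ≫ prod.map (𝟙 X) (Limits.Pi.map k) =
      prod.lift x (Pi.lift fun l => f l ≫ k l) := by
  ext <;> simp [prod.lift_fst, prod.lift_snd_assoc]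

/-- Both `f` and `g` are compatible with the actions, so acting in `Y` and projecting identifies the
two composites. -/
lemma exists_act {k : ℕ} {a b : Y.obj} (p : Chain Y.obj k a b) :
    ∃ act : B.obj k ⨯ (∏ᶜ fun i => S.tgt (p.src i) (p.tgt i)) ⟶ S.tgt a b,
      prod.map (𝟙 _) (Limits.Pi.map fun i => S.e (p.src i) (p.tgt i)) ≫ act =
        Y.act p ≫ S.e a b := by
  refine ((S.isCoequalizer (B.obj k) p.src p.tgt).existsUnique (Y.act p ≫ S.e a b) ?_).exists
  have key : ∀ (k : ∀ a b, S.src a b ⟶ Y.hom a b),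
      prod.map (𝟙 _) (Limits.Pi.map fun i => k (p.src i) (p.tgt i)) ≫ Y.act p =
        Y.op p prod.fst fun i => (prod.snd ≫ Pi.π _ i) ≫ k (p.src i) (p.tgt i) := fun k => by
    rw [OpCat.op, ← lift_map]
    congr 1
    ext <;> simp [prod.lift_fst, prod.lift_snd_assoc]
  rw [← Category.assoc, ← Category.assoc, key, key, ← S.op_f, ← S.op_g, Category.assoc,
    Category.assoc, (S.fork a b).w]

noncomputable def act {k : ℕ} {a b : Y.obj} (p : Chain Y.obj k a b) :
    B.obj k ⨯ (∏ᶜ fun i => S.tgt (p.src i) (p.tgt i)) ⟶ S.tgt a b := (S.exists_act p).choose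

/-- The action on the quotient. -/
noncomputable def opTgt {k : ℕ} {a b : Y.obj} (p : Chain Y.obj k a b) {Z : V} (x : Z ⟶ B.obj k)
    (f : ∀ i, Z ⟶ S.tgt (p.src i) (p.tgt i)) : Z ⟶ S.tgt a b := prod.lift x (Pi.lift f) ≫ S.act p

lemma opTgt_e {k : ℕ} {a b : Y.obj} (p : Chain Y.obj k a b) {Z : V} (x : Z ⟶ B.obj k)
    (f : ∀ i, Z ⟶ Y.hom (p.src i) (p.tgt i)) :
    S.opTgt p x (fun i => f i ≫ S.e _ _) = Y.op p x f ≫ S.e a b := by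
  rw [opTgt, ← lift_map, Category.assoc, act, (S.exists_act p).choose_spec, ← Category.assoc]
  rfl

lemma comp_opTgt {k : ℕ} {a b : Y.obj} (p : Chain Y.obj k a b) {Z Z' : V} (w : Z' ⟶ Z)
    (x : Z ⟶ B.obj k) (f : ∀ i, Z ⟶ S.tgt (p.src i) (p.tgt i)) :
    w ≫ S.opTgt p x f = S.opTgt p (w ≫ x) fun i => w ≫ f i := by
  rw [opTgt, ← Category.assoc, FreeOpCat.comp_lift, opTgt]

/-- Two natural families of maps out of elements of the quotient agree if they agree on the
elements which come from `Y`. -/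
lemma local_ext {n : ℕ} {X : V} {s t : Fin n → Y.obj} {W : V}
    (u w : ∀ {Z : V}, (Z ⟶ X) → (∀ l, Z ⟶ S.tgt (s l) (t l)) → (Z ⟶ W))
    (hu : ∀ {Z Z' : V} (r : Z' ⟶ Z) (x : Z ⟶ X) (f : ∀ l, Z ⟶ S.tgt (s l) (t l)),
      r ≫ u x f = u (r ≫ x) fun l => r ≫ f l)
    (hw : ∀ {Z Z' : V} (r : Z' ⟶ Z) (x : Z ⟶ X) (f : ∀ l, Z ⟶ S.tgt (s l) (t l)),
      r ≫ w x f = w (r ≫ x) fun l => r ≫ f l)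
    (h : ∀ {Z : V} (x : Z ⟶ X) (f : ∀ l, Z ⟶ Y.hom (s l) (t l)),
      u x (fun l => f l ≫ S.e _ _) = w x fun l => f l ≫ S.e _ _)
    {Z : V} (x : Z ⟶ X) (f : ∀ l, Z ⟶ S.tgt (s l) (t l)) : u x f = w x f := by
  have := (S.isCoequalizer X s t).epi
  have key : u (prod.fst : X ⨯ ∏ᶜ (fun l => S.tgt (s l) (t l)) ⟶ X)
      (fun l => prod.snd ≫ Pi.π _ l) = w prod.fst fun l => prod.snd ≫ Pi.π _ l := by
    rw [← cancel_epi (prod.map (𝟙 X) (Limits.Pi.map fun i => S.e (s i) (t i))), hu, hw]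
    have e' : ∀ l, prod.map (𝟙 X) (Limits.Pi.map fun i => S.e (s i) (t i)) ≫ prod.snd ≫
        Pi.π (fun l => S.tgt (s l) (t l)) l =
        (prod.snd ≫ Pi.π (fun l => Y.hom (s l) (t l)) l) ≫ S.e (s l) (t l) := fun l => by
      rw [prod.map_snd_assoc, Pi.map_π, Category.assoc]
    rw [funext e']
    exact h _ _
  have e1 : prod.lift x (Pi.lift f) ≫ prod.fst = x := prod.lift_fst _ _
  have e2 : (fun l => prod.lift x (Pi.lift f) ≫ prod.snd ≫ Pi.π (fun l => S.tgt (s l) (t l)) l) =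
      f := funext fun l => OpCat.lift_elem x f l
  have := congrArg (fun t => prod.lift x (Pi.lift f) ≫ t) key
  rwa [hu, hw, e1, e2] at this

/-- The graph of quotients. -/
def graph : EGraph V := ⟨Y.obj, S.tgt⟩

lemma e_eqToHom {a b a' b' : Y.obj} (ha : a = a') (hb : b = b') :
    S.e a b ≫ eqToHom (congrArg₂ S.tgt ha hb) = eqToHom (congrArg₂ Y.hom ha hb) ≫ S.e a' b' := by
  subst ha hb
  simp

lemma opTgt_one {a b : Y.obj} (p : Chain Y.obj 1 a b) {Z : V}
    (f : ∀ i, Z ⟶ S.tgt (p.src i) (p.tgt i)) :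
    S.opTgt p (terminal.from Z ≫ B.one) f = f 0 ≫ eqToHom (congrArg₂ S.tgt p.first p.last) := by
  refine S.local_ext (X := ⊤_ V) (s := p.src) (t := p.tgt)
    (fun x f => S.opTgt p (x ≫ B.one) f)
    (fun x f => f 0 ≫ eqToHom (congrArg₂ S.tgt p.first p.last))
    (fun w x f => ?_) (fun w x f => (Category.assoc _ _ _).symm) (fun {Z} x f => ?_) _ f
  · rw [comp_opTgt, Category.assoc]
  · obtain rfl : x = terminal.from Z := Subsingleton.elim _ _
    refine (S.opTgt_e p _ f).trans ((congrArg (· ≫ _) (Y.op_one p f)).trans ?_)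
    refine (Category.assoc _ _ _).trans (Eq.trans ?_ (Category.assoc _ _ _).symm)
    exact congrArg (f 0 ≫ ·) (S.e_eqToHom p.first p.last).symm

lemma opTgt_comp {k : ℕ} {m : Fin k → ℕ} {a b : Y.obj} (p : Chain Y.obj k a b)
    (q : ∀ i, Chain Y.obj (m i) (p.src i) (p.tgt i)) (r : Chain Y.obj (∑ i, m i) a b)
    (h : p.IsConcat q r) {Z : V} (x : Z ⟶ B.obj k) (y : ∀ i, Z ⟶ B.obj (m i))
    (f : ∀ i j, Z ⟶ S.tgt ((q i).src j) ((q i).tgt j))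
    (g : ∀ l, Z ⟶ S.tgt (r.src l) (r.tgt l))
    (hg : ∀ i j, g (finSigmaFinEquiv ⟨i, j⟩) =
      f i j ≫ eqToHom (congrArg₂ S.tgt (h.src i j).symm (h.tgt i j).symm)) :
    S.opTgt r (prod.lift x (Pi.lift y) ≫ B.comp m) g =
      S.opTgt p x fun i => S.opTgt (q i) (y i) (f i) := by
  -- All operations are packed into one parameter, and the families of elements are recovered from
  -- `g`, as in the free case.
  have key := fun (Z : V) => S.local_ext (X := B.obj k ⨯ ∏ᶜ fun i => B.obj (m i)) (s := r.src)
    (t := r.tgt) (fun x g => S.opTgt r (x ≫ B.comp m) g)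
    (fun x g => S.opTgt p (x ≫ prod.fst) fun i =>
      S.opTgt (q i) (x ≫ prod.snd ≫ Pi.π _ i) fun j =>
        g (finSigmaFinEquiv ⟨i, j⟩) ≫ eqToHom (congrArg₂ S.tgt (h.src i j) (h.tgt i j)))
    (fun w x f => by rw [comp_opTgt, Category.assoc])
    (fun w x f => by simp only [comp_opTgt, Category.assoc])
    (fun {Z} x f => ?_) (Z := Z)
  · have := key Z (prod.lift x (Pi.lift y)) g
    refine this.trans ?_
    rw [prod.lift_fst]
    congr 1
    funext i
    rw [OpCat.lift_elem]
    congr 1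
    funext j
    rw [hg]
    simp
  · have e1 : ∀ i j, (f (finSigmaFinEquiv ⟨i, j⟩) ≫ S.e _ _) ≫
        eqToHom (congrArg₂ S.tgt (h.src i j) (h.tgt i j)) = (f (finSigmaFinEquiv ⟨i, j⟩) ≫
          eqToHom (congrArg₂ Y.hom (h.src i j) (h.tgt i j))) ≫ S.e _ _ := fun i j => by
      rw [Category.assoc, S.e_eqToHom (h.src i j) (h.tgt i j), Category.assoc]
    dsimp only
    simp only [e1, opTgt_e]
    rw [← Y.op_comp p q r h (x ≫ prod.fst) (fun i => x ≫ prod.snd ≫ Pi.π _ i)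
      (fun i j => f (finSigmaFinEquiv ⟨i, j⟩) ≫
        eqToHom (congrArg₂ Y.hom (h.src i j) (h.tgt i j))) f fun i j => by simp, FreeOpCat.lift_eta]

/-- The quotient category. -/
noncomputable def quot : OpCat B :=
  OpCat.ofOp S.graph (fun p _ x f => S.opTgt p x f) S.comp_opTgt S.opTgt_one
    fun p q r h _ x y f g hg => S.opTgt_comp p q r h x y f g hg

lemma quot_op {k : ℕ} {a b : Y.obj} (p : Chain Y.obj k a b) {Z : V} (x : Z ⟶ B.obj k)
    (f : ∀ i, Z ⟶ S.tgt (p.src i) (p.tgt i)) :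
    S.quot.op (a := a) (b := b) p x f = S.opTgt p x f :=
  OpCat.ofOp_op S.graph (fun p _ x f => S.opTgt p x f) _ _ _ (a := a) (b := b) p x f

/-- The projection to the quotient. -/
noncomputable def proj : Y ⟶ S.quot where
  graph := ⟨id, S.e⟩
  comm p Z x f := (S.opTgt_e p x f).symm.trans (S.quot_op p x _).symm

lemma isCoequalizer_tgt (a b : Y.obj) : IsCoequalizer (S.f a b) (S.g a b) (S.e a b) :=
  (S.fork a b).isCoequalizer

/-- Descends hom by hom; compatibility with the actions may be tested on elements coming from `Y`,
where it holds for `h`. -/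
lemma existsUnique {W : OpCat B} (h : Y ⟶ W)
    (hh : ∀ a b, S.f a b ≫ (Hom.graph h).hom a b = S.g a b ≫ (Hom.graph h).hom a b) :
    ∃! u : S.quot ⟶ W, S.proj ≫ u = h := by
  choose u hu hu' using fun a b => (S.isCoequalizer_tgt a b).existsUnique _ (hh a b)
  dsimp only at hu
  have key : ∀ {n : ℕ} {a b : Y.obj} (p : Chain Y.obj n a b) {Z : V} (x : Z ⟶ B.obj n)
      (f : ∀ i, Z ⟶ S.tgt (p.src i) (p.tgt i)), S.opTgt p x f ≫ u a b =
        W.op (p.map (Hom.graph h).obj) x (fun i => f i ≫ u (p.src i) (p.tgt i)) := by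
    intro n a b p Z x f
    refine S.local_ext (s := p.src) (t := p.tgt) (fun x f => S.opTgt p x f ≫ u a b)
      (fun x f => W.op (p.map (Hom.graph h).obj) x (fun i => f i ≫ u (p.src i) (p.tgt i)))
      (fun w x f => ?_) (fun w x f => ?_) (fun {Z} x f => ?_) x f
    · rw [← Category.assoc, comp_opTgt]
    · exact (W.comp_op _ _ _ _).trans (congrArg _ (funext fun i => (Category.assoc _ _ _).symm))
    · rw [opTgt_e, Category.assoc, hu]
      refine (Hom.comm h p x f).trans (congrArg _ (funext fun i => ?_))
      rw [Category.assoc, hu]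
  let v : S.quot ⟶ W :=
    { graph := ⟨(Hom.graph h).obj, u⟩
      comm := fun {n a b} p Z x f => (congrArg (· ≫ u a b) (S.quot_op p x f)).trans (key p x f) }
  refine ⟨v, hom_ext (EGraph.hom_ext (fun _ => rfl) fun a b => ?_), fun w hw => ?_⟩
  · exact (Category.comp_id _).trans (hu a b)
  · refine hom_ext ?_
    have h1 : Hom.graph S.proj ≫ Hom.graph w = Hom.graph S.proj ≫ Hom.graph v := by
      refine (congrArg Hom.graph hw).trans (EGraph.hom_ext (fun _ => rfl) fun a b => ?_)
      exact (Category.comp_id _).trans (hu a b).symm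
    refine EGraph.hom_ext (fun a => congrArg
      (fun t : Y.toEGraph ⟶ W.toEGraph => EGraph.Hom.obj t a) h1) fun a b => ?_
    have := (S.isCoequalizer_tgt a b).epi
    refine (cancel_epi (S.e a b)).1 ?_
    exact (Category.assoc _ _ _).symm.trans (EGraph.hom_congr h1 a b)

/-- The underlying graph of the quotient is a quotient too, since the forks on homs split after
applying `U`. -/
lemma existsUnique_map {W : EGraph G} (h : (EGraph.map U).obj Y.toEGraph ⟶ W)
    (hh : ∀ a b, U.map (S.f a b) ≫ h.hom a b = U.map (S.g a b) ≫ h.hom a b) :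
    ∃! u : (EGraph.map U).obj S.graph ⟶ W, (EGraph.map U).map (Hom.graph S.proj) ≫ u = h := by
  have hc : ∀ a b, IsCoequalizer (U.map (S.f a b)) (U.map (S.g a b)) (U.map (S.e a b)) :=
    fun a b => (S.fork a b).isCoequalizer_map
  choose u hu hu' using fun a b => (hc a b).existsUnique _ (hh a b)
  dsimp only at hu
  let v : (EGraph.map U).obj S.graph ⟶ W := ⟨h.obj, u⟩
  have hv : (EGraph.map U).map (Hom.graph S.proj) ≫ v = h :=
    EGraph.hom_ext (fun _ => rfl) fun a b => (Category.comp_id _).trans (hu a b)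
  refine ⟨v, hv, fun w hw => ?_⟩
  have h1 := hw.trans hv.symm
  refine EGraph.hom_ext (fun a => congrArg
    (fun t : (EGraph.map U).obj Y.toEGraph ⟶ W => EGraph.Hom.obj t a) h1) fun a b => ?_
  have := (hc a b).epi
  refine (cancel_epi (U.map (S.e a b))).1 ?_
  exact (Category.assoc _ _ _).symm.trans (EGraph.hom_congr h1 a b)

end SplitFork

end OpCat

end

/-! ### Isomorphisms of enriched graphs. -/

namespace EGraph

variable {V : Type u} [Category.{v} V] {W : Type u'} [Category.{v} W]

lemma bijective_of_isIso {X Y : EGraph V} (f : X ⟶ Y) [IsIso f] : Function.Bijective f.obj :=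
  Function.bijective_iff_has_inverse.2 ⟨(inv f).obj,
    fun a => congrArg (fun t : X ⟶ X => EGraph.Hom.obj t a) (IsIso.hom_inv_id f),
    fun a => congrArg (fun t : Y ⟶ Y => EGraph.Hom.obj t a) (IsIso.inv_hom_id f)⟩

lemma isIso_hom {X Y : EGraph V} (f : X ⟶ Y) [IsIso f] (a b : X.obj) : IsIso (f.hom a b) := by
  have h : ∀ a, (inv f).obj (f.obj a) = a :=
    fun a => congrArg (fun t : X ⟶ X => EGraph.Hom.obj t a) (IsIso.hom_inv_id f)
  refine ⟨(inv f).hom _ _ ≫ eqToHom (congrArg₂ X.hom (h a) (h b)), ?_, ?_⟩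
  · exact (Category.assoc _ _ _).symm.trans (hom_congr (IsIso.hom_inv_id f) a b)
  · rw [Category.assoc, eqToHom_hom f (h a) (h b)]
    exact (Category.assoc _ _ _).symm.trans (hom_congr (IsIso.inv_hom_id f) (f.obj a) (f.obj b))

instance (U : V ⥤ W) [U.ReflectsIsomorphisms] : (EGraph.map U).ReflectsIsomorphisms where
  reflects {X Y} f hf := by
    refine isIso_of_bijective f (bijective_of_isIso ((EGraph.map U).map f)) fun a b => ?_
    have : IsIso (U.map (f.hom a b)) := isIso_hom ((EGraph.map U).map f) a b
    exact isIso_of_reflects_iso _ U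

end EGraph

/-! ### Monadicity of categories over an operad, over graphs enriched in the base. -/

section

variable {V : Type u} [Category.{v} V] [HasFiniteProducts V] [HasCoproducts.{v} V]
  [DistribCoprod V] {G : Type u'} [Category.{v} G] {U : V ⥤ G} {F : G ⥤ V}

/-- The free category over an operad on a graph enriched in `G`. -/
noncomputable def globAdjunction (B : NSOperad V) (adj : F ⊣ U) :
    EGraph.map F ⋙ FreeOpCat.functor B ⊣ OpCat.forget B ⋙ EGraph.map U :=
  (EGraph.mapAdjunction adj).comp (FreeOpCat.adjunction B)

/-- The unit of the adjunction `globAdjunction`. -/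
noncomputable def globUnit (B : NSOperad V) (adj : F ⊣ U) (A : EGraph G) :
    A ⟶ (EGraph.map U).obj (FreeOpCat.graph B ((EGraph.map F).obj A)) :=
  ⟨id, fun a b => adj.unit.app (A.hom a b) ≫
    U.map ((FreeOpCat.unit B ((EGraph.map F).obj A)).hom a b)⟩

/-- The counit of the adjunction `globAdjunction`. -/
noncomputable def globCounit (B : NSOperad V) (adj : F ⊣ U) (X : OpCat B) :
    FreeOpCat.free B ((EGraph.map F).obj ((EGraph.map U).obj X.toEGraph)) ⟶ X :=
  FreeOpCat.hat X ⟨id, fun a b => adj.counit.app (X.hom a b)⟩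

lemma globAdjunction_unit (B : NSOperad V) (adj : F ⊣ U) (A : EGraph G) :
    (globAdjunction B adj).unit.app A = globUnit B adj A := by
  rw [globAdjunction, Adjunction.comp_unit_app]
  exact congrArg (fun t => (EGraph.mapAdjunction adj).unit.app A ≫ (EGraph.map U).map t)
    (FreeOpCat.adjunction_unit ((EGraph.map F).obj A))

lemma globAdjunction_counit (B : NSOperad V) (adj : F ⊣ U) (X : OpCat B) :
    (globAdjunction B adj).counit.app X = globCounit B adj X := by
  rw [globAdjunction, Adjunction.comp_counit_app]
  refine ((FreeOpCat.adjunction B).homEquiv_counit _ _ _).symm.trans ?_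
  rw [FreeOpCat.homEquiv_adjunction]
  rfl

/-- Beck's criterion asks for coequalizers of the canonical pairs of algebras. Such a pair is the
identity on objects and splits on each hom after applying `U`, so the quotient category
`OpCat.SplitFork.quot` is the coequalizer required, both upstairs and on underlying graphs. -/
lemma isEquivalence_comparison_opCat (B : NSOperad V) (adj : F ⊣ U)
    [(Monad.comparison adj).IsEquivalence] [PreservesFiniteProducts U] :
    (Monad.comparison (globAdjunction B adj)).IsEquivalence := by
  let hU : MonadicRightAdjoint U := ⟨F, adj, inferInstance⟩
  have := reflectsIsomorphisms_of_monadic U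
  have : (OpCat.forget B ⋙ EGraph.map U).ReflectsIsomorphisms := inferInstance
  refine isEquivalence_comparison (globAdjunction B adj) (globUnit B adj) (globCounit B adj)
    (globAdjunction_unit B adj) (globAdjunction_counit B adj) ?_
  rintro ⟨O, H⟩ ⟨ao, ah⟩ h1 h2
  -- The unit of the adjunction is the identity on objects, so the unit law forces the structure map
  -- to be the identity on objects.
  obtain rfl : ao = id := funext fun x => congrArg
    (fun t : (⟨O, H⟩ : EGraph G) ⟶ ⟨O, H⟩ => EGraph.Hom.obj t x) h1
  let A : EGraph G := ⟨O, H⟩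
  let FA : EGraph V := (EGraph.map F).obj A
  let T : EGraph G := (EGraph.map U).obj (FreeOpCat.graph B FA)
  let FT : EGraph V := (EGraph.map F).obj T
  let Y : OpCat B := FreeOpCat.free B FA
  let X : OpCat B := FreeOpCat.free B FT
  let a : T ⟶ A := ⟨id, ah⟩
  let f : X ⟶ Y := (FreeOpCat.functor B).map ((EGraph.map F).map a)
  let g : X ⟶ Y := globCounit B adj Y
  have h1' : ∀ x y, (globUnit B adj A).hom x y ≫ a.hom x y = 𝟙 _ := fun x y => by
    have := EGraph.hom_congr h1 x y
    exact (Category.comp_id _).symm.trans this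
  have h2' : ∀ x y, U.map ((OpCat.Hom.graph f).hom x y) ≫ a.hom x y =
      U.map ((OpCat.Hom.graph g).hom x y) ≫ a.hom x y := fun x y => by
    have := EGraph.hom_congr h2 x y
    exact (Category.comp_id _).symm.trans this
  have h3 : ∀ x y, (globUnit B adj T).hom x y ≫ U.map ((OpCat.Hom.graph g).hom x y) = 𝟙 _ := by
    intro x y
    have := (globAdjunction B adj).right_triangle_components Y
    rw [globAdjunction_unit, globAdjunction_counit] at this
    exact (Category.comp_id _).symm.trans (EGraph.hom_congr this x y)
  have h4 : ∀ x y, (globUnit B adj T).hom x y ≫ U.map ((OpCat.Hom.graph f).hom x y) =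
      a.hom x y ≫ (globUnit B adj A).hom x y := by
    intro x y
    have := (globAdjunction B adj).unit.naturality a
    rw [globAdjunction_unit, globAdjunction_unit] at this
    exact (EGraph.hom_congr this.symm x y).symm.trans (Category.comp_id _) |>.symm
  -- On each hom the structure map is the split quotient, and the units at `A` and at `T` are its
  -- sections.
  choose Z e he using fun x y => exists_isSplitFork U ((OpCat.Hom.graph f).hom x y)
    ((OpCat.Hom.graph g).hom x y) (a.hom x y) ((globUnit B adj A).hom x y)
    ((globUnit B adj T).hom x y) (h2' x y) (h1' x y) (h3 x y) (h4 x y)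
  let S : OpCat.SplitFork U Y :=
    { src := X.hom
      op := fun p _ x k => X.op p x k
      f := (OpCat.Hom.graph f).hom
      g := (OpCat.Hom.graph g).hom
      tgt := Z
      e := e
      op_f := fun p _ x k => OpCat.Hom.comm f p x k
      op_g := fun p _ x k => OpCat.Hom.comm g p x k
      fork := he }
  have w : f ≫ S.proj = g ≫ S.proj := OpCat.hom_ext (EGraph.hom_ext (fun _ => rfl) fun x y =>
    (Category.comp_id _).trans (he x y).w)
  refine ⟨S.quot, S.proj, ⟨w, fun W k hk => S.existsUnique k fun x y => ?_⟩, ⟨?_, fun W k hk =>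
    S.existsUnique_map k fun x y => ?_⟩⟩
  · have := EGraph.hom_congr (congrArg OpCat.Hom.graph hk) x y
    exact (Category.comp_id _).symm.trans this
  · refine Eq.trans ?_ ((congrArg (OpCat.forget B ⋙ EGraph.map U).map w).trans ?_)
    · exact ((OpCat.forget B ⋙ EGraph.map U).map_comp _ _).symm
    · exact (OpCat.forget B ⋙ EGraph.map U).map_comp _ _
  · have := EGraph.hom_congr hk x y
    exact (Category.comp_id _).symm.trans this

end

/-! ### Comparison of two adjunctions over the same base -/

namespace AdjComparison

universe v₀ u₀

variable {G : Type u} [Category.{v} G] {V : Type u'} [Category.{v} V] {V₀ : Type u₀}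
  [Category.{v₀} V₀] {F : G ⥤ V} {U : V ⥤ G} (adj : F ⊣ U) {F₀ : G ⥤ V₀} {U₀ : V₀ ⥤ G}
  (adj₀ : F₀ ⊣ U₀) {K : V₀ ⥤ V} (κ : K ⋙ U ≅ U₀)

/-- The comparison of free objects. -/
noncomputable def θ (X : G) : F.obj X ⟶ K.obj (F₀.obj X) :=
  (adj.homEquiv X _).symm (adj₀.unit.app X ≫ κ.inv.app (F₀.obj X))

lemma unit_θ (X : G) : adj.unit.app X ≫ U.map (θ adj adj₀ κ X) =
    adj₀.unit.app X ≫ κ.inv.app (F₀.obj X) :=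
  (adj.homEquiv_unit _ _ _).symm.trans (Equiv.apply_symm_apply _ _)

lemma hom_ext {X : G} {Z : V} {f g : F.obj X ⟶ Z}
    (h : adj.unit.app X ≫ U.map f = adj.unit.app X ≫ U.map g) : f = g :=
  (adj.homEquiv X Z).injective (by rw [adj.homEquiv_unit, adj.homEquiv_unit, h])

/-- The comparison of the underlying objects of free objects. -/
noncomputable def φ (X : G) : U.obj (F.obj X) ⟶ U₀.obj (F₀.obj X) :=
  U.map (θ adj adj₀ κ X) ≫ κ.hom.app (F₀.obj X)

lemma φ_inv (X : G) : φ adj adj₀ κ X ≫ κ.inv.app (F₀.obj X) = U.map (θ adj adj₀ κ X) := by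
  rw [φ, Category.assoc, Iso.hom_inv_id_app]
  exact Category.comp_id _

lemma unit_φ (X : G) : adj.unit.app X ≫ φ adj adj₀ κ X = adj₀.unit.app X := by
  rw [φ, ← Category.assoc, unit_θ, Category.assoc, Iso.inv_hom_id_app]
  exact Category.comp_id _

lemma map_κ {A B : V₀} (f : A ⟶ B) :
    U.map (K.map f) ≫ κ.hom.app B = κ.hom.app A ≫ U₀.map f := κ.hom.naturality f

lemma map_κ_inv {A B : V₀} (f : A ⟶ B) :
    κ.inv.app A ≫ U.map (K.map f) = U₀.map f ≫ κ.inv.app B := (κ.inv.naturality f).symm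

lemma θ_naturality {X Y : G} (f : X ⟶ Y) :
    F.map f ≫ θ adj adj₀ κ Y = θ adj adj₀ κ X ≫ K.map (F₀.map f) := by
  refine hom_ext adj ?_
  have h1 := adj.unit.naturality f
  have h2 := adj₀.unit.naturality f
  dsimp only [Functor.id_map, Functor.comp_map] at h1 h2
  have h1' : f ≫ adj.unit.app Y = adj.unit.app X ≫ U.map (F.map f) := h1
  have h2' : f ≫ adj₀.unit.app Y = adj₀.unit.app X ≫ U₀.map (F₀.map f) := h2
  rw [U.map_comp, U.map_comp]
  refine (Category.assoc _ _ _).symm.trans ((congrArg (· ≫ _) h1'.symm).trans ?_)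
  refine (Category.assoc _ _ _).trans ((congrArg (f ≫ ·) (unit_θ adj adj₀ κ Y)).trans ?_)
  refine Eq.trans ?_ ((congrArg (· ≫ _) (unit_θ adj adj₀ κ X)).symm.trans (Category.assoc _ _ _))
  refine (Category.assoc _ _ _).symm.trans ((congrArg (· ≫ _) h2').trans ?_)
  refine (Category.assoc _ _ _).trans (Eq.trans ?_ (Category.assoc _ _ _).symm)
  exact congrArg (adj₀.unit.app X ≫ ·) (map_κ_inv κ (F₀.map f)).symm

/-- Compatibility with counits, which gives compatibility of `φ` with the multiplications. After
transposing, both sides reduce by the triangle identities to `U.map (θ adj adj₀ κ X)`. -/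
lemma counit_θ (X : G) : adj.counit.app (F.obj X) ≫ θ adj adj₀ κ X =
    F.map (φ adj adj₀ κ X) ≫ θ adj adj₀ κ (U₀.obj (F₀.obj X)) ≫
      K.map (adj₀.counit.app (F₀.obj X)) := by
  refine hom_ext adj ?_
  have h1 : adj.unit.app (U.obj (F.obj X)) ≫ U.map (adj.counit.app (F.obj X)) = 𝟙 _ :=
    adj.right_triangle_components _
  have h1' : adj₀.unit.app (U₀.obj (F₀.obj X)) ≫ U₀.map (adj₀.counit.app (F₀.obj X)) = 𝟙 _ :=
    adj₀.right_triangle_components _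
  have h2 : φ adj adj₀ κ X ≫ adj.unit.app _ =
    adj.unit.app _ ≫ U.map (F.map (φ adj adj₀ κ X)) := adj.unit.naturality _
  rw [U.map_comp, U.map_comp, U.map_comp]
  refine (Category.assoc _ _ _).symm.trans ((congrArg (· ≫ _) h1).trans ?_)
  refine (Category.id_comp _).trans (Eq.trans ?_ (Category.assoc _ _ _))
  refine Eq.trans ?_ (congrArg (· ≫ _) h2)
  refine Eq.trans ?_ (Category.assoc _ _ _).symm
  refine (φ_inv adj adj₀ κ X).symm.trans (congrArg (φ adj adj₀ κ X ≫ ·) ?_)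
  refine Eq.trans ?_ (Category.assoc _ _ _)
  refine Eq.trans ?_ (congrArg (· ≫ _) (unit_θ adj adj₀ κ _).symm)
  refine Eq.trans ?_ (Category.assoc _ _ _).symm
  refine Eq.trans ?_ (congrArg (adj₀.unit.app _ ≫ ·) (map_κ_inv κ _).symm)
  refine Eq.trans ?_ (Category.assoc _ _ _)
  exact ((congrArg (· ≫ _) h1').trans (Category.id_comp _)).symm

lemma φ_naturality {X Y : G} (f : X ⟶ Y) :
    U.map (F.map f) ≫ φ adj adj₀ κ Y = φ adj adj₀ κ X ≫ U₀.map (F₀.map f) := by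
  rw [φ, φ, ← Category.assoc, ← U.map_comp, θ_naturality, U.map_comp, Category.assoc, map_κ,
    Category.assoc]

/-- The comparison of the monads of two adjunctions. -/
noncomputable def monadHom : adj.toMonad ⟶ adj₀.toMonad :=
  { app := φ adj adj₀ κ
    naturality := fun X Y f => φ_naturality adj adj₀ κ f
    app_η := fun X => unit_φ adj adj₀ κ X
    app_μ := fun X => by
      change U.map (adj.counit.app (F.obj X)) ≫ φ adj adj₀ κ X =
        (U.map (F.map (φ adj adj₀ κ X)) ≫ φ adj adj₀ κ (U₀.obj (F₀.obj X))) ≫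
          U₀.map (adj₀.counit.app (F₀.obj X))
      rw [φ, ← Category.assoc, ← U.map_comp, counit_θ, U.map_comp, U.map_comp]
      rw [Category.assoc, Category.assoc, Category.assoc]
      refine congrArg (U.map (F.map (φ adj adj₀ κ X)) ≫ ·) (Eq.trans ?_ (Category.assoc _ _ _).symm)
      exact congrArg (U.map (θ adj adj₀ κ _) ≫ ·) (map_κ κ (adj₀.counit.app (F₀.obj X))) }

end AdjComparison

/-- A functor with a monadic comparison exhibits its source as a category of algebras. -/
lemma isAlgebrasOf_toMonad {G : Type u} [Category.{v} G] {V : Type u'} [Category.{v} V]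
    {F : G ⥤ V} {U : V ⥤ G} (adj : F ⊣ U) [(Monad.comparison adj).IsEquivalence] :
    IsAlgebrasOf adj.toMonad U :=
  ⟨(Monad.comparison adj).asEquivalence, ⟨Monad.comparisonForget adj⟩⟩

/-! ### Categories over the terminal operad -/

namespace OpCat

variable {V : Type u} [Category.{v} V] [HasFiniteProducts V]

/-- The restriction of the action of an operad whose objects of operations are terminal along
the map from another operad. -/
noncomputable def restrictObj (B : NSOperad V) {B' : NSOperad V} (h : ∀ n, IsTerminal (B'.obj n))
    (X : OpCat B') : OpCat B :=
  ofOp X.toEGraph (fun p Z x f => X.op p ((h _).from Z) f)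
    (fun p Z Z' w x f => (X.comp_op _ _ _ _).trans
      (congrArg (fun t => X.op p t _) ((h _).hom_ext _ _)))
    (fun p Z f => (congrArg (fun t => X.op p t f) ((h _).hom_ext _ _)).trans (X.op_one p f))
    (fun p q r hr Z x y f g hg => (congrArg (fun t => X.op r t g) ((h _).hom_ext _ _)).trans
      (X.op_comp p q r hr ((h _).from Z) (fun i => (h _).from Z) f g hg))

lemma restrictObj_op (B : NSOperad V) {B' : NSOperad V} (h : ∀ n, IsTerminal (B'.obj n))
    (X : OpCat B') {n : ℕ} {a b : X.obj} (p : Chain X.obj n a b) {Z : V} (x : Z ⟶ B.obj n)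
    (f : ∀ i, Z ⟶ X.hom (p.src i) (p.tgt i)) :
    (restrictObj B h X).op (n := n) (a := a) (b := b) p x f = X.op p ((h n).from Z) f :=
  ofOp_op (A := B) X.toEGraph (fun p Z x f => X.op p ((h _).from Z) f) _ _ _
    (n := n) (a := a) (b := b) p x f

/-- Categories over an operad whose objects of operations are terminal are categories over every
other operad. -/
noncomputable def restrict (B : NSOperad V) {B' : NSOperad V} (h : ∀ n, IsTerminal (B'.obj n)) :
    OpCat B' ⥤ OpCat B where
  obj X := restrictObj B h X
  map {X Y} f :=
    { graph := (forget B').map f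
      comm := fun p Z x g => (congrArg (· ≫ _) (restrictObj_op B h X p x g)).trans
        ((Hom.comm f p _ g).trans (restrictObj_op B h Y _ x _).symm) }
  map_id X := rfl
  map_comp f g := rfl

instance (B : NSOperad V) {B' : NSOperad V} (h : ∀ n, IsTerminal (B'.obj n)) :
    PreservesFiniteProducts (restrict B h) :=
  haveI : PreservesFiniteProducts (restrict B h ⋙ forget B) :=
    inferInstanceAs (PreservesFiniteProducts (forget B'))
  preservesFiniteProducts_of_reflects_of_preserves _ (forget B)

variable {V₀ : Type u'} [Category.{v} V₀] [HasFiniteProducts V₀] (K : V₀ ⥤ V)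
  [PreservesFiniteProducts K]

/-- The objects of operations of the image of the terminal operad are terminal. -/
noncomputable def isTerminalMapTerminal (n : ℕ) :
    IsTerminal (((NSOperad.terminal V₀).map K).obj n) :=
  IsTerminal.isTerminalObj K _ terminalIsTerminal

/-- The functor from categories over the terminal operad to categories over `B` induced by a
product preserving functor. -/
noncomputable def ofTerminal (B : NSOperad V) : OpCat (NSOperad.terminal V₀) ⥤ OpCat B :=
  mapOp K ⋙ restrict B (isTerminalMapTerminal K)

instance (B : NSOperad V) : PreservesFiniteProducts (ofTerminal K B) :=
  inferInstanceAs (PreservesFiniteProducts (_ ⋙ _))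

/-- The label `x` from `B` is ignored: any two elements of the image of a terminal object of
operations agree. -/
lemma ofTerminal_op (B : NSOperad V) (X : OpCat (NSOperad.terminal V₀)) {Z : V} {Z' : V₀}
    (w : Z ⟶ K.obj Z') {n : ℕ} {a b : X.obj} (p : Chain X.obj n a b) (x : Z ⟶ B.obj n)
    {f : ∀ i, Z ⟶ K.obj (X.hom (p.src i) (p.tgt i))}
    (x₀ : Z' ⟶ (NSOperad.terminal V₀).obj n) {f₀ : ∀ i, Z' ⟶ X.hom (p.src i) (p.tgt i)}
    (hf : ∀ i, f i = w ≫ K.map (f₀ i)) :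
    ((ofTerminal K B).obj X).op (n := n) (a := a) (b := b) p x f = w ≫ K.map (X.op p x₀ f₀) :=
  (restrictObj_op B (isTerminalMapTerminal K) ((mapOp K).obj X)
    (n := n) (a := a) (b := b) p x f).trans
    (map_act_elem K X w p ((isTerminalMapTerminal K n).hom_ext _ _) hf)

end OpCat

namespace EGraph

/-- Applying isomorphic functors to all homs gives isomorphic functors. -/
def mapIso {V : Type u} [Category.{v} V] {W : Type u'} [Category.{v} W] {F F' : V ⥤ W}
    (κ : F ≅ F') : EGraph.map F ≅ EGraph.map F' where
  hom :=
    { app := fun X => ⟨id, fun a b => κ.hom.app (X.hom a b)⟩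
      naturality := fun X Y f => hom_ext (fun _ => rfl) fun a b =>
        (Category.comp_id _).trans (κ.hom.naturality (f.hom a b)) }
  inv :=
    { app := fun X => ⟨id, fun a b => κ.inv.app (X.hom a b)⟩
      naturality := fun X Y f => hom_ext (fun _ => rfl) fun a b =>
        (Category.comp_id _).trans (κ.inv.naturality (f.hom a b)) }
  hom_inv_id := NatTrans.ext (funext fun X => hom_ext (fun _ => rfl) fun a b =>
    (Category.comp_id _).trans (κ.hom_inv_id_app (X.hom a b)))
  inv_hom_id := NatTrans.ext (funext fun X => hom_ext (fun _ => rfl) fun a b =>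
    (Category.comp_id _).trans (κ.inv_hom_id_app (X.hom a b)))

end EGraph

/-- The functor `OpCat.ofTerminal` is compatible with the forgetful functors. -/
noncomputable def ofTerminalForget {V : Type u} [Category.{v} V] [HasFiniteProducts V]
    {V₀ : Type u} [Category.{v} V₀] [HasFiniteProducts V₀] {G : Type u'} [Category.{v} G]
    {U : V ⥤ G} {U₀ : V₀ ⥤ G} {K : V₀ ⥤ V} [PreservesFiniteProducts K] (B : NSOperad V)
    (κ : K ⋙ U ≅ U₀) :
    OpCat.ofTerminal K B ⋙ OpCat.forget B ⋙ EGraph.map U ≅ OpCat.forget _ ⋙ EGraph.map U₀ :=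
  (Functor.isoWhiskerLeft (OpCat.forget (NSOperad.terminal V₀)) (EGraph.mapIso κ) :)

/-! ### Comparison of free categories with free categories over the terminal operad -/

namespace GlobComparison

variable {V : Type u} [Category.{v} V] [HasFiniteProducts V] [HasCoproducts.{v} V]
  [DistribCoprod V] {V₀ : Type u} [Category.{v} V₀] [HasFiniteProducts V₀] [HasCoproducts.{v} V₀]
  [DistribCoprod V₀] {G : Type u'} [Category.{v} G] {U : V ⥤ G} {F : G ⥤ V} (B : NSOperad V)
  (adj : F ⊣ U) {U₀ : V₀ ⥤ G} {F₀ : G ⥤ V₀} (adj₀ : F₀ ⊣ U₀) {K : V₀ ⥤ V}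
  [PreservesFiniteProducts K] (κ : K ⋙ U ≅ U₀)

/-- The graph of words over the terminal operad. -/
noncomputable abbrev graph₀ (F₀ : G ⥤ V₀) (X : EGraph G) : EGraph V₀ :=
  FreeOpCat.graph (NSOperad.terminal V₀) ((EGraph.map F₀).obj X)

/-- The morphism of graphs inducing the comparison of free categories. -/
noncomputable def gen (X : EGraph G) :
    (EGraph.map F).obj X ⟶ (EGraph.map K).obj (graph₀ F₀ X) :=
  ⟨id, fun a b => AdjComparison.θ adj adj₀ κ (X.hom a b) ≫
    K.map ((FreeOpCat.unit (NSOperad.terminal V₀) ((EGraph.map F₀).obj X)).hom a b)⟩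

/-- The comparison of free categories is the functor induced by sending each letter, compared by the
old `θ`, to a word of length one. Both sides have the same transpose. -/
lemma θ_eq (X : EGraph G) :
    AdjComparison.θ (globAdjunction B adj) (globAdjunction (NSOperad.terminal V₀) adj₀)
      (ofTerminalForget B κ) X =
    FreeOpCat.hat ((OpCat.ofTerminal K B).obj (FreeOpCat.free (NSOperad.terminal V₀)
      ((EGraph.map F₀).obj X))) (gen adj adj₀ κ X) := by
  refine AdjComparison.hom_ext (globAdjunction B adj) ?_
  rw [AdjComparison.unit_θ, globAdjunction_unit, globAdjunction_unit]
  refine EGraph.hom_ext (fun _ => rfl) fun a b => (Category.comp_id _).trans ?_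
  change (adj₀.unit.app _ ≫ U₀.map ((FreeOpCat.unit (NSOperad.terminal V₀) ((EGraph.map F₀).obj X)).hom a b)) ≫
    κ.inv.app _ = (adj.unit.app _ ≫ U.map ((FreeOpCat.unit B ((EGraph.map F).obj X)).hom a b)) ≫
      U.map ((FreeOpCat.hatHom ((OpCat.ofTerminal K B).obj (FreeOpCat.free (NSOperad.terminal V₀)
      ((EGraph.map F₀).obj X))) (gen adj adj₀ κ X)).hom a b)
  have e : (FreeOpCat.unit B ((EGraph.map F).obj X)).hom a b ≫
      (FreeOpCat.hatHom ((OpCat.ofTerminal K B).obj (FreeOpCat.free (NSOperad.terminal V₀)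
      ((EGraph.map F₀).obj X))) (gen adj adj₀ κ X)).hom a b = (gen adj adj₀ κ X).hom a b :=
    (Category.comp_id _).symm.trans (EGraph.hom_congr (FreeOpCat.unit_hat
      ((OpCat.ofTerminal K B).obj (FreeOpCat.free (NSOperad.terminal V₀)
      ((EGraph.map F₀).obj X))) (gen adj adj₀ κ X)) a b)
  refine Eq.trans ?_ (Category.assoc _ _ _).symm
  refine Eq.trans ?_ (congrArg (adj.unit.app _ ≫ ·) (U.map_comp _ _))
  refine Eq.trans ?_ (congrArg (fun t => adj.unit.app _ ≫ U.map t) e.symm)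
  refine Eq.trans ?_ (congrArg (adj.unit.app _ ≫ ·) (U.map_comp _ _).symm)
  refine Eq.trans ?_ (Category.assoc _ _ _)
  refine Eq.trans ?_ (congrArg (· ≫ _) (AdjComparison.unit_θ adj adj₀ κ _).symm)
  refine (Category.assoc _ _ _).trans (Eq.trans ?_ (Category.assoc _ _ _).symm)
  exact congrArg (adj₀.unit.app _ ≫ ·) (AdjComparison.map_κ_inv κ _).symm

section word

variable {X : EGraph G} {k : ℕ} {a b : X.obj} (p : Chain X.obj k a b)

/-- The object of words over `B`. -/
noncomputable abbrev wordB (F : G ⥤ V) {X : EGraph G} {k : ℕ} {a b : X.obj}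
    (p : Chain X.obj k a b) : V :=
  FreeOpCat.word (k := k) (a := a) (b := b) B ((EGraph.map F).obj X) p

/-- The object of words over the terminal operad. -/
noncomputable abbrev word₀ (F₀ : G ⥤ V₀) {X : EGraph G} {k : ℕ} {a b : X.obj}
    (p : Chain X.obj k a b) : V₀ :=
  FreeOpCat.word (k := k) (a := a) (b := b) (NSOperad.terminal V₀) ((EGraph.map F₀).obj X) p

/-- The projections of an object of words. -/
noncomputable def proj (F : G ⥤ V) {X : EGraph G} {k : ℕ} {a b : X.obj} (p : Chain X.obj k a b)
    (i : Fin k) : wordB B F p ⟶ F.obj (X.hom (p.src i) (p.tgt i)) :=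
  prod.snd ≫ Pi.π (fun i => F.obj (X.hom (p.src i) (p.tgt i))) i

lemma isProd_word (F : G ⥤ V) {X : EGraph G} {k : ℕ} {a b : X.obj} (p : Chain X.obj k a b) :
    IsProd (J := Option (Fin k))
      (X := fun o => o.elim (B.obj k) fun i => F.obj (X.hom (p.src i) (p.tgt i)))
      (P := wordB B F p) (fun o => match o with
        | none => prod.fst
        | some i => proj B F p i) :=
  isProd_prod_pi _ _

/-- As `K` preserves products, the maps `θ` on the letters combine; the component on labels is the
map to a terminal object. -/
lemma exists_wordMap : ∃ w : wordB B F p ⟶ K.obj (word₀ F₀ p),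
    ∀ i, proj B F p i ≫ AdjComparison.θ adj adj₀ κ _ =
      w ≫ K.map (proj (NSOperad.terminal V₀) F₀ p i) := by
  obtain ⟨w, hw, -⟩ := (isProd_word (NSOperad.terminal V₀) F₀ p).map K
    (fun o => (match o with
      | none => (OpCat.isTerminalMapTerminal K k).from _
      | some i => proj B F p i ≫ AdjComparison.θ adj adj₀ κ _ :
        wordB B F p ⟶ K.obj (o.elim ((NSOperad.terminal V₀).obj k)
          fun i => F₀.obj (X.hom (p.src i) (p.tgt i)))))
  exact ⟨w, fun i => (hw (some i)).symm⟩

/-- The comparison of objects of words. -/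
noncomputable def wordMap : wordB B F p ⟶ K.obj (word₀ F₀ p) :=
  (exists_wordMap B adj adj₀ κ p).choose

lemma wordMap_proj (i : Fin k) : proj B F p i ≫ AdjComparison.θ adj adj₀ κ _ =
    wordMap B adj adj₀ κ p ≫ K.map (proj (NSOperad.terminal V₀) F₀ p i) :=
  (exists_wordMap B adj adj₀ κ p).choose_spec i

/-- The homs of the free category over `B`. -/
noncomputable abbrev freeHom (F : G ⥤ V) (X : EGraph G) (a b : X.obj) : V :=
  (FreeOpCat.graph B ((EGraph.map F).obj X)).hom a b

/-- The inclusion of words. -/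
noncomputable def inc (F : G ⥤ V) {X : EGraph G} {k : ℕ} {a b : X.obj} (p : Chain X.obj k a b) :
    wordB B F p ⟶ freeHom B F X a b :=
  FreeOpCat.ι (Y := (EGraph.map F).obj X) (a := a) (b := b) p

lemma isCoprod_inc (F : G ⥤ V) {X : EGraph G} (a b : X.obj) :
    IsCoprod fun s : (Σ k, Chain X.obj k a b) => inc B F s.2 :=
  FreeOpCat.isCoprod_ι (B := B) (Y := (EGraph.map F).obj X) a b

lemma inc_eq (F : G ⥤ V) {X : EGraph G} {k : ℕ} {a b : X.obj} (p : Chain X.obj k a b) :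
    inc B F p = FreeOpCat.elem (Y := (EGraph.map F).obj X) (a := a) (b := b) p prod.fst
      (proj B F p) := by
  refine (Category.id_comp _).symm.trans
    ((FreeOpCat.elem_eta (B := B) (Y := (EGraph.map F).obj X) (a := a) (b := b) p (𝟙 _)).trans ?_)
  exact congrArg₂ (FreeOpCat.elem (B := B) (Y := (EGraph.map F).obj X) (a := a) (b := b) p)
    (Category.id_comp _) (funext fun i => Category.id_comp _)

/-- The comparison of homs of free categories. -/
noncomputable def hatK (X : EGraph G) (a b : X.obj) :
    freeHom B F X a b ⟶ K.obj (freeHom (NSOperad.terminal V₀) F₀ X a b) :=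
  (FreeOpCat.hatHom ((OpCat.ofTerminal K B).obj
      (FreeOpCat.free (NSOperad.terminal V₀) ((EGraph.map F₀).obj X))) (gen adj adj₀ κ X)).hom a b

/-- On words along a chain the comparison forgets the label and compares the letters, staying over
the same chain. -/
lemma inc_hatK : inc B F p ≫ hatK B adj adj₀ κ X a b =
    wordMap B adj adj₀ κ p ≫ K.map (inc (NSOperad.terminal V₀) F₀ p) := by
  rw [inc_eq, inc_eq]
  refine (FreeOpCat.elem_hatHom (Y := (EGraph.map F).obj X) _ _ p prod.fst (proj B F p)).trans ?_
  refine (OpCat.ofTerminal_op K B (FreeOpCat.free (NSOperad.terminal V₀) ((EGraph.map F₀).obj X))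
    (a := a) (b := b) (wordMap B adj adj₀ κ p) p prod.fst prod.fst
    (f₀ := fun i => proj (NSOperad.terminal V₀) F₀ p i ≫
      (FreeOpCat.unit (NSOperad.terminal V₀) ((EGraph.map F₀).obj X)).hom _ _) fun i => ?_).trans ?_
  · refine (Category.assoc _ _ _).symm.trans ((congrArg (· ≫ _) (wordMap_proj B adj adj₀ κ p i)).trans
      ((Category.assoc _ _ _).trans (congrArg (wordMap B adj adj₀ κ p ≫ ·) (K.map_comp _ _).symm)))
  · refine congrArg (fun t => wordMap B adj adj₀ κ p ≫ K.map t) ?_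
    refine (FreeOpCat.free_op (Y := (EGraph.map F₀).obj X) (a := a) (b := b) p _ _).trans ?_
    exact (FreeOpCat.elem_eq_op (Y := (EGraph.map F₀).obj X) (a := a) (b := b) p _ _).symm

/-- The comparison of underlying objects of objects of words. -/
noncomputable def ω : U.obj (wordB B F p) ⟶ U₀.obj (word₀ F₀ p) :=
  U.map (wordMap B adj adj₀ κ p) ≫ κ.hom.app _

lemma ω_proj (i : Fin k) : ω B adj adj₀ κ p ≫ U₀.map (proj (NSOperad.terminal V₀) F₀ p i) =
    U.map (proj B F p i) ≫ AdjComparison.φ adj adj₀ κ (X.hom (p.src i) (p.tgt i)) := by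
  rw [ω, Category.assoc, ← AdjComparison.map_κ, ← Category.assoc, ← U.map_comp, ← wordMap_proj,
    U.map_comp, Category.assoc, AdjComparison.φ]

/-- The comparison of the underlying homs of free categories. -/
noncomputable def φHom (X : EGraph G) (a b : X.obj) :
    U.obj (freeHom B F X a b) ⟶ U₀.obj (freeHom (NSOperad.terminal V₀) F₀ X a b) :=
  U.map (hatK B adj adj₀ κ X a b) ≫ κ.hom.app _

/-- The comparison of monads is the identity on objects, so all its properties are properties of
maps of homs. -/
lemma φ_eq (X : EGraph G) :
    AdjComparison.φ (globAdjunction B adj) (globAdjunction (NSOperad.terminal V₀) adj₀)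
      (ofTerminalForget B κ) X = ⟨id, φHom B adj adj₀ κ X⟩ := by
  rw [AdjComparison.φ, θ_eq]
  rfl

/-- Exhibits `φHom` as the coproduct over chains of the maps `ω`, once `U` and `U₀` preserve
coproducts. -/
lemma inc_φHom : U.map (inc B F p) ≫ φHom B adj adj₀ κ X a b =
    ω B adj adj₀ κ p ≫ U₀.map (inc (NSOperad.terminal V₀) F₀ p) := by
  rw [φHom, ← Category.assoc, ← U.map_comp, inc_hatK, ω, U.map_comp, Category.assoc,
    AdjComparison.map_κ, Category.assoc]

end word

/-! The action of morphisms on words. -/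

section map

variable (F) {X X' : EGraph G} (f : X ⟶ X')

/-- The map of objects of words induced by a morphism of graphs. -/
noncomputable def wordOf {k : ℕ} {a b : X.obj} (p : Chain X.obj k a b) :
    wordB B F p ⟶ wordB B F (p.map f.obj) :=
  prod.map (𝟙 _) (Limits.Pi.map fun i => F.map (f.hom (p.src i) (p.tgt i)))

lemma wordOf_fst {k : ℕ} {a b : X.obj} (p : Chain X.obj k a b) :
    wordOf F B f p ≫ prod.fst = prod.fst :=
  (prod.map_fst _ _).trans (Category.comp_id _)

lemma wordOf_proj {k : ℕ} {a b : X.obj} (p : Chain X.obj k a b) (i : Fin k) :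
    wordOf F B f p ≫ proj B F (p.map f.obj) i =
      proj B F p i ≫ F.map (f.hom (p.src i) (p.tgt i)) := by
  refine (prod.map_snd_assoc _ _ _).trans (Eq.trans ?_ (Category.assoc _ _ _).symm)
  exact congrArg (prod.snd ≫ ·) (Pi.map_π _ _)

/-- The map of homs of free categories induced by a morphism of graphs. -/
noncomputable def freeHomMap (a b : X.obj) :
    freeHom B F X a b ⟶ freeHom B F X' (f.obj a) (f.obj b) :=
  (FreeOpCat.hatHom (FreeOpCat.free B ((EGraph.map F).obj X'))
    ((EGraph.map F).map f ≫ FreeOpCat.unit B ((EGraph.map F).obj X'))).hom a b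

lemma functor_map_eq : OpCat.Hom.graph ((EGraph.map F ⋙ FreeOpCat.functor B).map f) =
    ⟨f.obj, freeHomMap F B f⟩ :=
  congrArg OpCat.Hom.graph (FreeOpCat.functor_map ((EGraph.map F).map f))

lemma inc_freeHomMap {k : ℕ} {a b : X.obj} (p : Chain X.obj k a b) :
    inc B F p ≫ freeHomMap F B f a b = wordOf F B f p ≫ inc B F (p.map f.obj) := by
  rw [inc_eq, inc_eq]
  refine (FreeOpCat.elem_hatHom (Y := (EGraph.map F).obj X) _ _ p prod.fst (proj B F p)).trans ?_
  refine Eq.trans ?_ (FreeOpCat.comp_elem (Y := (EGraph.map F).obj X') (a := f.obj a)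
    (b := f.obj b) (p.map f.obj) (wordOf F B f p) prod.fst (proj B F (p.map f.obj))).symm
  refine (FreeOpCat.free_op (Y := (EGraph.map F).obj X') (a := f.obj a) (b := f.obj b)
    (p.map f.obj) _ _).trans ?_
  refine Eq.trans ?_ (FreeOpCat.elem_eq_op (Y := (EGraph.map F).obj X') (a := f.obj a)
    (b := f.obj b) (p.map f.obj) _ _).symm
  refine congrArg₂ (FreeOpCat.op (Y := (EGraph.map F).obj X') (a := f.obj a)
    (b := f.obj b) (p.map f.obj)) (wordOf_fst F B f p).symm (funext fun i => ?_)
  refine (Category.assoc _ _ _).symm.trans (congrArg (· ≫ _) (wordOf_proj F B f p i).symm)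

end map

end GlobComparison

universe w

/-! ### Lifting properties of products and coproducts -/

section

variable {G : Type u} [Category.{v} G]

lemma isPullback_prod {J : Type w} {P Q R S : J → G} {t : ∀ j, P j ⟶ Q j} {l : ∀ j, P j ⟶ R j}
    {r : ∀ j, Q j ⟶ S j} {b : ∀ j, R j ⟶ S j} (h : ∀ j, IsPullback (t j) (l j) (r j) (b j))
    {P' Q' R' S' : G} {p : ∀ j, P' ⟶ P j} {q : ∀ j, Q' ⟶ Q j} {ρ : ∀ j, R' ⟶ R j}
    {s : ∀ j, S' ⟶ S j} (hp : IsProd p) (hq : IsProd q) (hρ : IsProd ρ) (hs : IsProd s)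
    {T : P' ⟶ Q'} {L : P' ⟶ R'} {M : Q' ⟶ S'} {B : R' ⟶ S'} (hT : ∀ j, T ≫ q j = p j ≫ t j)
    (hL : ∀ j, L ≫ ρ j = p j ≫ l j) (hM : ∀ j, M ≫ s j = q j ≫ r j)
    (hB : ∀ j, B ≫ s j = ρ j ≫ b j) : IsPullback T L M B := by
  refine isPullback_of_existsUnique (hs.hom_ext fun j => ?_) fun Z x y hxy => ?_
  · rw [Category.assoc, Category.assoc, hM, hB, ← Category.assoc, ← Category.assoc, hT, hL,
      Category.assoc, Category.assoc, (h j).w]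
  · have e : ∀ j, (x ≫ q j) ≫ r j = (y ≫ ρ j) ≫ b j := fun j => by
      rw [Category.assoc, Category.assoc, ← hM, ← hB, ← Category.assoc, ← Category.assoc, hxy]
    obtain ⟨u, hu, -⟩ := hp fun j => (h j).lift _ _ (e j)
    refine ⟨u, ⟨hq.hom_ext fun j => ?_, hρ.hom_ext fun j => ?_⟩, fun u' h' =>
      hp.hom_ext fun j => (h j).hom_ext ?_ ?_⟩
    · rw [Category.assoc, hT, ← Category.assoc, hu, IsPullback.lift_fst]
    · rw [Category.assoc, hL, ← Category.assoc, hu, IsPullback.lift_snd]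
    · rw [hu, IsPullback.lift_fst, Category.assoc, ← hT, ← Category.assoc, h'.1]
    · rw [hu, IsPullback.lift_snd, Category.assoc, ← hL, ← Category.assoc, h'.2]

lemma hasLiftingProperty_of_exists {S D X Y : G} {i : S ⟶ D} {f : X ⟶ Y}
    (h : ∀ (s : S ⟶ X) (d : D ⟶ Y), s ≫ f = i ≫ d → ∃ l : D ⟶ X, i ≫ l = s ∧ l ≫ f = d) :
    HasLiftingProperty i f :=
  ⟨fun {s d} sq => by
    obtain ⟨l, h1, h2⟩ := h s d sq.w
    exact ⟨⟨⟨l, h1, h2⟩⟩⟩⟩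

lemma exists_lift {S D X Y : G} {i : S ⟶ D} {f : X ⟶ Y} (h : HasLiftingProperty i f) (s : S ⟶ X)
    (d : D ⟶ Y) (w : s ≫ f = i ≫ d) : ∃ l : D ⟶ X, i ≫ l = s ∧ l ≫ f = d :=
  have sq : CommSq s i f d := ⟨w⟩
  ⟨sq.lift, sq.fac_left, sq.fac_right⟩

lemma hasLiftingProperty_of_isTerminal {S D X T T' : G} {i : S ⟶ D} {f : X ⟶ T} {f' : X ⟶ T'}
    (hT : IsTerminal T) (hT' : IsTerminal T') (h : HasLiftingProperty i f) :
    HasLiftingProperty i f' :=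
  hasLiftingProperty_of_exists fun s d _ => by
    obtain ⟨l, h1, -⟩ := exists_lift h s (hT.from D) (hT.hom_ext _ _)
    exact ⟨l, h1, hT'.hom_ext _ _⟩

lemma hasLiftingProperty_prod {S D : G} {i : S ⟶ D} {J : Type w} {P Q : J → G}
    {l : ∀ j, P j ⟶ Q j} (h : ∀ j, HasLiftingProperty i (l j)) {P' Q' : G} {p : ∀ j, P' ⟶ P j}
    {q : ∀ j, Q' ⟶ Q j} (hp : IsProd p) (hq : IsProd q) {L : P' ⟶ Q'}
    (hL : ∀ j, L ≫ q j = p j ≫ l j) : HasLiftingProperty i L :=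
  hasLiftingProperty_of_exists fun s d w => by
    choose g hg hg' using fun j => exists_lift (h j) (s ≫ p j) (d ≫ q j) (by
      rw [Category.assoc, ← hL, ← Category.assoc, w, Category.assoc])
    obtain ⟨u, hu, -⟩ := hp g
    refine ⟨u, hp.hom_ext fun j => ?_, hq.hom_ext fun j => ?_⟩
    · rw [Category.assoc, hu, hg]
    · rw [Category.assoc, hL, ← Category.assoc, hu, hg']

/-- Every morphism from the object to a coproduct factors through one of the summands. -/
def IsConnectedObj (D : G) : Prop :=
  ∀ ⦃J : Type v⦄ ⦃X : J → G⦄ ⦃P : G⦄ (m : ∀ j, X j ⟶ P), IsCoprod m →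
    ∀ f : D ⟶ P, ∃ j, ∃ g : D ⟶ X j, g ≫ m j = f

lemma isConnectedObj_of_exists {D : G}
    (h : ∀ {J : Type v} (X : J → G), ∃ (P : G) (m : ∀ j, X j ⟶ P), IsCoprod m ∧
      ∀ f : D ⟶ P, ∃ j, ∃ g : D ⟶ X j, g ≫ m j = f) : IsConnectedObj D := by
  intro J X P m hm f
  obtain ⟨P', m', hm', h'⟩ := h X
  obtain ⟨e, he⟩ := hm.exists_iso hm'
  obtain ⟨j, g, hg⟩ := h' (f ≫ e.hom)
  refine ⟨j, g, (cancel_mono e.hom).1 ?_⟩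
  rw [Category.assoc, he, hg]

/-- A map to the empty coproduct would have to factor through one of its summands. -/
lemma IsConnectedObj.isEmpty_hom {D I : G} (h : IsConnectedObj D) (hI : IsInitial I) :
    IsEmpty (D ⟶ I) :=
  ⟨fun f => by
    obtain ⟨j, -⟩ := h (J := PEmpty) (X := fun j => j.elim) (P := I) (fun j => j.elim)
      (fun W g => ⟨hI.to W, fun i => i.elim, fun u _ => hI.hom_ext _ _⟩) f
    exact j.elim⟩

lemma isConnectedObj_type (D : Type v) [Unique D] : IsConnectedObj D :=
  isConnectedObj_of_exists fun X => ⟨Σ j, X j, fun j => ↾fun x => ⟨j, x⟩, fun W f =>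
    ⟨↾fun x => f x.1 x.2, fun j => rfl, fun u hu => by
      ext x
      exact ConcreteCategory.congr_hom (hu x.1) x.2⟩, fun f =>
    ⟨(f default).1, ↾fun _ => (f default).2, ConcreteCategory.hom_ext _ _ fun x => by
      obtain rfl := Unique.eq_default x
      rfl⟩⟩

/-- By connectedness the map from `D` lands in one summand `Q j`. The part of `P'` over this summand
is `P j`, so the problem becomes a lifting problem against `l j`. -/
lemma hasLiftingProperty_coprod [HasPullbacks G] [HasCells G] {S D : G} {i : S ⟶ D}
    (hD : IsConnectedObj D) {J : Type v} {P Q : J → G} {l : ∀ j, P j ⟶ Q j}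
    (h : ∀ j, HasLiftingProperty i (l j)) {P' Q' : G} {p : ∀ j, P j ⟶ P'} {q : ∀ j, Q j ⟶ Q'}
    (hp : IsCoprod p) (hq : IsCoprod q) {L : P' ⟶ Q'} (hL : ∀ j, p j ≫ L = l j ≫ q j) :
    HasLiftingProperty i L :=
  hasLiftingProperty_of_exists fun s d w => by
    obtain ⟨j, d, rfl⟩ := hD q hq d
    obtain ⟨ι, Φ, hΦ⟩ := HasCells.out (V := G)
    have hone : ∀ X : G, IsCoprod fun _ : PUnit.{v + 1} => 𝟙 X := fun X W f =>
      ⟨f ⟨⟩, fun _ => Category.id_comp _, fun u hu => (Category.id_comp _).symm.trans (hu ⟨⟩)⟩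
    -- A single summand is treated as a coproduct indexed by a point, included into the full
    -- coproduct along the index `j`.
    have sq : IsPullback (p j) (l j) L (q j) := by
      refine hΦ.isPullback_coprod (I := PUnit) (fun _ => j) (t := fun _ => 𝟙 (P j))
        (l := fun _ => l j) (r := l) (b := fun _ => 𝟙 (Q j))
        (fun _ => IsPullback.of_horiz_isIso ⟨by simp⟩) (hone _) hp (hone _) hq
        (fun _ => rfl) (fun _ => ?_) hL (fun _ => rfl)
      rw [Category.id_comp, Category.comp_id]
    obtain ⟨g, h1, h2⟩ := exists_lift (h j) (sq.lift s (i ≫ d) (by rw [w, Category.assoc])) d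
      (sq.lift_snd _ _ _)
    refine ⟨g ≫ p j, ?_, ?_⟩
    · rw [← Category.assoc, h1, sq.lift_fst]
    · rw [Category.assoc, hL, ← Category.assoc, h2]

end

/-! ### Lifting properties and connectedness for enriched graphs. -/

namespace EGraph

variable {V : Type u} [Category.{v} V] [HasInitial V]

/-- The morphism out of a graph with a single non-initial hom given by its value on this hom. -/
noncomputable def edgeDesc {Z : V} {X : EGraph V} (o : ULift.{v} Bool → X.obj)
    (h : Z ⟶ X.hom (o ⟨false⟩) (o ⟨true⟩)) : edge Z ⟶ X where
  obj := o
  hom a b := match a, b with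
    | ⟨false⟩, ⟨true⟩ => h
    | ⟨false⟩, ⟨false⟩ => initial.to (C := V) _
    | ⟨true⟩, ⟨false⟩ => initial.to (C := V) _
    | ⟨true⟩, ⟨true⟩ => initial.to (C := V) _

/-- The value of a morphism out of a graph with a single non-initial hom on this hom. -/
def edgeHom {Z : V} {X : EGraph V} (f : edge Z ⟶ X) :
    Z ⟶ X.hom (f.obj ⟨false⟩) (f.obj ⟨true⟩) := f.hom ⟨false⟩ ⟨true⟩

lemma edge_hom_ext {Z : V} {X : EGraph V} {f g : edge Z ⟶ X} (ho : ∀ a, f.obj a = g.obj a)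
    (h : edgeHom f ≫ eqToHom (congrArg₂ X.hom (ho _) (ho _)) = edgeHom g) : f = g := by
  refine hom_ext ho fun a b => ?_
  obtain ⟨_ | _⟩ := a <;> obtain ⟨_ | _⟩ := b
  · exact initialIsInitial.hom_ext (Y := X.hom _ _) _ _
  · exact h
  · exact initialIsInitial.hom_ext (Y := X.hom _ _) _ _
  · exact initialIsInitial.hom_ext (Y := X.hom _ _) _ _

/-- The morphism out of a graph with one object and initial hom. -/
noncomputable def pointDesc {X : EGraph V} (x : X.obj) : point V ⟶ X :=
  ⟨fun _ => x, fun _ _ => initial.to _⟩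

lemma point_hom_ext {X : EGraph V} {f g : point V ⟶ X} (h : f.obj ⟨⟩ = g.obj ⟨⟩) : f = g :=
  hom_ext (fun _ => h) fun _ _ => initialIsInitial.hom_ext _ _

/-- A morphism of graphs lifts against `EGraph.plus I` if it is surjective on objects and its
hom maps lift against `I`. -/
lemma rlp_plus {I : MorphismProperty V} {X Y : EGraph V} (f : X ⟶ Y)
    (ho : Function.Surjective f.obj) (hh : ∀ a b, I.rlp (f.hom a b)) : (plus I).rlp f := by
  rintro S D j (_ | ⟨i, hi⟩)
  · refine hasLiftingProperty_of_exists fun s d w => ?_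
    obtain ⟨x, hx⟩ := ho (d.obj ⟨⟩)
    exact ⟨pointDesc x, initialIsInitial.hom_ext _ _, point_hom_ext hx⟩
  · refine hasLiftingProperty_of_exists fun s d w => ?_
    have e : ∀ a, f.obj (s.obj a) = d.obj a := fun a => obj_congr w a
    obtain ⟨l, h1, h2⟩ := exists_lift (hh _ _ i hi) (edgeHom s)
      (edgeHom d ≫ eqToHom (congrArg₂ (EGraph.hom _) (e _).symm (e _).symm)) (by
        rw [← Category.assoc]
        have := hom_congr w.symm ⟨false⟩ ⟨true⟩
        exact this.symm)
    -- The two graphs have the same objects, so the object map is that of `s`; only the map on the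
    -- one non-initial hom has to be found.
    refine ⟨edgeDesc s.obj l, edge_hom_ext (fun _ => rfl) ?_, edge_hom_ext e ?_⟩
    · exact (Category.comp_id _).trans h1
    · refine (congrArg (· ≫ _) h2).trans ((Category.assoc _ _ _).trans ?_)
      exact (congrArg (edgeHom d ≫ ·) ((eqToHom_trans _ _).trans (eqToHom_refl _ rfl))).trans
        (Category.comp_id _)

lemma isConnectedObj_point : IsConnectedObj (point V) :=
  isConnectedObj_of_exists fun X => ⟨_, _, (isSum_sumι X).isCoprod, fun f =>
    ⟨(f.obj ⟨⟩).1, pointDesc (f.obj ⟨⟩).2, point_hom_ext rfl⟩⟩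

/-- If the two objects went to different summands, `D` would map to an initial hom, which a
connected object cannot do. -/
lemma isConnectedObj_edge {D : V} (hD : IsConnectedObj D) : IsConnectedObj (edge D) :=
  isConnectedObj_of_exists fun {J} X => ⟨_, _, (isSum_sumι X).isCoprod, fun f => by
    have h := isSum_sumι X
    let o := f.obj
    have key : ∀ (x y : Σ j, (X j).obj) (g : D ⟶ (sum X).hom x y),
        ∃ (j : J) (a b : (X j).obj) (ha : (sumι X j).obj a = x) (hb : (sumι X j).obj b = y)
          (g' : D ⟶ (X j).hom a b),
          (g' ≫ (sumι X j).hom a b) ≫ eqToHom (congrArg₂ (sum X).hom ha hb) = g := by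
      rintro ⟨j, a⟩ ⟨j', b⟩ g
      by_cases hj : j = j'
      · subst hj
        obtain ⟨t, -, ht⟩ := (h.iso j a b).out
        refine ⟨j, a, b, rfl, rfl, g ≫ t, (Category.comp_id _).trans ?_⟩
        exact (Category.assoc _ _ _).trans ((congrArg (g ≫ ·) ht).trans (Category.comp_id _))
      · exact ((hD.isEmpty_hom (h.initial j j' a b hj).some).false g).elim
    obtain ⟨j, a, b, ha, hb, g', hg'⟩ := key _ _ (edgeHom f)
    refine ⟨j, edgeDesc (fun t => if t.down then b else a) g', edge_hom_ext ?_ ?_⟩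
    · rintro ⟨_ | _⟩
      · exact ha
      · exact hb
    · exact hg'⟩

end EGraph

lemma isConnectedObj_of_globBoundaries : ∀ (n : ℕ) {S D : GlobCat.{v} n} (i : S ⟶ D),
    GlobBoundaries n i → IsConnectedObj D
  | 0, _, _, _, h => by
    have : Unique (⊤_ (Type v)) := Types.terminalIso.toEquiv.unique
    cases h
    · exact isConnectedObj_type (⊤_ (Type v))
    · exact isConnectedObj_type (⊤_ (Type v))
  | n + 1, _, _, _, h => by
    cases h with
    | vertex => exact EGraph.isConnectedObj_point (V := GlobCat n)
    | edge i hi => exact EGraph.isConnectedObj_edge (isConnectedObj_of_globBoundaries n i hi)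

/-! ### Cartesianness and lifting properties of the comparison on words and homs. -/

namespace GlobComparison

section

variable {V : Type u} [Category.{v} V] [HasFiniteProducts V] [HasCoproducts.{v} V]
  [DistribCoprod V] {V₀ : Type u} [Category.{v} V₀] [HasFiniteProducts V₀] [HasCoproducts.{v} V₀]
  [DistribCoprod V₀] {G : Type u'} [Category.{v} G] {U : V ⥤ G} {F : G ⥤ V} (B : NSOperad V)
  (adj : F ⊣ U) {U₀ : V₀ ⥤ G} {F₀ : G ⥤ V₀} (adj₀ : F₀ ⊣ U₀) {K : V₀ ⥤ V}
  [PreservesFiniteProducts K] (κ : K ⋙ U ≅ U₀) [PreservesFiniteProducts U]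
  [PreservesFiniteProducts U₀]

/-- The images of the terminal object of operations are terminal. -/
noncomputable def isTerminalMapUnit (U₀ : V₀ ⥤ G) [PreservesFiniteProducts U₀] (k : ℕ) :
    IsTerminal (U₀.obj ((NSOperad.terminal V₀).obj k)) :=
  IsTerminal.isTerminalObj U₀ _ terminalIsTerminal

/-- A product of squares. The square of labels is cartesian because `f` does not change labels, so
its horizontal sides are identities; the squares of letters are cartesian by `hφ`. -/
lemma isPullback_ω
    (hφ : ∀ {X Y : G} (f : X ⟶ Y), IsPullback (U.map (F.map f)) (AdjComparison.φ adj adj₀ κ X)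
      (AdjComparison.φ adj adj₀ κ Y) (U₀.map (F₀.map f)))
    {X X' : EGraph G} (f : X ⟶ X') {k : ℕ} {a b : X.obj} (p : Chain X.obj k a b) :
    IsPullback (U.map (wordOf F B f p)) (ω B adj adj₀ κ p) (ω B adj adj₀ κ (p.map f.obj))
      (U₀.map (wordOf F₀ (NSOperad.terminal V₀) f p)) := by
  let T := NSOperad.terminal V₀
  refine isPullback_prod (J := Option (Fin k))
    (P := fun o => U.obj (o.elim (B.obj k) fun i => F.obj (X.hom (p.src i) (p.tgt i))))
    (Q := fun o => U.obj (o.elim (B.obj k) fun i =>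
      F.obj (X'.hom (f.obj (p.src i)) (f.obj (p.tgt i)))))
    (R := fun o => U₀.obj (o.elim (T.obj k) fun i => F₀.obj (X.hom (p.src i) (p.tgt i))))
    (S := fun o => U₀.obj (o.elim (T.obj k) fun i =>
      F₀.obj (X'.hom (f.obj (p.src i)) (f.obj (p.tgt i)))))
    (t := fun o => match o with
      | none => 𝟙 (U.obj (B.obj k))
      | some i => U.map (F.map (f.hom (p.src i) (p.tgt i))))
    (l := fun o => match o with
      | none => (isTerminalMapUnit U₀ k).from _
      | some i => AdjComparison.φ adj adj₀ κ (X.hom (p.src i) (p.tgt i)))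
    (r := fun o => match o with
      | none => (isTerminalMapUnit U₀ k).from _
      | some i => AdjComparison.φ adj adj₀ κ (X'.hom (f.obj (p.src i)) (f.obj (p.tgt i))))
    (b := fun o => match o with
      | none => 𝟙 (U₀.obj (T.obj k))
      | some i => U₀.map (F₀.map (f.hom (p.src i) (p.tgt i))))
    ?_ ((isProd_word B F p).map U) ((isProd_word B F (p.map f.obj)).map U)
    ((isProd_word T F₀ p).map U₀) ((isProd_word T F₀ (p.map f.obj)).map U₀) ?_ ?_ ?_ ?_
  · rintro (_ | i)
    · exact IsPullback.of_horiz_isIso (fst := 𝟙 (U.obj (B.obj k)))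
        (g := 𝟙 (U₀.obj (T.obj k))) ⟨(isTerminalMapUnit U₀ k).hom_ext _ _⟩
    · exact hφ _
  · rintro (_ | i)
    · exact (U.map_comp _ _).symm.trans ((congrArg U.map (wordOf_fst F B f p)).trans
        (Category.comp_id _).symm)
    · exact (U.map_comp _ _).symm.trans ((congrArg U.map (wordOf_proj F B f p i)).trans
        (U.map_comp _ _))
  · rintro (_ | i)
    · exact (isTerminalMapUnit U₀ k).hom_ext _ _
    · exact ω_proj B adj adj₀ κ p i
  · rintro (_ | i)
    · exact (isTerminalMapUnit U₀ k).hom_ext _ _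
    · exact ω_proj B adj adj₀ κ (p.map f.obj) i
  · rintro (_ | i)
    · exact (isTerminalMapUnit U₀ k).hom_ext _ _
    · exact (U₀.map_comp _ _).symm.trans ((congrArg U₀.map (wordOf_proj F₀ T f p i)).trans
        (U₀.map_comp _ _))

/-- The map is a product of comparisons of letters with the map from the operations to a terminal
object. This is the only place where the lifting property of the operations enters. -/
lemma hasLiftingProperty_ω {S D : G} {i : S ⟶ D}
    (hφ : ∀ X, HasLiftingProperty i (AdjComparison.φ adj adj₀ κ X))
    (hB : ∀ k {T : G} (hT : IsTerminal T), HasLiftingProperty i (hT.from (U.obj (B.obj k))))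
    {X : EGraph G} {k : ℕ} {a b : X.obj} (p : Chain X.obj k a b) :
    HasLiftingProperty i (ω B adj adj₀ κ p) := by
  let T := NSOperad.terminal V₀
  refine hasLiftingProperty_prod (J := Option (Fin k))
    (P := fun o => U.obj (o.elim (B.obj k) fun i => F.obj (X.hom (p.src i) (p.tgt i))))
    (Q := fun o => U₀.obj (o.elim (T.obj k) fun i => F₀.obj (X.hom (p.src i) (p.tgt i))))
    (l := fun o => match o with
      | none => (isTerminalMapUnit U₀ k).from _
      | some i => AdjComparison.φ adj adj₀ κ (X.hom (p.src i) (p.tgt i)))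
    ?_ ((isProd_word B F p).map U) ((isProd_word T F₀ p).map U₀) ?_
  · rintro (_ | i)
    · exact hB k _
    · exact hφ _
  · rintro (_ | i)
    · exact (isTerminalMapUnit U₀ k).hom_ext _ _
    · exact ω_proj B adj adj₀ κ p i

variable [HasPullbacks G] [HasCells G] (hU : PreservesCoprods U) (hU₀ : PreservesCoprods U₀)
include hU hU₀

/-- A coproduct of the squares for single chains. The morphism `f` sends chains of `X` to chains of
`X'`, so the coproduct is taken along this map of index sets. -/
lemma isPullback_φHom
    (hφ : ∀ {X Y : G} (f : X ⟶ Y), IsPullback (U.map (F.map f)) (AdjComparison.φ adj adj₀ κ X)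
      (AdjComparison.φ adj adj₀ κ Y) (U₀.map (F₀.map f)))
    {X X' : EGraph G} (f : X ⟶ X') (a b : X.obj) :
    IsPullback (U.map (freeHomMap F B f a b)) (φHom B adj adj₀ κ X a b)
      (φHom B adj adj₀ κ X' (f.obj a) (f.obj b))
      (U₀.map (freeHomMap F₀ (NSOperad.terminal V₀) f a b)) := by
  obtain ⟨ι, Φ, hΦ⟩ := HasCells.out (V := G)
  refine hΦ.isPullback_coprod (I := Σ k, Chain X.obj k a b)
    (J := Σ k, Chain X'.obj k (f.obj a) (f.obj b)) (fun s => ⟨s.1, s.2.map f.obj⟩)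
    (t := fun s => U.map (wordOf F B f s.2)) (l := fun s => ω B adj adj₀ κ s.2)
    (r := fun s => ω B adj adj₀ κ s.2)
    (b := fun s => U₀.map (wordOf F₀ (NSOperad.terminal V₀) f s.2))
    (fun s => isPullback_ω B adj adj₀ κ hφ f s.2) (hU _ (isCoprod_inc B F a b))
    (hU _ (isCoprod_inc B F (f.obj a) (f.obj b))) (hU₀ _ (isCoprod_inc _ F₀ a b))
    (hU₀ _ (isCoprod_inc _ F₀ (f.obj a) (f.obj b))) (fun s => ?_) (fun s => ?_) (fun s => ?_)
    (fun s => ?_)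
  · exact (U.map_comp _ _).symm.trans ((congrArg U.map (inc_freeHomMap F B f s.2)).trans
      (U.map_comp _ _))
  · exact inc_φHom B adj adj₀ κ s.2
  · exact inc_φHom B adj adj₀ κ s.2
  · exact (U₀.map_comp _ _).symm.trans ((congrArg U₀.map (inc_freeHomMap F₀ _ f s.2)).trans
      (U₀.map_comp _ _))

/-- Connectedness of `D` reduces the problem to words along a single chain. -/
lemma hasLiftingProperty_φHom {S D : G} {i : S ⟶ D} (hD : IsConnectedObj D)
    (hφ : ∀ X, HasLiftingProperty i (AdjComparison.φ adj adj₀ κ X))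
    (hB : ∀ k {T : G} (hT : IsTerminal T), HasLiftingProperty i (hT.from (U.obj (B.obj k))))
    (X : EGraph G) (a b : X.obj) : HasLiftingProperty i (φHom B adj adj₀ κ X a b) :=
  hasLiftingProperty_coprod hD
    (fun s : (Σ k, Chain X.obj k a b) => hasLiftingProperty_ω B adj adj₀ κ hφ hB s.2)
    (hU _ (isCoprod_inc B F a b)) (hU₀ _ (isCoprod_inc _ F₀ a b))
    fun s => inc_φHom B adj adj₀ κ s.2

end

end GlobComparison

/-- Two functors to `G` exhibiting their sources as categories of algebras of monads, together with
a comparison inducing a cartesian morphism of monads which lifts against `I`. -/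
structure MonadComparison {G : Type u'} [Category.{v} G] (I : MorphismProperty G)
    {V : Type u} [Category.{v} V] (U : V ⥤ G) {V₀ : Type u} [Category.{v} V₀] (U₀ : V₀ ⥤ G) where
  hasCoproducts : HasCoproducts.{v} V
  hasCoproducts₀ : HasCoproducts.{v} V₀
  preservesProducts : PreservesFiniteProducts U
  preservesProducts₀ : PreservesFiniteProducts U₀
  preservesCoprods : PreservesCoprods U
  preservesCoprods₀ : PreservesCoprods U₀
  F : G ⥤ V
  adj : F ⊣ U
  F₀ : G ⥤ V₀
  adj₀ : F₀ ⊣ U₀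
  isEquivalence : (Monad.comparison adj).IsEquivalence
  isEquivalence₀ : (Monad.comparison adj₀).IsEquivalence
  K : V₀ ⥤ V
  preservesProductsK : PreservesFiniteProducts K
  κ : K ⋙ U ≅ U₀
  isPullback : ∀ {X Y : G} (f : X ⟶ Y), IsPullback (U.map (F.map f))
    (AdjComparison.φ adj adj₀ κ X) (AdjComparison.φ adj adj₀ κ Y) (U₀.map (F₀.map f))
  rlp : ∀ X, I.rlp (AdjComparison.φ adj adj₀ κ X)

/-- A monadic functor preserves limits and reflects isomorphisms, so cells in the base give cells
upstairs, provided coproducts are preserved. -/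
lemma hasCells_of_monadic {G : Type u'} [Category.{v} G] [HasCells G] {V : Type u} [Category.{v} V]
    {U : V ⥤ G} {F : G ⥤ V} (adj : F ⊣ U) [(Monad.comparison adj).IsEquivalence]
    [PreservesFiniteProducts U] (hU : PreservesCoprods U) : HasCells V :=
  have : PreservesLimitsOfSize.{0, 0} U := adj.rightAdjoint_preservesLimits
  let _ : MonadicRightAdjoint U := ⟨F, adj, inferInstance⟩
  have := reflectsIsomorphisms_of_monadic U
  HasCells.of_functor U hU

/-! ### The inductive step: from a base to categories enriched over an operad in it. -/

namespace MonadComparison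

variable {G : Type u'} [Category.{v} G] {I : MorphismProperty G}
    {V : Type u} [Category.{v} V] {U : V ⥤ G} {V₀ : Type u} [Category.{v} V₀] {U₀ : V₀ ⥤ G}
    [HasFiniteProducts V] [HasFiniteProducts V₀] [HasFiniteProducts G] [HasPullbacks G]
    [HasCells G] [HasInitial G]

lemma bijective_opCat [HasCoproducts.{v} V] [HasCoproducts.{v} V₀] [DistribCoprod V]
    [DistribCoprod V₀] {F : G ⥤ V} {F₀ : G ⥤ V₀} (adj : F ⊣ U) (adj₀ : F₀ ⊣ U₀) {K : V₀ ⥤ V}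
    [PreservesFiniteProducts K] (κ : K ⋙ U ≅ U₀) (B : NSOperad V) (X : EGraph G) :
    Function.Bijective (EGraph.Hom.obj (AdjComparison.φ (globAdjunction B adj)
      (globAdjunction (NSOperad.terminal V₀) adj₀) (ofTerminalForget B κ) X)) := by
  rw [GlobComparison.φ_eq]
  exact Function.bijective_id

/-- A comparison of monads induces a comparison of the monads for enriched categories over an
operad with those over the terminal operad. -/
lemma exists_opCat (c : MonadComparison I U U₀) (B : NSOperad V)
    (hI : ∀ {S D : G} (i : S ⟶ D), I i → IsConnectedObj D)
    (hB : ∀ k, I.rlp (terminal.from (U.obj (B.obj k)))) :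
    ∃ c : MonadComparison (EGraph.plus I) (OpCat.forget B ⋙ EGraph.map U)
      (OpCat.forget (NSOperad.terminal V₀) ⋙ EGraph.map U₀),
      ∀ X, Function.Bijective (EGraph.Hom.obj (AdjComparison.φ c.adj c.adj₀ c.κ X)) := by
  obtain ⟨h1, h2, h3, h4, hU, hU₀, F, adj, F₀, adj₀, e, e₀, K, hK, κ, hφ, hr⟩ := c
  -- Cells make products distribute over coproducts in `V` and `V₀`, as the construction of free
  -- categories requires.
  have := hasCells_of_monadic adj hU
  have := hasCells_of_monadic adj₀ hU₀
  have hB' : ∀ {S D : G} (i : S ⟶ D), I i → ∀ k {T : G} (hT : IsTerminal T),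
      HasLiftingProperty i (hT.from (U.obj (B.obj k))) := fun i hi k T hT =>
    hasLiftingProperty_of_isTerminal terminalIsTerminal hT (hB k i hi)
  refine ⟨⟨inferInstance, inferInstance, inferInstance, inferInstance,
    OpCat.preservesCoprods hU, OpCat.preservesCoprods hU₀, _, globAdjunction B adj, _,
    globAdjunction (NSOperad.terminal V₀) adj₀, isEquivalence_comparison_opCat B adj,
    isEquivalence_comparison_opCat _ adj₀, OpCat.ofTerminal K B, inferInstance,
    ofTerminalForget B κ, fun {X Y} f => ?_, fun X => ?_⟩,
    fun X => bijective_opCat adj adj₀ κ B X⟩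
  · have w := AdjComparison.φ_naturality (globAdjunction B adj)
      (globAdjunction (NSOperad.terminal V₀) adj₀) (ofTerminalForget B κ) f
    rw [GlobComparison.φ_eq, GlobComparison.φ_eq] at w ⊢
    have e1 : (OpCat.forget B ⋙ EGraph.map U).map ((EGraph.map F ⋙ FreeOpCat.functor B).map f) =
      ⟨f.obj, fun a b => U.map (GlobComparison.freeHomMap F B f a b)⟩ :=
      congrArg (EGraph.map U).map (GlobComparison.functor_map_eq F B f)
    have e2 : (OpCat.forget (NSOperad.terminal V₀) ⋙ EGraph.map U₀).map
        ((EGraph.map F₀ ⋙ FreeOpCat.functor (NSOperad.terminal V₀)).map f) =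
      ⟨f.obj, fun a b => U₀.map (GlobComparison.freeHomMap F₀ (NSOperad.terminal V₀) f a b)⟩ :=
      congrArg (EGraph.map U₀).map (GlobComparison.functor_map_eq F₀ (NSOperad.terminal V₀) f)
    rw [e1, e2] at w ⊢
    -- On objects the vertical maps are identities, so the square is trivially cartesian there.
    refine EGraph.isPullback w (fun x y h => ⟨y, ⟨h.symm, rfl⟩, fun z hz => hz.2⟩) fun p q => ?_
    have := GlobComparison.isPullback_φHom B adj adj₀ κ hU hU₀ hφ f p q
    -- `EGraph.isPullback` asks for a leg that ends in a transport, which is an identity here.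
    have e3 := Category.comp_id (U₀.map (GlobComparison.freeHomMap F₀ (NSOperad.terminal V₀) f p q))
    rw [← e3] at this
    exact this
  · rw [GlobComparison.φ_eq]
    exact EGraph.rlp_plus _ Function.surjective_id fun a b S D i hi =>
      GlobComparison.hasLiftingProperty_φHom B adj adj₀ κ hU hU₀ (hI i hi)
        (fun X => hr X i hi) (hB' i hi) X a b

end MonadComparison

/-! ### Contractibility of fundamental higher groupoids -/

lemma rlp_terminal_iff {C : Type u} [Category.{v} C] {I : MorphismProperty C} {X T : C}
    (hT : IsTerminal T) :
    I.rlp (hT.from X) ↔ ∀ ⦃S D : C⦄ (i : S ⟶ D), I i → ∀ s : S ⟶ X, ∃ l : D ⟶ X, i ≫ l = s := by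
  refine ⟨fun h S D i hi s => ?_, fun h S D i hi => hasLiftingProperty_of_exists fun s d w => ?_⟩
  · obtain ⟨l, hl, -⟩ := exists_lift (h i hi) s (hT.from D) (hT.hom_ext _ _)
    exact ⟨l, hl⟩
  · obtain ⟨l, hl⟩ := h i hi s
    exact ⟨l, hl, hT.hom_ext _ _⟩

namespace PathInterval

variable {C : Type u} [Category.{v} C] [HasFiniteLimits C] [HasFiniteColimits C]
  (𝕀 : PathInterval C)

/-- A space is weakly contractible if maps from spheres to it extend to disks. -/
def IsContractible (X : C) : Prop :=
  ∀ ⦃S D : C⦄ (i : S ⟶ D), 𝕀.Spheres i → ∀ s : S ⟶ X, ∃ l : D ⟶ X, i ≫ l = s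

variable {𝕀}

lemma IsContractible.of_iso {X Y : C} (h : 𝕀.IsContractible X) (e : X ≅ Y) :
    𝕀.IsContractible Y := fun S D i hi s => by
  obtain ⟨l, hl⟩ := h i hi (s ≫ e.inv)
  exact ⟨l ≫ e.hom, by rw [← Category.assoc, hl, Category.assoc, e.inv_hom_id, Category.comp_id]⟩

lemma IsContractible.nonempty {X : C} (h : 𝕀.IsContractible X) : Nonempty (⊤_ C ⟶ X) :=
  ⟨(h _ .empty (initial.to X)).choose⟩

/-- The canonical map from the cylinder to the suspension. -/
noncomputable def cylinder (𝕀 : PathInterval C) (Z : C) : Z ⨯ 𝕀.I ⟶ 𝕀.susp Z := pushout.inl _ _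

/-- The inclusion of the two poles of the suspension. -/
noncomputable def poles (𝕀 : PathInterval C) (Z : C) : (⊤_ C) ⨿ (⊤_ C) ⟶ 𝕀.susp Z := pushout.inr _ _

lemma ends_cylinder (Z : C) : 𝕀.ends Z ≫ 𝕀.cylinder Z =
    coprod.map (terminal.from Z) (terminal.from Z) ≫ 𝕀.poles Z := pushout.condition

lemma zero_cylinder (Z : C) : prod.lift (𝟙 Z) (terminal.from Z ≫ 𝕀.zero) ≫ 𝕀.cylinder Z =
    terminal.from Z ≫ coprod.inl ≫ 𝕀.poles Z := by
  have := congrArg (coprod.inl ≫ ·) (𝕀.ends_cylinder Z)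
  simpa [ends, coprod.inl_desc, coprod.inl_map_assoc] using this

lemma one_cylinder (Z : C) : prod.lift (𝟙 Z) (terminal.from Z ≫ 𝕀.one) ≫ 𝕀.cylinder Z =
    terminal.from Z ≫ coprod.inr ≫ 𝕀.poles Z := by
  have := congrArg (coprod.inr ≫ ·) (𝕀.ends_cylinder Z)
  simpa [ends, coprod.inr_desc, coprod.inr_map_assoc] using this

lemma cylinder_suspMap {Z Z' : C} (f : Z ⟶ Z') :
    𝕀.cylinder Z ≫ 𝕀.suspMap f = prod.map f (𝟙 _) ≫ 𝕀.cylinder Z' := pushout.inl_desc _ _ _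

lemma poles_suspMap {Z Z' : C} (f : Z ⟶ Z') : 𝕀.poles Z ≫ 𝕀.suspMap f = 𝕀.poles Z' :=
  (pushout.inr_desc _ _ _).trans (Category.id_comp _)

lemma susp_hom_ext {Z X : C} {f g : 𝕀.susp Z ⟶ X} (h : 𝕀.cylinder Z ≫ f = 𝕀.cylinder Z ≫ g)
    (h' : 𝕀.poles Z ≫ f = 𝕀.poles Z ≫ g) : f = g := pushout.hom_ext h h'

/-- One half of the adjunction between suspension and paths: a family of paths from `a` to `b` is
constant on the ends of the cylinder, so it descends to the suspension. -/
lemma exists_suspDesc {X Z : C} {a b : ⊤_ C ⟶ X} (s : Z ⟶ 𝕀.path a b) : ∃ g : 𝕀.susp Z ⟶ X,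
    𝕀.cylinder Z ≫ g = prod.map s (𝟙 _) ≫ 𝕀.ev a b ∧ 𝕀.poles Z ≫ g = coprod.desc a b := by
  have w : 𝕀.ends Z ≫ prod.map s (𝟙 _) ≫ 𝕀.ev a b =
      coprod.map (terminal.from Z) (terminal.from Z) ≫ coprod.desc a b := by
    refine coprod.hom_ext ?_ ?_
    · rw [ends, coprod.inl_desc_assoc, zero_map_ev, coprod.inl_map_assoc, coprod.inl_desc]
    · rw [ends, coprod.inr_desc_assoc, one_map_ev, coprod.inr_map_assoc, coprod.inr_desc]
  exact ⟨pushout.desc _ _ w, pushout.inl_desc _ _ w, pushout.inr_desc _ _ w⟩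

/-- The spaces of paths in a weakly contractible space are weakly contractible. -/
lemma IsContractible.path {X : C} (h : 𝕀.IsContractible X) (a b : ⊤_ C ⟶ X) :
    𝕀.IsContractible (𝕀.path a b) := fun S D i hi s => by
  obtain ⟨s', hs, hs'⟩ := exists_suspDesc s
  -- Extending `s` along `i` into a path object amounts to extending its transpose along the
  -- suspension of `i`, which is again among the sphere inclusions.
  obtain ⟨g, hg⟩ := h _ (.susp i hi) s'
  have h1 : 𝕀.poles D ≫ g = coprod.desc a b := by
    rw [← hs', ← hg, ← Category.assoc, poles_suspMap]
  have h2 : prod.map i (𝟙 _) ≫ 𝕀.cylinder D ≫ g = prod.map s (𝟙 _) ≫ 𝕀.ev a b := by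
    rw [← hs, ← hg, ← Category.assoc, ← Category.assoc, cylinder_suspMap]
  refine ⟨𝕀.curry a b (𝕀.cylinder D ≫ g) ?_ ?_, 𝕀.path_ext ?_⟩
  · rw [← Category.assoc, zero_cylinder, Category.assoc, Category.assoc, h1, coprod.inl_desc]
  · rw [← Category.assoc, one_cylinder, Category.assoc, Category.assoc, h1, coprod.inr_desc]
  · rw [map_comp_id, Category.assoc, curry_ev, h2]

/-- The path object is weakly contractible, hence has a point, and a point of it is a path. -/
lemma IsContractible.joined {X : C} (h : 𝕀.IsContractible X) (a b : ⊤_ C ⟶ X) :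
    𝕀.Joined a b := by
  obtain ⟨γ⟩ := (h.path a b).nonempty
  refine ⟨prod.lift (terminal.from _) (𝟙 _) ≫ prod.map γ (𝟙 _) ≫ 𝕀.ev a b, ?_, ?_⟩
  · have := 𝕀.zero_map_ev γ
    rw [Subsingleton.elim (terminal.from (⊤_ C)) (𝟙 _), Category.id_comp, Category.id_comp] at this
    refine Eq.trans ?_ this
    rw [← Category.assoc]
    congr 1
    ext
    simp [prod.lift_snd]
  · have := 𝕀.one_map_ev γ
    rw [Subsingleton.elim (terminal.from (⊤_ C)) (𝟙 _), Category.id_comp, Category.id_comp] at this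
    refine Eq.trans ?_ this
    rw [← Category.assoc]
    congr 1
    ext
    simp [prod.lift_snd]

end PathInterval

/-! ### Limits, cells and terminal objects of globular sets. -/

instance GlobCat.hasFiniteProducts : ∀ n, HasFiniteProducts (GlobCat.{v} n)
  | 0 => inferInstanceAs (HasFiniteProducts (Type v))
  | n + 1 =>
    haveI := GlobCat.hasFiniteProducts n
    inferInstanceAs (HasFiniteProducts (EGraph (GlobCat n)))

instance GlobCat.hasPullbacks : ∀ n, HasPullbacks (GlobCat.{v} n)
  | 0 => inferInstanceAs (HasPullbacks (Type v))
  | n + 1 =>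
    haveI := GlobCat.hasPullbacks n
    inferInstanceAs (HasPullbacks (EGraph (GlobCat n)))

instance GlobCat.hasCells : ∀ n, HasCells (GlobCat.{v} n)
  | 0 => inferInstanceAs (HasCells (Type v))
  | n + 1 =>
    haveI := GlobCat.hasCells n
    inferInstanceAs (HasCells (EGraph (GlobCat n)))

/-- A graph with one object whose hom is terminal is terminal. -/
noncomputable def EGraph.isTerminalPoint (V : Type u) [Category.{v} V] [HasFiniteProducts V] :
    IsTerminal (⟨PUnit, fun _ _ => ⊤_ V⟩ : EGraph V) :=
  IsTerminal.ofUniqueHom (fun X => ⟨fun _ => ⟨⟩, fun _ _ => terminal.from _⟩) fun X f =>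
    EGraph.hom_ext (fun _ => rfl) fun _ _ => terminalIsTerminal.hom_ext _ _

/-! ### Weak contractibility of fundamental higher groupoids. -/

namespace PathInterval.Action

variable {C : Type u} [Category.{v} C] [HasFiniteLimits C] [HasFiniteColimits C]
  {𝕀 : PathInterval C} {A : NSOperad C} (α : 𝕀.Action A)

/-- The fundamental higher groupoids of a weakly contractible space are weakly contractible. -/
lemma rlp_trimble : ∀ (n : ℕ) {X : C}, 𝕀.IsContractible X → ∀ {T : GlobCat.{v} n} (hT : IsTerminal T),
    (GlobBoundaries n).rlp (hT.from ((α.trimble n).U.obj ((α.trimble n).Q.obj X)))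
  | 0, X, h, T, hT => by
    have h1 : Subsingleton (𝕀.π₀.obj X) := ⟨fun x y => by
      induction x using Quot.ind with | _ x
      induction y using Quot.ind with | _ y
      exact Quot.sound (h.joined x y)⟩
    obtain ⟨x⟩ := h.nonempty
    refine (rlp_terminal_iff hT).2 fun S D i hi s => ?_
    -- There is exactly one path component, so the constant map extends every map.
    exact ⟨(↾fun _ => (Quot.mk _ x : 𝕀.π₀.obj X) : (D : Type v) ⟶ 𝕀.π₀.obj X),
      ConcreteCategory.hom_ext (C := Type v) _ _ fun _ => h1.elim _ _⟩
  | n + 1, X, h, T, hT => by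
    intro S D i hi
    -- The choice of terminal object is immaterial. With this one the hom maps again go to a
    -- terminal object, as in the induction hypothesis.
    refine hasLiftingProperty_of_isTerminal (EGraph.isTerminalPoint (GlobCat n)) hT
      (f := (EGraph.isTerminalPoint (GlobCat n)).from _) ?_
    -- The action lifts `P` only up to isomorphism, so the homs are path objects up to isomorphism.
    let e : (α.lift.obj X).toEGraph ⟶ 𝕀.P.obj X := α.iso.hom.app X
    have : IsIso e := inferInstanceAs (IsIso (α.iso.hom.app X))
    refine EGraph.rlp_plus (I := GlobBoundaries n) _ (fun y => ?_) (fun a b => ?_) i hi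
    · obtain ⟨x⟩ := h.nonempty
      obtain ⟨z, -⟩ := (EGraph.bijective_of_isIso e).2 x
      exact ⟨z, rfl⟩
    · have := EGraph.isIso_hom e a b
      have hp : 𝕀.IsContractible ((α.lift.obj X).hom a b) :=
        (h.path (e.obj a) (e.obj b)).of_iso (asIso (e.hom a b)).symm
      exact rlp_trimble n hp terminalIsTerminal

end PathInterval.Action

/-- The comparison functor of the identity adjunction is an equivalence. -/
lemma isEquivalence_comparison_id (V : Type u) [Category.{v} V] :
    (Monad.comparison (Adjunction.id (C := V))).IsEquivalence :=
  isEquivalence_comparison _ (fun A => 𝟙 A) (fun X => 𝟙 X) (fun _ => rfl) (fun _ => rfl)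
    fun A a h _ => ⟨A, a, by
      have h' : a = 𝟙 A := (Category.id_comp _).symm.trans h
      have key : IsCoequalizer a (𝟙 A) a := by
        subst h'
        exact ⟨rfl, fun W k _ => ⟨k, Category.id_comp k, fun l hl =>
          (Category.id_comp l).symm.trans hl⟩⟩
      exact ⟨key, key⟩⟩

/-- In dimension zero both sides are sets. The comparison of monads is determined by the units,
which are identities, so it is an identity and lifts against everything. -/
lemma exists_monadComparison_id (I : MorphismProperty (Type v)) :
    Nonempty (MonadComparison I (𝟭 (Type v)) (𝟭 (Type v))) := by
  have e := isEquivalence_comparison_id (Type v)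
  have h : ∀ X : Type v, AdjComparison.φ Adjunction.id Adjunction.id
      (Functor.leftUnitor (𝟭 (Type v))) X = 𝟙 X := fun X =>
    (Category.id_comp _).symm.trans (AdjComparison.unit_φ Adjunction.id Adjunction.id
      (Functor.leftUnitor (𝟭 (Type v))) X)
  refine ⟨⟨inferInstance, inferInstance, inferInstance, inferInstance, fun J X P m hm => hm,
    fun J X P m hm => hm, _, Adjunction.id, _, Adjunction.id, e, e, 𝟭 _, inferInstance,
    Functor.leftUnitor _, fun {X Y} f => ?_, fun X => ?_⟩⟩
  · rw [h, h]
    have sq : IsPullback f (𝟙 X) (𝟙 Y) f := IsPullback.of_vert_isIso ⟨by simp⟩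
    exact sq
  · rw [h]
    exact fun S D i hi => hasLiftingProperty_of_exists fun s d w =>
      ⟨d, w.symm.trans (Category.comp_id s), Category.comp_id d⟩

/-! ### The induction on the dimension. -/

namespace PathInterval.Action

variable {C : Type u} [Category.{v} C] [HasFiniteLimits C] [HasFiniteColimits C]
  {𝕀 : PathInterval C} {A : NSOperad C} (α : 𝕀.Action A)

/-- The inductive step is applied to the image of `A` in Trimble `n`-categories, whose operations
lift by the weak contractibility of fundamental `n`-groupoids. Bijectivity on objects is not needed
for the induction, so it is dropped at each step and produced anew. -/
lemma exists_monadComparison (hA : 𝕀.IsContractibleOperad A) : ∀ n : ℕ,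
    ∃ c : MonadComparison (GlobBoundaries n) (α.trimble n).U (strictCat.{v} n).U,
      ∀ X, GlobCat.IsBijectiveOnObjects n (AdjComparison.φ c.adj c.adj₀ c.κ X)
  | 0 => by
    obtain ⟨c⟩ := exists_monadComparison_id SetBoundaries.{v}
    exact ⟨c, fun _ => trivial⟩
  | n + 1 => by
    obtain ⟨c, -⟩ := exists_monadComparison hA n
    exact c.exists_opCat (A.map (α.trimble n).Q) (isConnectedObj_of_globBoundaries n) fun k =>
      α.rlp_trimble n ((rlp_terminal_iff terminalIsTerminal).1 (hA k)) terminalIsTerminal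

theorem isAlgebrasOfContractibleOperad (hA : 𝕀.IsContractibleOperad A) (n : ℕ) :
    IsAlgebrasOfContractibleOperad n (α.trimble n).U := by
  obtain ⟨c, hc⟩ := α.exists_monadComparison hA n
  have := c.isEquivalence
  have := c.isEquivalence₀
  exact ⟨c.adj₀.toMonad, ⟨c.adj.toMonad, AdjComparison.monadHom c.adj c.adj₀ c.κ,
    fun _ _ f => c.isPullback f, hc⟩, isAlgebrasOf_toMonad c.adj₀, c.rlp, isAlgebrasOf_toMonad c.adj⟩

end PathInterval.Action

/-! ### Spaces of reparametrisations are contractible -/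

namespace TopInterval

/-- A space is equiconnected if there are paths between any two of its points which depend
continuously on the points, and are constant if the points agree. -/
def Equiconnected (X : Type) [TopologicalSpace X] : Prop :=
  ∃ h : X × X × unitInterval → X, Continuous h ∧ (∀ x y, h (x, y, 0) = x) ∧
    (∀ x y, h (x, y, 1) = y) ∧ ∀ x t, h (x, x, t) = x

variable {X : Type} [TopologicalSpace X]

lemma Equiconnected.nonempty_path (hX : Equiconnected X) (a b : X) : Nonempty (Path a b) := by
  obtain ⟨h, hc, h0, h1, -⟩ := hX
  exact ⟨⟨⟨fun t => h (a, b, t), by fun_prop⟩, h0 a b, h1 a b⟩⟩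

/-- Paths are deformed pointwise. Their ends stay fixed because the chosen paths in `X` between
equal points are constant, which is why this condition is part of equiconnectedness. -/
lemma Equiconnected.path (hX : Equiconnected X) (a b : X) : Equiconnected (Path a b) := by
  obtain ⟨h, hc, h0, h1, h2⟩ := hX
  have hev : Continuous fun q : Path a b × unitInterval => q.1 q.2 := continuous_eval
  refine ⟨fun q => ⟨⟨fun u => h (q.1 u, q.2.1 u, q.2.2), by fun_prop⟩, ?_, ?_⟩, ?_, ?_, ?_, ?_⟩
  · change h (q.1 0, q.2.1 0, q.2.2) = a
    rw [q.1.source, q.2.1.source, h2]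
  · change h (q.1 1, q.2.1 1, q.2.2) = b
    rw [q.1.target, q.2.1.target, h2]
  · refine Path.continuous_uncurry_iff.1 ?_
    change Continuous fun q : (Path a b × Path a b × unitInterval) × unitInterval =>
      h (q.1.1 q.2, q.1.2.1 q.2, q.1.2.2)
    have e1 : Continuous fun q : (Path a b × Path a b × unitInterval) × unitInterval =>
      q.1.1 q.2 := hev.comp (by fun_prop : Continuous fun q :
        (Path a b × Path a b × unitInterval) × unitInterval => (q.1.1, q.2))
    have e2 : Continuous fun q : (Path a b × Path a b × unitInterval) × unitInterval =>
      q.1.2.1 q.2 := hev.comp (by fun_prop : Continuous fun q :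
        (Path a b × Path a b × unitInterval) × unitInterval => (q.1.2.1, q.2))
    fun_prop
  · exact fun γ δ => Path.ext (funext fun u => h0 _ _)
  · exact fun γ δ => Path.ext (funext fun u => h1 _ _)
  · exact fun γ t => Path.ext (funext fun u => h2 _ _)

/-- Maps from spheres to equiconnected spaces extend to disks. -/
lemma exists_extension {S D : TopCat.{0}} {i : S ⟶ D} (hi : unitPathInterval.Spheres i) :
    ∀ {X : TopCat.{0}}, Nonempty X → Equiconnected X → ∀ s : S ⟶ X, ∃ l : D ⟶ X, i ≫ l = s := by
  induction hi with
  | empty =>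
    intro X ⟨x⟩ _ s
    exact ⟨TopCat.ofHom (ContinuousMap.const _ x), initialIsInitial.hom_ext _ _⟩
  | @susp S D i hi ih =>
    intro X _ hX s
    let a : ⊤_ TopCat.{0} ⟶ X := coprod.inl ≫ unitPathInterval.poles S ≫ s
    let b : ⊤_ TopCat.{0} ⟶ X := coprod.inr ≫ unitPathInterval.poles S ≫ s
    have h0 : prod.lift (𝟙 _) (terminal.from _ ≫ unitPathInterval.zero) ≫
        unitPathInterval.cylinder S ≫ s = terminal.from _ ≫ a := by
      rw [← Category.assoc, PathInterval.zero_cylinder, Category.assoc, Category.assoc]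
    have h1 : prod.lift (𝟙 _) (terminal.from _ ≫ unitPathInterval.one) ≫
        unitPathInterval.cylinder S ≫ s = terminal.from _ ≫ b := by
      rw [← Category.assoc, PathInterval.one_cylinder, Category.assoc, Category.assoc]
    -- A map from the suspension is a family of paths between the images of the poles. It is
    -- extended in the path space, by the induction hypothesis for that space, and then turned back
    -- into a map from a suspension.
    obtain ⟨l, hl⟩ := ih (X := unitPathInterval.path a b) (hX.nonempty_path (pt a) (pt b))
      (hX.path (pt a) (pt b)) (unitPathInterval.curry a b _ h0 h1)
    obtain ⟨g, hg, hg'⟩ := PathInterval.exists_suspDesc l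
    refine ⟨g, PathInterval.susp_hom_ext ?_ ?_⟩
    · rw [← Category.assoc, PathInterval.cylinder_suspMap, Category.assoc, hg, ← Category.assoc,
        ← PathInterval.map_comp_id, hl, PathInterval.curry_ev]
    · rw [← Category.assoc, PathInterval.poles_suspMap, hg']
      exact coprod.hom_ext (coprod.inl_desc _ _) (coprod.inr_desc _ _)

/-! ### Convexity of the spaces of reparametrisations. -/

namespace Reparam

variable (k : ℕ)

/-- The linear reparametrisation. -/
noncomputable def linear : Reparam k :=
  ⟨⟨fun t => k * t, by fun_prop⟩, by simp, by simp, fun t =>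
    ⟨mul_nonneg (Nat.cast_nonneg k) t.2.1, mul_le_of_le_one_right (Nat.cast_nonneg k) t.2.2⟩⟩

variable {k} in
/-- The convex combinations of two reparametrisations. -/
noncomputable def combine (f g : Reparam k) (t : unitInterval) : Reparam k :=
  ⟨⟨fun u => (1 - t : ℝ) * f u + t * g u,
    (continuous_const.mul f.1.continuous).add (continuous_const.mul g.1.continuous)⟩, by
    refine ⟨?_, ?_, fun u => ?_⟩
    · change (1 - t : ℝ) * f 0 + t * g 0 = 0
      rw [f.zero, g.zero]
      ring
    · change (1 - t : ℝ) * f 1 + t * g 1 = k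
      rw [f.one, g.one]
      ring
    · exact (convex_Icc (0 : ℝ) k) ⟨f.nonneg u, f.le u⟩ ⟨g.nonneg u, g.le u⟩
        (sub_nonneg.2 t.2.2) t.2.1 (by ring)⟩

variable {k} in
lemma combine_apply (f g : Reparam k) (t u : unitInterval) :
    combine f g t u = (1 - t : ℝ) * f u + t * g u := rfl

/-- The space is convex, and straight segments depend continuously on their ends and are constant
when the ends agree. -/
lemma equiconnected : Equiconnected (Reparam k) := by
  refine ⟨fun q => combine q.1 q.2.1 q.2.2, continuous_of_eval ?_, fun f g => ext fun u => ?_,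
    fun f g => ext fun u => ?_, fun f t => ext fun u => ?_⟩
  · simp only [combine_apply]
    have e1 : Continuous fun q : (Reparam k × Reparam k × unitInterval) × unitInterval =>
      q.1.1 q.2 := continuous_eval' (by fun_prop) (by fun_prop)
    have e2 : Continuous fun q : (Reparam k × Reparam k × unitInterval) × unitInterval =>
      q.1.2.1 q.2 := continuous_eval' (by fun_prop) (by fun_prop)
    fun_prop
  · simp [combine_apply]
  · simp [combine_apply]
  · rw [combine_apply]
    ring

end Reparam

lemma isContractibleOperad_reparam : unitPathInterval.IsContractibleOperad reparamOperad :=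
  fun k => (rlp_terminal_iff terminalIsTerminal).2 fun S D i hi s =>
    exists_extension hi (X := TopCat.of (Reparam k)) ⟨Reparam.linear k⟩ (Reparam.equiconnected k) s

end TopInterval

theorem mainTheorem8 :
    (∀ (C : Type u) [Category.{v} C] [HasFiniteLimits C] [HasFiniteColimits C]
      (𝕀 : PathInterval C) (A : NSOperad C) (α : 𝕀.Action A), 𝕀.IsContractibleOperad A →
      ∀ n : ℕ, IsAlgebrasOfContractibleOperad n (α.trimble n).U) ∧
    ∀ n : ℕ, IsAlgebrasOfContractibleOperad n (TopInterval.pathAction.trimble n).U :=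
  ⟨fun _ _ _ _ _ _ α hA n => α.isAlgebrasOfContractibleOperad hA n,
    fun n => TopInterval.pathAction.isAlgebrasOfContractibleOperad
      TopInterval.isContractibleOperad_reparam n⟩
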